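/- **Setting.** Let $\mathfrak g$ be a compact real Lie algebra (its Killing form $\varkappa$ is negative definite) with an involutive automorphism $\sigma$. Put $\mathfrak k=\mathrm{Eig}(\sigma,1)$, $\mathfrak m=\mathrm{Eig}(\sigma,-1)$, let $\mathfrak a\subset\mathfrak m$ be a maximal flat (abelian) subspace and $\mathfrak t\supset\mathfrak a$ a Cartan subalgebra (maximal abelian subalgebra) of $\mathfrak g$. Let $\langle X,Y\rangle=-\varkappa(X,Y)$ on $\mathfrak g$. For a linear form $\alpha\in(\mathfrak t^{\mathbb C})^*$ put $\mathfrak g_\alpha=\{X\in\mathfrak g: \mathrm{ad}(H)^2X=\alpha(H)^2X\ \forall H\in\mathfrak t\}$; let $\Delta=\{\alpha\ne0:\mathfrak g_\alpha\neq\{0\}\}$ be the set of roots, $\sigma(\alpha)=\alpha\circ\sigma^{-1}$, and for $\alpha \in \Delta$ let $\alpha^\sharp\in i\mathfrak t$ be the vector with $\alpha=\varkappa(\alpha^\sharp,\cdot)$ on $\mathfrak t$. Put $\mathfrak k_\alpha=(\mathfrak g_\alpha+\mathfrak g_{\sigma(\alpha)})\cap\mathfrak k$ and $\mathfrak m_\alpha=(\mathfrak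 g_\alpha+\mathfrak g_{\sigma(\alpha)})\cap\mathfrak m$. Let $(X_\alpha)_{\alpha\in\Delta}$ be a Chevalley basis of $\mathfrak g^{\mathbb C}$: vectors with $[H,X_\alpha]=\alpha(H)X_\alpha$ for $H\in\mathfrak t$, such that there are real Chevalley constants $c_{\alpha,\beta}$ ($\alpha,\beta\in\Delta$) with $[X_\alpha,X_\beta]=c_{\alpha,\beta}X_{\alpha+\beta}$ if $\alpha+\beta\in\Delta$, $[X_\alpha,X_{-\alpha}]=\alpha^\sharp$, $[X_\alpha,X_\beta]=0$ otherwise, $c_{-\alpha,-\beta}=-c_{\alpha,\beta}$, and $c_{\alpha,\beta}=0$ if $\alpha+\beta\notin\Delta$, $\beta\ne-\alpha$. Assume that $X_{-\alpha}=-\overline{X_\alpha}$ and that the numbers $s_\alpha$ defined by $\sigma(X_\alpha)=s_\alpha X_{\sigma(\alpha)}$ all lie in $\{1,-1\}$. Put $V_\alpha(z)=\frac1{\sqrt2}(zX_\alpha-\bar zX_{-\alpha})$ for $\alpha\in\Delta$, $z\in\mathbb C$; for every root $\alpha$ put $$K_\alpha(z)=\tfrac1{\sqrt2}\bigl(V_\alpha(z)+s_\alpha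 V_{\sigma(\alpha)}(z)\bigr),\qquad M_\alpha(z)=\tfrac1{\sqrt2}\bigl(V_\alpha(z)-s_\alpha V_{\sigma(\alpha)}(z)\bigr),$$ and, with $\zeta_\alpha=i$ if $s_\alpha=1$, $\zeta_\alpha=1$ if $s_\alpha=-1$, and $\zeta_\alpha'=1+i-\zeta_\alpha$, put $\widetilde K_\alpha(t)=V_\alpha(\zeta_\alpha t)$ and $\widetilde M_\alpha(t)=V_\alpha(\zeta'_\alpha t)$ for $t\in\mathbb R$. All these vectors are defined to be $0$ if the index is not a root. Below $z,z'\in\mathbb C$, $t,t'\in\mathbb R$, and $\alpha,\beta\in\Delta$; call $\alpha$ *generic* if $\sigma(\alpha)\notin\{\alpha,-\alpha\}$. **(a)** If $\alpha$ is generic, $\mathfrak k_\alpha=\{K_\alpha(z):z\in\mathbb C\}$ and $\mathfrak m_\alpha=\{M_\alpha(z):z\in\mathbb C\}$. If $\sigma(\alpha)=\alpha$, $\mathfrak k_\alpha=\{V_\alpha(z):z\in\mathbb C\}$ and $\mathfrak m_\alpha=\{0\}$. If $\sigma(\alpha)=-\alpha$, $\mathfrak k_\alpha=\{\widetilde K_\alpha(t):t\in\mathbb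 R\}$ and $\mathfrak m_\alpha=\{\widetilde M_\alpha(t):t\in\mathbb R\}$. **(b)** The spaces $\mathfrak t\cap\mathfrak k,\ \mathfrak a,\ \mathfrak k_\alpha,\ \mathfrak m_\alpha$ are pairwise orthogonal, and so are $\mathfrak t\cap\mathfrak k,\ \mathfrak a,\ \mathfrak k_\alpha,\ \mathfrak m_\alpha,\ \mathfrak k_\beta,\ \mathfrak m_\beta$ if $\beta\notin\{\pm\alpha,\pm\sigma(\alpha)\}$. Moreover $\langle K_\alpha(z),K_\alpha(z')\rangle=\langle M_\alpha(z),M_\alpha(z')\rangle=\mathrm{Re}(z\overline{z'})$ for generic $\alpha$; $\langle V_\alpha(z),V_\alpha(z')\rangle=\mathrm{Re}(z\overline{z'})$ if $\sigma(\alpha)=\alpha$; $\langle\widetilde K_\alpha(t),\widetilde K_\alpha(t')\rangle=\langle\widetilde M_\alpha(t),\widetilde M_\alpha(t')\rangle=tt'$ if $\sigma(\alpha)=-\alpha$. **(c)** The Lie brackets are as follows. For all $\alpha,\beta\in\Delta$ and $H\in\mathfrak t$: $[H,V_\alpha(z)]=V_\alpha(\alpha(H)z)$ and $$[V_\alpha(z),V_\beta(z')]=\begin{cases}\frac1{\sqrt2}\bigl(c_{\alpha,\beta}V_{\alpha+\beta}(zz')-c_{\alpha,-\beta}V_{\alpha-\beta}(z\overline{z'})\bigr)&\beta\notin\{\pm\alpha\},\\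 \mathrm{Im}(\bar zz')\,i\alpha^\sharp&\beta=\alpha,\\ \mathrm{Im}(zz')\,i\alpha^\sharp&\beta=-\alpha.\end{cases}\tag{$*$}$$ (i) For generic $\beta$: $K_{\sigma(\beta)}(z)=s_\beta K_\beta(z)$, $M_{\sigma(\beta)}(z)=-s_\beta M_\beta(z)$, $K_{-\beta}(z)=-K_\beta(\bar z)$, $M_{-\beta}(z)=-M_\beta(\bar z)$. For generic $\alpha,\beta$ with $\beta\notin\{\pm\alpha,\pm\sigma(\alpha)\}$: $$[K_\alpha(z),K_\beta(z')]=\tfrac12\bigl(c_{\alpha,\beta}K_{\alpha+\beta}(zz')-c_{\alpha,-\beta}K_{\alpha-\beta}(z\overline{z'})+s_\alpha c_{\sigma(\alpha),\beta}K_{\sigma(\alpha)+\beta}(zz')-s_\alpha c_{\sigma(\alpha),-\beta}K_{\sigma(\alpha)-\beta}(z\overline{z'})\bigr),$$ $$[K_\alpha(z),M_\beta(z')]=\tfrac12\bigl(c_{\alpha,\beta}M_{\alpha+\beta}(zz')-c_{\alpha,-\beta}M_{\alpha-\beta}(z\overline{z'})+s_\alpha c_{\sigma(\alpha),\beta}M_{\sigma(\alpha)+\beta}(zz')-s_\alpha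 c_{\sigma(\alpha),-\beta}M_{\sigma(\alpha)-\beta}(z\overline{z'})\bigr),$$ $$[M_\alpha(z),M_\beta(z')]=\tfrac12\bigl(c_{\alpha,\beta}K_{\alpha+\beta}(zz')-c_{\alpha,-\beta}K_{\alpha-\beta}(z\overline{z'})-s_\alpha c_{\sigma(\alpha),\beta}K_{\sigma(\alpha)+\beta}(zz')+s_\alpha c_{\sigma(\alpha),-\beta}K_{\sigma(\alpha)-\beta}(z\overline{z'})\bigr).$$ For generic $\alpha$: $$[K_\alpha(z),K_\alpha(z')]=\tfrac12\mathrm{Im}(\bar zz')\,i(\alpha^\sharp+\sigma(\alpha)^\sharp)+\tfrac1{\sqrt2}s_\alpha c_{\alpha,-\sigma(\alpha)}\widetilde K_{\alpha-\sigma(\alpha)}(\mathrm{Im}(\bar zz')),$$ $$[K_\alpha(z),M_\alpha(z')]=\tfrac12\mathrm{Im}(\bar zz')\,i(\alpha^\sharp-\sigma(\alpha)^\sharp)+\tfrac1{\sqrt2}s_\alpha c_{\alpha,-\sigma(\alpha)}\widetilde M_{\alpha-\sigma(\alpha)}(\mathrm{Re}(\bar zz')),$$ $$[M_\alpha(z),M_\alpha(z')]=\tfrac12\mathrm{Im}(\bar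 zz')\,i(\alpha^\sharp+\sigma(\alpha)^\sharp)-\tfrac1{\sqrt2}s_\alpha c_{\alpha,-\sigma(\alpha)}\widetilde K_{\alpha-\sigma(\alpha)}(\mathrm{Im}(\bar zz')).$$ (ii) If $\sigma(\alpha)=\alpha$ and $\beta$ is generic: $[V_\alpha(z),K_\beta(z')]=\frac1{\sqrt2}\bigl(c_{\alpha,\beta}K_{\alpha+\beta}(zz')-c_{\alpha,-\beta}K_{\alpha-\beta}(z\overline{z'})\bigr)$, and the same with $K$ replaced by $M$ throughout. (iii) If $\sigma(\alpha)=-\alpha$ and $\beta$ is generic: $$[\widetilde K_\alpha(t),K_\beta(z)]=\tfrac1{\sqrt2}\bigl(c_{\alpha,\beta}K_{\alpha+\beta}(\zeta_\alpha tz)-c_{\alpha,-\beta}K_{\alpha-\beta}(\zeta_\alpha t\bar z)\bigr),\quad [\widetilde K_\alpha(t),M_\beta(z)]=\tfrac1{\sqrt2}\bigl(c_{\alpha,\beta}M_{\alpha+\beta}(\zeta_\alpha tz)-c_{\alpha,-\beta}M_{\alpha-\beta}(\zeta_\alpha t\bar z)\bigr),$$ $$[\widetilde M_\alpha(t),K_\beta(z)]=\tfrac1{\sqrt2}\bigl(c_{\alpha,\beta}M_{\alpha+\beta}(\zeta'_\alpha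 tz)-c_{\alpha,-\beta}M_{\alpha-\beta}(\zeta'_\alpha t\bar z)\bigr),\quad [\widetilde M_\alpha(t),M_\beta(z)]=\tfrac1{\sqrt2}\bigl(c_{\alpha,\beta}K_{\alpha+\beta}(\zeta'_\alpha tz)-c_{\alpha,-\beta}K_{\alpha-\beta}(\zeta'_\alpha t\bar z)\bigr).$$ (iv) If $\sigma(\alpha)=\alpha$ and $\sigma(\beta)=\beta$, then $[V_\alpha(z),V_\beta(z')]$ is given by $(*)$. (v) If $\sigma(\alpha)=-\alpha$ and $\sigma(\beta)=\beta$: $[\widetilde K_\alpha(t),V_\beta(z)]=c_{\alpha,\beta}K_{\alpha+\beta}(\zeta_\alpha tz)$ and $[\widetilde M_\alpha(t),V_\beta(z)]=c_{\alpha,\beta}M_{\alpha+\beta}(\zeta'_\alpha tz)$. (vi) If $\sigma(\alpha)=-\alpha$ and $\sigma(\beta)=-\beta$, then $[\widetilde K_\alpha(t),\widetilde K_\beta(t')]$, $[\widetilde K_\alpha(t),\widetilde M_\beta(t')]$, $[\widetilde M_\alpha(t),\widetilde M_\beta(t')]$ are the values of $(*)$ at $(\zeta_\alpha t,\zeta_\beta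 t')$, $(\zeta_\alpha t,\zeta'_\beta t')$, $(\zeta'_\alpha t,\zeta'_\beta t')$ in place of $(z,z')$. **(d)** Let $M=G/K$ be a Riemannian symmetric space whose Lie group $G$ acts transitively by isometries and has Lie algebra $\mathfrak g$, with $K$ the isotropy group of the base point $o$, and with the symmetric structure given by an involutive automorphism $\Theta$ of $G$ with differential $\sigma$ and $(G^\Theta)_0\subset K\subset G^\Theta$. Then the differential at $1$ of the orbit map $g\mapsto g\cdot o$ restricts to a linear isomorphism $\mathfrak m\to T_oM$, and under this identification the curvature tensor of the Levi-Civita connection at $o$, $R(U,V)W=\nabla_U\nabla_VW-\nabla_V\nabla_UW-\nabla_{[U,V]}W$, is $$R(u,v)w=-[[u,v],w]\qquad(u,v,w\in\mathfrak m),$$ so that it can be calculated by two-fold application of (c). -/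

import Mathlib

open scoped TensorProduct Manifold ContDiff
open Bundle

noncomputable section

namespace SymmetricSpace

section Algebra

variable {𝔤 : Type*} [LieRing 𝔤] [LieAlgebra ℝ 𝔤]

/-- A linear subspace on which the Lie bracket vanishes (an abelian, or flat, subspace). -/
def IsFlat (U : Submodule ℝ 𝔤) : Prop := ∀ X ∈ U, ∀ Y ∈ U, ⁅X, Y⁆ = 0

/-- The inclusion `X ↦ 1 ⊗ X` of `𝔤` into its complexification `ℂ ⊗ 𝔤`. -/
def incl : 𝔤 →ₗ[ℝ] ℂ ⊗[ℝ] 𝔤 := TensorProduct.mk ℝ ℂ 𝔤 1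

/-- The complex conjugation `z ⊗ X ↦ z̄ ⊗ X` of `ℂ ⊗ 𝔤` with respect to `𝔤`. -/
def conjC : ℂ ⊗[ℝ] 𝔤 →ₗ[ℝ] ℂ ⊗[ℝ] 𝔤 := LinearMap.rTensor 𝔤 Complex.conjAe.toLinearMap

/-- The inner product `⟨X, Y⟩ = -ϰ(X, Y)` of a compact Lie algebra, `ϰ` its Killing form. -/
def ip (X Y : 𝔤) : ℝ := - killingForm ℝ 𝔤 X Y

/-- The complex bilinear extension of `ip` to `ℂ ⊗ 𝔤`, that is, minus the Killing form of
`ℂ ⊗ 𝔤` (see `ipC_incl`). -/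
def ipC (X Y : ℂ ⊗[ℝ] 𝔤) : ℂ := - killingForm ℂ (ℂ ⊗[ℝ] 𝔤) X Y

theorem ipC_incl [FiniteDimensional ℝ 𝔤] (X Y : 𝔤) :
    ipC (incl X) (incl Y) = ((ip X Y : ℝ) : ℂ) := by
  simp [ipC, ip, incl, killingForm, LieModule.traceForm_baseChange]

variable (𝔤) in
/-- A compact real Lie algebra `𝔤` (negative definite Killing form) with an involutive
automorphism `σ`, a maximal flat subspace `𝔞` of `𝔪 = Eig(σ, -1)`, and a Cartan subalgebra
(maximal abelian subalgebra) `𝔱` of `𝔤` which contains `𝔞`. -/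
structure SymData where
  σ : 𝔤 ≃ₗ⁅ℝ⁆ 𝔤
  𝔱 : Submodule ℝ 𝔤
  𝔞 : Submodule ℝ 𝔤
  compact : ∀ X : 𝔤, X ≠ 0 → killingForm ℝ 𝔤 X X < 0
  σ_invol : ∀ X, σ (σ X) = X
  𝔞_maximal : Maximal (fun U : Submodule ℝ 𝔤 => (∀ X ∈ U, σ X = -X) ∧ IsFlat U) 𝔞
  𝔱_maximal : Maximal IsFlat 𝔱
  𝔞_le_𝔱 : 𝔞 ≤ 𝔱

/-- An element commuting with a flat subspace can be adjoined to it. -/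
theorem IsFlat.sup_span {U : Submodule ℝ 𝔤} (hU : IsFlat U) {X : 𝔤}
    (hX : ∀ Y ∈ U, ⁅X, Y⁆ = 0) : IsFlat (U ⊔ Submodule.span ℝ {X}) := by
  intro A hA B hB
  obtain ⟨a, ha, p, hp, rfl⟩ := Submodule.mem_sup.1 hA
  obtain ⟨b, hb, q, hq, rfl⟩ := Submodule.mem_sup.1 hB
  obtain ⟨r, rfl⟩ := Submodule.mem_span_singleton.1 hp
  obtain ⟨t, rfl⟩ := Submodule.mem_span_singleton.1 hq
  have h1 : ⁅a, X⁆ = 0 := by rw [← lie_skew, hX a ha, neg_zero]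
  simp [hU a ha b hb, hX b hb, h1]

namespace SymData

variable (S : SymData 𝔤)

/-- `𝔨 = Eig(σ, 1)`. -/
def 𝔨 : Submodule ℝ 𝔤 := Module.End.eigenspace (S.σ : 𝔤 →ₗ[ℝ] 𝔤) 1

/-- `𝔪 = Eig(σ, -1)`. -/
def 𝔪 : Submodule ℝ 𝔤 := Module.End.eigenspace (S.σ : 𝔤 →ₗ[ℝ] 𝔤) (-1)

theorem symm_eq (X : 𝔤) : S.σ.symm X = S.σ X := by
  apply S.σ.injective
  simp [S.σ_invol]

/-- The Cartan subalgebra is `σ`-invariant. -/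
theorem symm_mem_𝔱 (H : 𝔤) (hH : H ∈ S.𝔱) : S.σ.symm H ∈ S.𝔱 := by
  rw [symm_eq]
  have hcomm : ∀ A ∈ S.𝔞, ⁅H - S.σ H, A⁆ = 0 := by
    intro A hA
    have h1 : ⁅H, A⁆ = 0 := S.𝔱_maximal.prop H hH A (S.𝔞_le_𝔱 hA)
    have h2 : S.σ A = -A := S.𝔞_maximal.prop.1 A hA
    have h3 : ⁅S.σ H, A⁆ = 0 := by
      have h4 : ⁅S.σ H, S.σ A⁆ = 0 := by rw [← LieEquiv.map_lie, h1, map_zero]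
      rw [h2, lie_neg, neg_eq_zero] at h4
      exact h4
    simp [h1, h3]
  have hmem : H - S.σ H ∈ S.𝔞 := by
    have hle : S.𝔞 ⊔ Submodule.span ℝ {H - S.σ H} ≤ S.𝔞 := by
      refine S.𝔞_maximal.le_of_ge ⟨?_, S.𝔞_maximal.prop.2.sup_span hcomm⟩ le_sup_left
      intro X hX
      obtain ⟨a, ha, p, hp, rfl⟩ := Submodule.mem_sup.1 hX
      obtain ⟨r, rfl⟩ := Submodule.mem_span_singleton.1 hp
      simp only [map_add, map_smul, map_sub, S.σ_invol, S.𝔞_maximal.prop.1 a ha]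
      module
    exact hle (Submodule.mem_sup_right (Submodule.mem_span_singleton_self _))
  have := S.𝔱.sub_mem hH (S.𝔞_le_𝔱 hmem)
  simpa using this

/-- Complex linear forms on the complexification of `𝔱`; such a form is the same as its
restriction to `𝔱`, an arbitrary `ℝ`-linear map `𝔱 → ℂ`. -/
abbrev Form := S.𝔱 →ₗ[ℝ] ℂ

/-- The action `σ(α) = α ∘ σ⁻¹` of `σ` on linear forms. -/
def σf (α : S.Form) : S.Form :=
  α ∘ₗ (S.σ.symm : 𝔤 →ₗ[ℝ] 𝔤).restrict S.symm_mem_𝔱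

/-- `𝔤_α = {X ∈ 𝔤 | ∀ H ∈ 𝔱, ad(H)² X = α(H)² X}`, the equation being read in `ℂ ⊗ 𝔤`. -/
def rootSp (α : S.Form) : Submodule ℝ 𝔤 where
  carrier := {X | ∀ H : S.𝔱, incl ⁅(H : 𝔤), ⁅(H : 𝔤), X⁆⁆ = (α H) ^ 2 • incl X}
  add_mem' := by
    intro a b ha hb H
    simp only [Set.mem_ofPred_eq] at ha hb
    simp [ha H, hb H]
  zero_mem' := by intro H; simp
  smul_mem' := by
    intro r a ha H
    simp only [Set.mem_ofPred_eq] at ha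
    simp only [lie_smul, map_smul, ha H]
    exact smul_comm _ _ _

/-- The set `Δ` of roots. -/
def Δ : Set S.Form := {α | α ≠ 0 ∧ S.rootSp α ≠ ⊥}

/-- The complex root space `{X ∈ ℂ ⊗ 𝔤 | ∀ H ∈ 𝔱, ad(H) X = α(H) X}`. -/
def rootSpC (α : S.Form) : Set (ℂ ⊗[ℝ] 𝔤) :=
  {X | ∀ H : S.𝔱, ⁅(incl (H : 𝔤) : ℂ ⊗[ℝ] 𝔤), X⁆ = α H • X}

/-- `𝔨_α = (𝔤_α + 𝔤_{σ(α)}) ∩ 𝔨`. -/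
def 𝔨r (α : S.Form) : Submodule ℝ 𝔤 := (S.rootSp α ⊔ S.rootSp (S.σf α)) ⊓ S.𝔨

/-- `𝔪_α = (𝔤_α + 𝔤_{σ(α)}) ∩ 𝔪`. -/
def 𝔪r (α : S.Form) : Submodule ℝ 𝔤 := (S.rootSp α ⊔ S.rootSp (S.σf α)) ⊓ S.𝔪

/-- The vector `α^♯ ∈ i𝔱` with `α = ϰ(α^♯, ·)`. It exists and is unique for every form which,
like a root, takes purely imaginary values on `𝔱`. -/
def sharp (α : S.Form) : ℂ ⊗[ℝ] 𝔤 :=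
  Classical.epsilon fun A => (∃ h : S.𝔱, A = Complex.I • incl (h : 𝔤)) ∧
    ∀ H : S.𝔱, killingForm ℂ (ℂ ⊗[ℝ] 𝔤) A (incl (H : 𝔤)) = α H

/-- `(X_α)` is a Chevalley basis of `ℂ ⊗ 𝔤` with Chevalley constants `c_{α,β}`
(only the values of `X` and `c` at roots matter). -/
structure IsChevalley (X : S.Form → ℂ ⊗[ℝ] 𝔤) (c : S.Form → S.Form → ℝ) : Prop where
  mem : ∀ α ∈ S.Δ, X α ∈ S.rootSpC α
  lie_root : ∀ α ∈ S.Δ, ∀ β ∈ S.Δ, α + β ∈ S.Δ → ⁅X α, X β⁆ = (c α β : ℂ) • X (α + β)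
  lie_neg : ∀ α ∈ S.Δ, ∀ β ∈ S.Δ, α + β = 0 → ⁅X α, X β⁆ = S.sharp α
  lie_zero : ∀ α ∈ S.Δ, ∀ β ∈ S.Δ, α + β ∉ S.Δ → α + β ≠ 0 → ⁅X α, X β⁆ = 0
  c_neg : ∀ α ∈ S.Δ, ∀ β ∈ S.Δ, c (-α) (-β) = - c α β
  c_zero : ∀ α ∈ S.Δ, ∀ β ∈ S.Δ, α + β ∉ S.Δ → β ≠ -α → c α β = 0

/-- A Chevalley basis with `X_{-α} = -conj X_α`, and the numbers `s_α` with
`σ(X_α) = s_α X_{σ(α)}`, where the basis and `σ` are so adapted to each other that every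
`s_α` is `1` or `-1`. -/
structure IsAdapted (X : S.Form → ℂ ⊗[ℝ] 𝔤) (c : S.Form → S.Form → ℝ) (s : S.Form → ℂ) :
    Prop extends S.IsChevalley X c where
  conj_eq : ∀ α ∈ S.Δ, X (-α) = - conjC (X α)
  σ_eq : ∀ α ∈ S.Δ, (S.σ : 𝔤 →ₗ[ℝ] 𝔤).baseChange ℂ (X α) = s α • X (S.σf α)
  s_sign : ∀ α ∈ S.Δ, s α = 1 ∨ s α = -1

/-- The number `1/√2`. -/
def rt : ℂ := ((1 / Real.sqrt 2 : ℝ) : ℂ)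

open Classical in
/-- `V_α(z) = (1/√2)(z X_α - z̄ X_{-α})` for a root `α`, and `0` if `α` is not a root. -/
def V (X : S.Form → ℂ ⊗[ℝ] 𝔤) (α : S.Form) (z : ℂ) : ℂ ⊗[ℝ] 𝔤 :=
  if α ∈ S.Δ then rt • (z • X α - (starRingEnd ℂ z) • X (-α)) else 0

/-- `K_α(z) = (1/√2)(V_α(z) + s_α V_{σ(α)}(z))`; this is `0` if `α` is not a root. -/
def K (X : S.Form → ℂ ⊗[ℝ] 𝔤) (s : S.Form → ℂ) (α : S.Form) (z : ℂ) : ℂ ⊗[ℝ] 𝔤 :=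
  rt • (S.V X α z + s α • S.V X (S.σf α) z)

/-- `M_α(z) = (1/√2)(V_α(z) - s_α V_{σ(α)}(z))`; this is `0` if `α` is not a root. -/
def M (X : S.Form → ℂ ⊗[ℝ] 𝔤) (s : S.Form → ℂ) (α : S.Form) (z : ℂ) : ℂ ⊗[ℝ] 𝔤 :=
  rt • (S.V X α z - s α • S.V X (S.σf α) z)

open Classical in
/-- `ζ_α = i` if `s_α = 1` and `ζ_α = 1` if `s_α = -1`. -/
def ζ (s : S.Form → ℂ) (α : S.Form) : ℂ := if s α = 1 then Complex.I else 1

open Classical in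
/-- `K̃_α(t)`, which is `V_α(it)` if `s_α = 1` and `V_α(t)` if `s_α = -1`. -/
def Kt (X : S.Form → ℂ ⊗[ℝ] 𝔤) (s : S.Form → ℂ) (α : S.Form) (t : ℝ) : ℂ ⊗[ℝ] 𝔤 :=
  if s α = 1 then S.V X α (Complex.I * t) else S.V X α t

open Classical in
/-- `M̃_α(t)`, which is `V_α(t)` if `s_α = 1` and `V_α(it)` if `s_α = -1`. -/
def Mt (X : S.Form → ℂ ⊗[ℝ] 𝔤) (s : S.Form → ℂ) (α : S.Form) (t : ℝ) : ℂ ⊗[ℝ] 𝔤 :=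
  if s α = 1 then S.V X α t else S.V X α (Complex.I * t)

open Classical in
/-- The closed formula for `[V_α(z), V_β(w)]`. -/
def VV (X : S.Form → ℂ ⊗[ℝ] 𝔤) (c : S.Form → S.Form → ℝ) (α : S.Form) (z : ℂ)
    (β : S.Form) (w : ℂ) : ℂ ⊗[ℝ] 𝔤 :=
  if β = α then (((starRingEnd ℂ z * w).im : ℂ) * Complex.I) • S.sharp α
  else if β = -α then (((z * w).im : ℂ) * Complex.I) • S.sharp α
  else rt • ((c α β : ℂ) • S.V X (α + β) (z * w)
    - (c α (-β) : ℂ) • S.V X (α - β) (z * starRingEnd ℂ w))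

/-- `σ(α) ∉ {α, -α}`. -/
def Generic (α : S.Form) : Prop := S.σf α ≠ α ∧ S.σf α ≠ -α

/-- `β ∉ {α, -α, σ(α), -σ(α)}`. -/
def Apart (α β : S.Form) : Prop := β ≠ α ∧ β ≠ -α ∧ β ≠ S.σf α ∧ β ≠ -S.σf α

end SymData

end Algebra

section Geometry

variable {EM : Type*} [NormedAddCommGroup EM] [NormedSpace ℝ EM]
  {M : Type*} [TopologicalSpace M] [ChartedSpace EM M] [IsManifold 𝓘(ℝ, EM) ∞ M]

/-- `X` is a smooth vector field on `M`. -/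
def SmoothField (X : ∀ x : M, TangentSpace 𝓘(ℝ, EM) x) : Prop :=
  ContMDiff 𝓘(ℝ, EM) 𝓘(ℝ, EM).tangent ∞ fun x => (⟨x, X x⟩ : TangentBundle 𝓘(ℝ, EM) M)

/-- The curvature `R(X,Y)Z = ∇_X ∇_Y Z - ∇_Y ∇_X Z - ∇_{[X,Y]} Z` of a connection on the
tangent bundle, at the point `x`. -/
def curvature (cov : CovariantDerivative 𝓘(ℝ, EM) EM (fun x : M => TangentSpace 𝓘(ℝ, EM) x))
    (X Y Z : ∀ x : M, TangentSpace 𝓘(ℝ, EM) x) (x : M) : TangentSpace 𝓘(ℝ, EM) x :=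
  cov (fun y => cov Z y (Y y)) x (X x) - cov (fun y => cov Z y (X y)) x (Y x)
    - cov Z x (VectorField.mlieBracket 𝓘(ℝ, EM) X Y x)

/-- `cov` is the Levi-Civita connection of the Riemannian manifold `M`: a smooth connection on
the tangent bundle which is compatible with the metric and free of torsion. -/
def IsLeviCivita [FiniteDimensional ℝ EM]
    [RiemannianBundle (fun x : M => TangentSpace 𝓘(ℝ, EM) x)]
    [IsContMDiffRiemannianBundle 𝓘(ℝ, EM) ∞ EM (fun x : M => TangentSpace 𝓘(ℝ, EM) x)]
    (cov : CovariantDerivative 𝓘(ℝ, EM) EM (fun x : M => TangentSpace 𝓘(ℝ, EM) x)) : Prop :=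
  CovariantDerivative.ContMDiffCovariantDerivative cov ∞ ∧
    @CovariantDerivative.IsMetricCompatible EM _ _ EM _ 𝓘(ℝ, EM) M _ _ EM _ _
      (fun x : M => TangentSpace 𝓘(ℝ, EM) x) inferInstance
      (fun _ => inferInstance) (fun _ => inferInstance) inferInstance cov inferInstance
      inferInstance inferInstance inferInstance ∧
    cov.torsion = 0

end Geometry

section Space

instance : ENat.LEInfty (minSmoothness ℝ 3) :=
  ⟨by rw [minSmoothness_of_isRCLikeNormedField]; exact ENat.LEInfty.out⟩

variable {𝔤 : Type*} [LieRing 𝔤] [LieAlgebra ℝ 𝔤]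
  {EG : Type*} [NormedAddCommGroup EG] [NormedSpace ℝ EG] [FiniteDimensional ℝ EG]
  {G : Type*} [TopologicalSpace G] [ChartedSpace EG G] [Group G] [LieGroup 𝓘(ℝ, EG) ∞ G]
  {EM : Type*} [NormedAddCommGroup EM] [NormedSpace ℝ EM]
  {M : Type*} [TopologicalSpace M] [ChartedSpace EM M]
  [RiemannianBundle (fun x : M => TangentSpace 𝓘(ℝ, EM) x)] [MulAction G M]

/-- The differential at `1` of the orbit map `g ↦ g • o`, from the Lie algebra of `G` to the
tangent space of `M` at `1 • o = o`. -/
def orbitDeriv (EG : Type*) [NormedAddCommGroup EG] [NormedSpace ℝ EG]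
    {G : Type*} [TopologicalSpace G] [ChartedSpace EG G] [Group G]
    {EM : Type*} [NormedAddCommGroup EM] [NormedSpace ℝ EM]
    {M : Type*} [TopologicalSpace M] [ChartedSpace EM M] [MulAction G M] (o : M) :
    GroupLieAlgebra 𝓘(ℝ, EG) G →L[ℝ] TangentSpace 𝓘(ℝ, EM) ((1 : G) • o) :=
  mfderiv 𝓘(ℝ, EG) 𝓘(ℝ, EM) (fun g : G => g • o) 1

/-- `M = G/K` is a Riemannian symmetric space, with base point `o` and isotropy group
`K = {g | g • o = o}`, on which the Lie group `G` acts (smoothly and) transitively by isometries;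
its symmetric structure is given by the involutive automorphism `Θ` of `G`, with
`(G^Θ)₀ ⊆ K ⊆ G^Θ`. The Lie algebra of `G` is identified with `𝔤` by `ι`, and then the
differential of `Θ` is the automorphism `σ` of `𝔤`. The manifold structure of `M` is the one of
`G/K`, that is, the orbit map is a submersion. -/
structure IsSymmetricSpace (S : SymData 𝔤) (ι : 𝔤 ≃ₗ⁅ℝ⁆ GroupLieAlgebra 𝓘(ℝ, EG) G)
    (Θ : G ≃* G) (o : M) : Prop where
  transitive : MulAction.IsPretransitive G M
  submersion : Function.Surjective (orbitDeriv EG (G := G) (EM := EM) o)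
  isometric : ∀ (g : G) (x : M) (u v : TangentSpace 𝓘(ℝ, EM) x),
    inner ℝ (mfderiv 𝓘(ℝ, EM) 𝓘(ℝ, EM) (fun y : M => g • y) x u)
      (mfderiv 𝓘(ℝ, EM) 𝓘(ℝ, EM) (fun y : M => g • y) x v) = inner ℝ u v
  Θ_smooth : ContMDiff 𝓘(ℝ, EG) 𝓘(ℝ, EG) ∞ Θ
  Θ_invol : ∀ g, Θ (Θ g) = g
  Θ_deriv : ∀ X : 𝔤, tangentMap 𝓘(ℝ, EG) 𝓘(ℝ, EG) Θ ⟨1, ι X⟩ =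
    (⟨1, ι (S.σ X)⟩ : TangentBundle 𝓘(ℝ, EG) G)
  isotropy_le : ∀ g : G, g • o = o → Θ g = g
  le_isotropy : ∀ g ∈ connectedComponentIn {g : G | Θ g = g} 1, g • o = o

end Space

end SymmetricSpace

end

set_option linter.unusedSectionVars false

/-! Everything in the algebraic part happens in `ℂ ⊗ 𝔤`, where `𝔤` is the fixed space of `conjC`.
Since the Killing form of `𝔤` is negative definite, `ipC A (conjC A)` is positive definite. Hence
roots are purely imaginary on `𝔱`, and each root space is the line spanned by `X_α`
(`eq_smul_of_mem_rootSpC`), so that `𝔤_α` consists exactly of the vectors `V_α(z)` (`exists_eq_V`,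
`exists_incl_eq_V`).

The involution acts by `σ V_α(z) = s_α V_{σ(α)}(z)` (`σC_V`). So `K_α(z)` and `M_α(z)` are, up to
the factor `√2`, the projections of `V_α(z)` to the two eigenspaces of `σ`. As `σ` is an
automorphism and an isometry, all brackets and inner products reduce by bilinearity to those of the
`V_α`; for instance `[K_α, K_β]` needs only `[V_α, V_β]` and `[σ V_α, V_β]`. The one deeper input is
the maximality of `𝔞`: if `σ(α) = α`, then `s_α = 1` (`s_eq_one`). This gives `𝔪_α = 0` for such
roots and removes the root `α + σ(α)` from the brackets with `β = α`. If `σ(α) = -α`, then `σ` is a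
reflection of the real plane of the `V_α(z)`, with eigenlines spanned by `ζ_α` and `ζ'_α`.

For the curvature, `𝔨` is the kernel of the differential of the orbit map
(`IsSymmetricSpace.orb_eq_zero_iff`), by uniqueness of integral curves. The fundamental fields `X*`
of the action satisfy `[X*, Y*] = -[X, Y]*` (`mlieBracket_fund`) and are Killing fields
(`diff_gram`), so the Koszul formula expresses `∇_{X*} Y*` by brackets (`IsLeviCivita.cov_fund`).
Since `[𝔪, 𝔪] ⊆ 𝔨`, the derivatives `∇Y*` with `Y ∈ 𝔪` vanish at `o`. A further derivative of the
Koszul formula, the Jacobi identity and the skewness of the isotropy action give `⟨R(X*, Y*)Z*, W*⟩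
= -⟨[[X, Y], Z], W⟩` at `o` (`IsLeviCivita.curvature_fund`). Arbitrary fields are reached by
tensoriality in the first two arguments and by skew-symmetry of the curvature endomorphism, which
moves the third argument into the slot where only its value at `o` matters
(`IsLeviCivita.curvature_eq`). -/

namespace SymmetricSpace

/-! ### The eigenspaces of the involution. -/

section Eigenspaces

variable {𝔤 : Type*} [LieRing 𝔤] [LieAlgebra ℝ 𝔤] (S : SymData 𝔤)

theorem SymData.mem_𝔨 {X : 𝔤} : X ∈ S.𝔨 ↔ S.σ X = X := by
  simp [SymData.𝔨]

theorem SymData.mem_𝔪 {X : 𝔤} : X ∈ S.𝔪 ↔ S.σ X = -X := by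
  simp [SymData.𝔪]

theorem SymData.lie_𝔪_𝔪 {X Y : 𝔤} (hX : X ∈ S.𝔪) (hY : Y ∈ S.𝔪) : ⁅X, Y⁆ ∈ S.𝔨 := by
  rw [S.mem_𝔪] at hX hY
  rw [S.mem_𝔨, LieEquiv.map_lie, hX, hY, neg_lie, lie_neg, neg_neg]

theorem SymData.eq_zero_of_mem {X : 𝔤} (hk : X ∈ S.𝔨) (hm : X ∈ S.𝔪) : X = 0 := by
  have h : (2 : ℝ) • X = 0 := by
    rw [two_smul]
    nth_rewrite 1 [← S.mem_𝔨.1 hk]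
    rw [S.mem_𝔪.1 hm, neg_add_cancel]
  exact (smul_eq_zero.1 h).resolve_left two_ne_zero

end Eigenspaces

/-! ### The complexification, its conjugation and its invariant form. -/

section Complexification

variable {𝔤 : Type*} [LieRing 𝔤] [LieAlgebra ℝ 𝔤]

theorem incl_smul (r : ℝ) (X : 𝔤) : incl (r • X) = (r : ℂ) • incl X := by
  simp [incl, TensorProduct.smul_tmul']

/-- The laws of a complex Lie algebra, specialised to the bracket and scalars of `ℂ ⊗[ℝ] 𝔤` for use
in rewriting. -/
theorem smul_lieC (z : ℂ) (A B : ℂ ⊗[ℝ] 𝔤) : ⁅z • A, B⁆ = z • ⁅A, B⁆ := smul_lie z A B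

theorem lie_smulC (z : ℂ) (A B : ℂ ⊗[ℝ] 𝔤) : ⁅A, z • B⁆ = z • ⁅A, B⁆ := lie_smul z A B

theorem add_lieC (A B C : ℂ ⊗[ℝ] 𝔤) : ⁅A + B, C⁆ = ⁅A, C⁆ + ⁅B, C⁆ := add_lie A B C

theorem lie_addC (A B C : ℂ ⊗[ℝ] 𝔤) : ⁅A, B + C⁆ = ⁅A, B⁆ + ⁅A, C⁆ := lie_add A B C

theorem sub_lieC (A B C : ℂ ⊗[ℝ] 𝔤) : ⁅A - B, C⁆ = ⁅A, C⁆ - ⁅B, C⁆ := sub_lie A B C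

theorem lie_subC (A B C : ℂ ⊗[ℝ] 𝔤) : ⁅A, B - C⁆ = ⁅A, B⁆ - ⁅A, C⁆ := lie_sub A B C

theorem neg_lieC (A B : ℂ ⊗[ℝ] 𝔤) : ⁅-A, B⁆ = -⁅A, B⁆ := neg_lie A B

theorem lie_negC (A B : ℂ ⊗[ℝ] 𝔤) : ⁅A, -B⁆ = -⁅A, B⁆ := lie_neg A B

theorem zero_lieC (A : ℂ ⊗[ℝ] 𝔤) : ⁅(0 : ℂ ⊗[ℝ] 𝔤), A⁆ = 0 := zero_lie A

theorem lie_zeroC (A : ℂ ⊗[ℝ] 𝔤) : ⁅A, (0 : ℂ ⊗[ℝ] 𝔤)⁆ = 0 := lie_zero A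

theorem lie_skewC (A B : ℂ ⊗[ℝ] 𝔤) : ⁅A, B⁆ = -⁅B, A⁆ := (lie_skew A B).symm

theorem lie_selfC (A : ℂ ⊗[ℝ] 𝔤) : ⁅A, A⁆ = 0 := lie_self A

theorem leibniz_lieC (A B C : ℂ ⊗[ℝ] 𝔤) : ⁅A, ⁅B, C⁆⁆ = ⁅⁅A, B⁆, C⁆ + ⁅B, ⁅A, C⁆⁆ :=
  leibniz_lie A B C

theorem lie_incl (X Y : 𝔤) : (⁅incl X, incl Y⁆ : ℂ ⊗[ℝ] 𝔤) = incl ⁅X, Y⁆ := by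
  simp [incl]

theorem exists_incl_add (A : ℂ ⊗[ℝ] 𝔤) : ∃ X Y : 𝔤, A = incl X + Complex.I • incl Y := by
  induction A with
  | zero => exact ⟨0, 0, by simp⟩
  | tmul z X =>
    refine ⟨z.re • X, z.im • X, ?_⟩
    rw [incl_smul, incl_smul, smul_smul, ← add_smul, mul_comm, Complex.re_add_im]
    simp [incl, TensorProduct.smul_tmul']
  | add A B hA hB =>
    obtain ⟨X, Y, rfl⟩ := hA
    obtain ⟨X', Y', rfl⟩ := hB
    refine ⟨X + X', Y + Y', ?_⟩
    simp only [map_add]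
    module

theorem conjC_incl (X : 𝔤) : conjC (incl X) = incl X := by
  simp [conjC, incl]

theorem conjC_smul (z : ℂ) (A : ℂ ⊗[ℝ] 𝔤) : conjC (z • A) = (starRingEnd ℂ z) • conjC A := by
  induction A with
  | zero => simp
  | tmul w X => simp [conjC, TensorProduct.smul_tmul']
  | add A B hA hB => rw [smul_add, map_add, hA, hB, map_add, smul_add]

theorem conjC_add_smul (X Y : 𝔤) :
    conjC (incl X + Complex.I • incl Y) = incl X - Complex.I • incl Y := by
  rw [map_add, conjC_smul, conjC_incl, conjC_incl, Complex.conj_I, neg_smul, sub_eq_add_neg]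

theorem conjC_lie (A B : ℂ ⊗[ℝ] 𝔤) : conjC ⁅A, B⁆ = ⁅conjC A, conjC B⁆ := by
  obtain ⟨X, Y, rfl⟩ := exists_incl_add A
  obtain ⟨X', Y', rfl⟩ := exists_incl_add B
  rw [conjC_add_smul, conjC_add_smul]
  simp only [add_lieC, lie_addC, lie_subC, sub_lieC, smul_lieC, lie_smulC, lie_incl,
    map_add, conjC_smul, conjC_incl, Complex.conj_I]
  module

theorem incl_injective : Function.Injective (incl : 𝔤 → ℂ ⊗[ℝ] 𝔤) :=
  
  Function.LeftInverse.injective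
    (g := fun A => TensorProduct.lid ℝ 𝔤 (LinearMap.rTensor 𝔤 Complex.reLm A))
    fun X => by simp [incl]

theorem incl_add_eq_zero {X Y : 𝔤} (h : incl X + Complex.I • incl Y = 0) : X = 0 ∧ Y = 0 := by
  have h2 := congrArg conjC h
  rw [conjC_add_smul, map_zero] at h2
  have hX : (2 : ℂ) • incl X = 0 := by
    have : (2 : ℂ) • incl X = (incl X + Complex.I • incl Y) + (incl X - Complex.I • incl Y) := by
      module
    rw [this, h, h2, add_zero]
  have hX0 : incl X = 0 := (smul_eq_zero.1 hX).resolve_left two_ne_zero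
  rw [hX0, zero_add] at h
  have hY0 : incl Y = 0 := (smul_eq_zero.1 h).resolve_left Complex.I_ne_zero
  exact ⟨incl_injective (hX0.trans (map_zero _).symm), incl_injective (hY0.trans (map_zero _).symm)⟩

/-- This is how `V_α(z)`, defined in the complexification, is recognised as a vector of `𝔤`. -/
theorem exists_incl_of_conjC {A : ℂ ⊗[ℝ] 𝔤} (h : conjC A = A) : ∃ X : 𝔤, incl X = A := by
  obtain ⟨X, Y, rfl⟩ := exists_incl_add A
  rw [conjC_add_smul] at h
  have hY : (2 * Complex.I) • incl Y = 0 := by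
    have : (2 * Complex.I) • incl Y = (incl X + Complex.I • incl Y) -
        (incl X - Complex.I • incl Y) := by module
    rw [this, h, sub_self]
  have hY0 : incl Y = 0 := (smul_eq_zero.1 hY).resolve_left (by simp)
  exact ⟨X, by rw [hY0, smul_zero, add_zero]⟩

theorem ipC_add_left (A B C : ℂ ⊗[ℝ] 𝔤) : ipC (A + B) C = ipC A C + ipC B C := by
  simp only [ipC, map_add, LinearMap.add_apply]
  ring

theorem ipC_smul_left (z : ℂ) (A C : ℂ ⊗[ℝ] 𝔤) : ipC (z • A) C = z * ipC A C := by
  simp only [ipC, map_smul, LinearMap.smul_apply, smul_eq_mul]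
  ring

theorem ipC_comm (A B : ℂ ⊗[ℝ] 𝔤) : ipC A B = ipC B A := by
  simp only [ipC, killingForm, LieModule.traceForm_comm ℂ (ℂ ⊗[ℝ] 𝔤) (ℂ ⊗[ℝ] 𝔤) A B]

theorem ipC_add_right (A B C : ℂ ⊗[ℝ] 𝔤) : ipC A (B + C) = ipC A B + ipC A C := by
  rw [ipC_comm, ipC_add_left, ipC_comm B, ipC_comm C]

theorem ipC_smul_right (z : ℂ) (A C : ℂ ⊗[ℝ] 𝔤) : ipC A (z • C) = z * ipC A C := by
  rw [ipC_comm, ipC_smul_left, ipC_comm C]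

theorem ipC_neg_left (A C : ℂ ⊗[ℝ] 𝔤) : ipC (-A) C = -ipC A C := by
  rw [← neg_one_smul ℂ, ipC_smul_left, neg_one_mul]

theorem ipC_neg_right (A C : ℂ ⊗[ℝ] 𝔤) : ipC A (-C) = -ipC A C := by
  rw [← neg_one_smul ℂ, ipC_smul_right, neg_one_mul]

theorem ipC_sub_left (A B C : ℂ ⊗[ℝ] 𝔤) : ipC (A - B) C = ipC A C - ipC B C := by
  rw [sub_eq_add_neg, ipC_add_left, ipC_neg_left, sub_eq_add_neg]

theorem ipC_sub_right (A B C : ℂ ⊗[ℝ] 𝔤) : ipC A (B - C) = ipC A B - ipC A C := by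
  rw [sub_eq_add_neg, ipC_add_right, ipC_neg_right, sub_eq_add_neg]

theorem ipC_zero_left (C : ℂ ⊗[ℝ] 𝔤) : ipC 0 C = 0 := by
  simp [ipC]

theorem ipC_lie (A B C : ℂ ⊗[ℝ] 𝔤) : ipC ⁅A, B⁆ C = ipC A ⁅B, C⁆ := by
  simp only [ipC, killingForm, LieModule.traceForm_apply_lie_apply]

theorem ip_lie (A B C : 𝔤) : ip ⁅A, B⁆ C = ip A ⁅B, C⁆ := by
  simp only [ip, killingForm, LieModule.traceForm_apply_lie_apply]

theorem ip_comm (A B : 𝔤) : ip A B = ip B A := by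
  simp only [ip, killingForm, LieModule.traceForm_comm ℝ 𝔤 𝔤 A B]

theorem ip_smul_left (r : ℝ) (A C : 𝔤) : ip (r • A) C = r * ip A C := by
  simp only [ip, map_smul, LinearMap.smul_apply, smul_eq_mul]
  ring

theorem ip_neg_left (A C : 𝔤) : ip (-A) C = -ip A C := by
  simp [ip]

theorem ip_neg_right (A C : 𝔤) : ip A (-C) = -ip A C := by
  simp [ip]

theorem ipC_conjC_self [FiniteDimensional ℝ 𝔤] (X Y : 𝔤) :
    ipC (incl X + Complex.I • incl Y) (conjC (incl X + Complex.I • incl Y)) =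
      ((ip X X + ip Y Y : ℝ) : ℂ) := by
  simp only [conjC_add_smul, ipC_add_left, ipC_sub_right,
    ipC_smul_left, ipC_smul_right, ipC_incl, ip_comm Y X]
  push_cast
  linear_combination (-(ip Y Y : ℂ)) * Complex.I_mul_I

end Complexification

/-! ### Positivity of the inner product; `σ` on the complexification. -/

namespace SymData

theorem ip_self_pos {𝔤 : Type*} [LieRing 𝔤] [LieAlgebra ℝ 𝔤] (S : SymData 𝔤) {X : 𝔤} (hX : X ≠ 0) : 0 < ip X X := by
  have := S.compact X hX
  unfold ip
  linarith

theorem ip_self_nonneg {𝔤 : Type*} [LieRing 𝔤] [LieAlgebra ℝ 𝔤] (S : SymData 𝔤) (X : 𝔤) : 0 ≤ ip X X := by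
  by_cases hX : X = 0
  · simp [hX, ip]
  · exact (S.ip_self_pos hX).le

theorem eq_zero_of_ip_self {𝔤 : Type*} [LieRing 𝔤] [LieAlgebra ℝ 𝔤] (S : SymData 𝔤) {X : 𝔤} (h : ip X X = 0) : X = 0 := by
  by_contra hX
  exact (S.ip_self_pos hX).ne' h

/-- The Hermitian form `⟨A, conj B⟩` is positive definite. -/
theorem ipC_conjC_nonneg {𝔤 : Type*} [LieRing 𝔤] [LieAlgebra ℝ 𝔤] (S : SymData 𝔤)
    [FiniteDimensional ℝ 𝔤] (A : ℂ ⊗[ℝ] 𝔤) :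
    ∃ r : ℝ, 0 ≤ r ∧ ipC A (conjC A) = r ∧ (r = 0 → A = 0) := by
  obtain ⟨X, Y, rfl⟩ := exists_incl_add A
  have h1 := S.ip_self_nonneg X
  have h2 := S.ip_self_nonneg Y
  refine ⟨ip X X + ip Y Y, by positivity, ipC_conjC_self X Y, fun h => ?_⟩
  rw [S.eq_zero_of_ip_self (X := X) (by linarith), S.eq_zero_of_ip_self (X := Y) (by linarith)]
  simp

variable {𝔤 : Type*} [LieRing 𝔤] [LieAlgebra ℝ 𝔤] (S : SymData 𝔤)

/-- The complex linear extension of `σ`. -/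
noncomputable abbrev σC : ℂ ⊗[ℝ] 𝔤 →ₗ[ℂ] ℂ ⊗[ℝ] 𝔤 := (S.σ : 𝔤 →ₗ[ℝ] 𝔤).baseChange ℂ

theorem σC_incl (X : 𝔤) : S.σC (incl X) = incl (S.σ X) := by
  simp [incl, σC]

theorem σC_σC (A : ℂ ⊗[ℝ] 𝔤) : S.σC (S.σC A) = A := by
  obtain ⟨X, Y, rfl⟩ := exists_incl_add A
  simp only [map_add, map_smul, σC_incl, S.σ_invol]

theorem σC_lie (A B : ℂ ⊗[ℝ] 𝔤) : S.σC ⁅A, B⁆ = ⁅S.σC A, S.σC B⁆ := by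
  obtain ⟨X, Y, rfl⟩ := exists_incl_add A
  obtain ⟨X', Y', rfl⟩ := exists_incl_add B
  simp only [map_add, map_smul, σC_incl, add_lieC, lie_addC, smul_lieC, lie_smulC, lie_incl,
    LieEquiv.map_lie]

theorem σC_conjC (A : ℂ ⊗[ℝ] 𝔤) : S.σC (conjC A) = conjC (S.σC A) := by
  obtain ⟨X, Y, rfl⟩ := exists_incl_add A
  rw [conjC_add_smul]
  simp only [map_add, map_smul, map_sub, σC_incl, conjC_smul, conjC_incl, Complex.conj_I]
  module

theorem ip_σ (X Y : 𝔤) : ip (S.σ X) (S.σ Y) = ip X Y := by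
  simp only [ip, LieAlgebra.killingForm_of_equiv_apply]

theorem ipC_σC [FiniteDimensional ℝ 𝔤] (A B : ℂ ⊗[ℝ] 𝔤) : ipC (S.σC A) (S.σC B) = ipC A B := by
  obtain ⟨X, Y, rfl⟩ := exists_incl_add A
  obtain ⟨X', Y', rfl⟩ := exists_incl_add B
  simp only [map_add, map_smul, σC_incl, ipC_add_left, ipC_add_right,
    ipC_smul_left, ipC_smul_right, ipC_incl, ip_σ]

/-! ### Roots and the action of `σ` on them. -/

section Roots

variable {𝔤 : Type*} [LieRing 𝔤] [LieAlgebra ℝ 𝔤] (S : SymData 𝔤)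

theorem mem_𝔱_of_lie_eq_zero {X : 𝔤} (h : ∀ H : S.𝔱, ⁅(H : 𝔤), X⁆ = 0) : X ∈ S.𝔱 := by
  have hle : S.𝔱 ⊔ Submodule.span ℝ {X} ≤ S.𝔱 := by
    refine S.𝔱_maximal.le_of_ge (S.𝔱_maximal.prop.sup_span fun Y hY => ?_) le_sup_left
    rw [← lie_skew, h ⟨Y, hY⟩, neg_zero]
  exact hle (Submodule.mem_sup_right (Submodule.mem_span_singleton_self _))

theorem lie_𝔱 (H H' : S.𝔱) : ⁅(H : 𝔤), (H' : 𝔤)⁆ = 0 := S.𝔱_maximal.prop _ H.2 _ H'.2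

theorem σ_mem_𝔱 {H : 𝔤} (hH : H ∈ S.𝔱) : S.σ H ∈ S.𝔱 := by
  rw [← S.symm_eq]
  exact S.symm_mem_𝔱 H hH

theorem σf_apply (α : S.Form) (H : S.𝔱) : S.σf α H = α ⟨S.σ H, S.σ_mem_𝔱 H.2⟩ := by
  have h : (S.σ.symm : 𝔤 →ₗ[ℝ] 𝔤).restrict S.symm_mem_𝔱 H = ⟨S.σ H, S.σ_mem_𝔱 H.2⟩ :=
    Subtype.ext (S.symm_eq H)
  rw [σf, LinearMap.comp_apply, h]

theorem σf_σf (α : S.Form) : S.σf (S.σf α) = α := by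
  ext H
  simp only [σf_apply]
  congr 1
  exact Subtype.ext (S.σ_invol H)

theorem σf_neg (α : S.Form) : S.σf (-α) = -S.σf α := by
  ext H
  simp only [σf_apply, LinearMap.neg_apply]

theorem σf_add (α β : S.Form) : S.σf (α + β) = S.σf α + S.σf β := by
  ext H
  simp only [σf_apply, LinearMap.add_apply]

theorem σf_sub (α β : S.Form) : S.σf (α - β) = S.σf α - S.σf β := by
  rw [sub_eq_add_neg, σf_add, σf_neg, sub_eq_add_neg]

theorem mem_rootSp {α : S.Form} {X : 𝔤} : X ∈ S.rootSp α ↔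
    ∀ H : S.𝔱, incl ⁅(H : 𝔤), ⁅(H : 𝔤), X⁆⁆ = (α H) ^ 2 • incl X := Iff.rfl

theorem rootSp_neg (α : S.Form) : S.rootSp (-α) = S.rootSp α := by
  ext X
  simp only [mem_rootSp, LinearMap.neg_apply, neg_sq]

theorem σ_mem_rootSp {α : S.Form} {X : 𝔤} (hX : X ∈ S.rootSp α) :
    S.σ X ∈ S.rootSp (S.σf α) := by
  rw [mem_rootSp] at hX ⊢
  intro H
  have h := congrArg S.σC (hX ⟨S.σ H, S.σ_mem_𝔱 H.2⟩)
  rw [σC_incl, map_smul, σC_incl, LieEquiv.map_lie, LieEquiv.map_lie, S.σ_invol] at h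
  rw [h, σf_apply]

theorem neg_mem_Δ {α : S.Form} (hα : α ∈ S.Δ) : -α ∈ S.Δ :=
  ⟨neg_ne_zero.2 hα.1, by rw [rootSp_neg]; exact hα.2⟩

theorem σf_mem_Δ {α : S.Form} (hα : α ∈ S.Δ) : S.σf α ∈ S.Δ := by
  refine ⟨fun h => hα.1 ?_, ?_⟩
  · have h2 := congrArg S.σf h
    rw [σf_σf] at h2
    rw [h2]
    ext H
    simp [σf_apply]
  · obtain ⟨X, hX, hX0⟩ := Submodule.exists_mem_ne_zero_of_ne_bot hα.2
    intro h
    have h2 := S.σ_mem_rootSp hX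
    rw [h, Submodule.mem_bot] at h2
    exact hX0 ((map_eq_zero_iff _ S.σ.injective).1 h2)

theorem neg_mem_Δ_iff {α : S.Form} : -α ∈ S.Δ ↔ α ∈ S.Δ :=
  ⟨fun h => by simpa using S.neg_mem_Δ h, S.neg_mem_Δ⟩

theorem σf_mem_Δ_iff {α : S.Form} : S.σf α ∈ S.Δ ↔ α ∈ S.Δ :=
  ⟨fun h => by simpa [σf_σf] using S.σf_mem_Δ h, S.σf_mem_Δ⟩

theorem exists_ne_zero {α : S.Form} (hα : α ∈ S.Δ) : ∃ H : S.𝔱, α H ≠ 0 := by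
  by_contra! h
  exact hα.1 (LinearMap.ext h)

/-- Roots are purely imaginary on `𝔱`. -/
theorem re_eq_zero {α : S.Form} (hα : α ∈ S.Δ) (H : S.𝔱) : (α H).re = 0 := by
  obtain ⟨X, hX, hX0⟩ := Submodule.exists_mem_ne_zero_of_ne_bot hα.2
  have h := S.mem_rootSp.1 hX H
  set z := (α H) ^ 2 with hz
  -- Comparison of real and imaginary parts: `X` is a nonzero real vector, so `α(H)²` must be real.
  have h1 : incl (⁅(H : 𝔤), ⁅(H : 𝔤), X⁆⁆ - z.re • X) + Complex.I • incl (-(z.im • X)) = 0 := by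
    rw [map_sub, map_neg, incl_smul, incl_smul, h]
    nth_rewrite 1 [← Complex.re_add_im z]
    module
  obtain ⟨h2, h3⟩ := incl_add_eq_zero h1
  have him : z.im = 0 := (smul_eq_zero.1 (neg_eq_zero.1 h3)).resolve_right hX0
  have hre : z.re ≤ 0 := by
    -- `ad(H)` is skew, so `⟨ad(H)² X, X⟩ = -⟨[H, X], [H, X]⟩` and the real number `α(H)²` is at
    -- most `0`.
    have h4 : ip ⁅(H : 𝔤), ⁅(H : 𝔤), X⁆⁆ X = -ip ⁅(H : 𝔤), X⁆ ⁅(H : 𝔤), X⁆ := by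
      rw [← lie_skew, ip_neg_left, ip_lie]
    rw [sub_eq_zero.1 h2, ip_smul_left] at h4
    have h5 := S.ip_self_nonneg ⁅(H : 𝔤), X⁆
    have h6 := S.ip_self_pos hX0
    by_contra! hpos
    have := mul_pos hpos h6
    linarith
  rw [hz, sq, Complex.mul_im] at him
  rw [hz, sq, Complex.mul_re] at hre
  have h7 : (α H).re * (α H).im = 0 := by linarith
  rcases mul_eq_zero.1 h7 with h8 | h8
  · exact h8
  · rw [h8] at hre
    nlinarith

theorem conj_root {α : S.Form} (hα : α ∈ S.Δ) (H : S.𝔱) : starRingEnd ℂ (α H) = -α H := by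
  apply Complex.ext <;> simp [S.re_eq_zero hα H]

end Roots

/-! ### The dual vectors of roots. -/

section Sharp

variable {𝔤 : Type*} [LieRing 𝔤] [LieAlgebra ℝ 𝔤] [FiniteDimensional ℝ 𝔤] (S : SymData 𝔤)

theorem exists_ip_eq (f : S.𝔱 →ₗ[ℝ] ℝ) : ∃ h : S.𝔱, ∀ H : S.𝔱, ip (h : 𝔤) (H : 𝔤) = f H := by
  let B : S.𝔱 →ₗ[ℝ] Module.Dual ℝ S.𝔱 := (-(killingForm ℝ 𝔤)).domRestrict₁₂ S.𝔱 S.𝔱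
  have hB : ∀ h H : S.𝔱, B h H = ip (h : 𝔤) (H : 𝔤) := fun h H => rfl
  have hinj : Function.Injective B := by
    rw [injective_iff_map_eq_zero]
    intro h hh
    apply Subtype.ext
    apply S.eq_zero_of_ip_self
    rw [← hB, hh]
    rfl
  obtain ⟨h, hh⟩ := (LinearMap.injective_iff_surjective_of_finrank_eq_finrank
    (Subspace.dual_finrank_eq (K := ℝ) (V := S.𝔱)).symm).1 hinj f
  exact ⟨h, fun H => by rw [← hB, hh]⟩

theorem sharp_spec {α : S.Form} (hα : α ∈ S.Δ) :
    (∃ h : S.𝔱, S.sharp α = Complex.I • incl (h : 𝔤)) ∧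
      ∀ H : S.𝔱, ipC (S.sharp α) (incl (H : 𝔤)) = -α H := by
  have hex : ∃ A : ℂ ⊗[ℝ] 𝔤, (∃ h : S.𝔱, A = Complex.I • incl (h : 𝔤)) ∧
      ∀ H : S.𝔱, killingForm ℂ (ℂ ⊗[ℝ] 𝔤) A (incl (H : 𝔤)) = α H := by
    -- A root equals `i Im α` on `𝔱`. Because `⟨·,·⟩ = -ϰ`, the vector `ih` represents `α` for `ϰ`
    -- as soon as `h` represents `-Im α` for `⟨·,·⟩`.
    obtain ⟨h, hh⟩ := S.exists_ip_eq (-(Complex.imLm ∘ₗ α))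
    refine ⟨_, ⟨h, rfl⟩, fun H => ?_⟩
    have h1 : ipC (Complex.I • incl (h : 𝔤)) (incl (H : 𝔤)) = -α H := by
      rw [ipC_smul_left, ipC_incl, hh]
      apply Complex.ext <;> simp [S.re_eq_zero hα H]
    rw [ipC] at h1
    exact neg_injective h1
  have h := Classical.epsilon_spec hex
  exact ⟨h.1, fun H => congrArg Neg.neg (h.2 H)⟩

/-- An element of the complexification of `𝔱` is determined by its products with `𝔱`. -/
theorem eq_of_ipC_𝔱 {A B : ℂ ⊗[ℝ] 𝔤} (hA : ∃ h k : S.𝔱, A = incl (h : 𝔤) + Complex.I • incl (k : 𝔤))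
    (hB : ∃ h k : S.𝔱, B = incl (h : 𝔤) + Complex.I • incl (k : 𝔤))
    (h : ∀ H : S.𝔱, ipC A (incl (H : 𝔤)) = ipC B (incl (H : 𝔤))) : A = B := by
  obtain ⟨a, b, rfl⟩ := hA
  obtain ⟨c, d, rfl⟩ := hB
  rw [← sub_eq_zero]
  have e : incl (a : 𝔤) + Complex.I • incl (b : 𝔤) - (incl (c : 𝔤) + Complex.I • incl (d : 𝔤)) =
      incl ((a - c : S.𝔱) : 𝔤) + Complex.I • incl ((b - d : S.𝔱) : 𝔤) := by
    simp only [Submodule.coe_sub, map_sub]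
    module
  obtain ⟨r, -, hr, hr0⟩ := S.ipC_conjC_nonneg
    (incl (a : 𝔤) + Complex.I • incl (b : 𝔤) - (incl (c : 𝔤) + Complex.I • incl (d : 𝔤)))
  apply hr0
  have h0 : ∀ H : S.𝔱, ipC (incl (a : 𝔤) + Complex.I • incl (b : 𝔤) -
      (incl (c : 𝔤) + Complex.I • incl (d : 𝔤))) (incl (H : 𝔤)) = 0 := by
    intro H
    rw [ipC_sub_left, h, sub_self]
  -- The conjugate of the difference lies again in the complexification of `𝔱`, so the difference is
  -- orthogonal to its own conjugate and vanishes by positivity.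
  have h1 : conjC (incl (a : 𝔤) + Complex.I • incl (b : 𝔤) -
      (incl (c : 𝔤) + Complex.I • incl (d : 𝔤))) =
      incl ((a - c : S.𝔱) : 𝔤) - Complex.I • incl ((b - d : S.𝔱) : 𝔤) := by
    rw [e, conjC_add_smul]
  rw [h1, ipC_sub_right, ipC_smul_right, h0, h0, mul_zero, sub_zero] at hr
  exact_mod_cast hr.symm

theorem exists_of_sharp {α : S.Form} (hα : α ∈ S.Δ) :
    ∃ h k : S.𝔱, S.sharp α = incl (h : 𝔤) + Complex.I • incl (k : 𝔤) := by
  obtain ⟨h, hh⟩ := (S.sharp_spec hα).1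
  exact ⟨0, h, by simp [hh]⟩

theorem sharp_ne_zero {α : S.Form} (hα : α ∈ S.Δ) : S.sharp α ≠ 0 := by
  intro h
  obtain ⟨H, hH⟩ := S.exists_ne_zero hα
  have h2 := (S.sharp_spec hα).2 H
  rw [h, ipC_zero_left] at h2
  exact hH (neg_eq_zero.1 h2.symm)

theorem σC_sharp {α : S.Form} (hα : α ∈ S.Δ) : S.σC (S.sharp α) = S.sharp (S.σf α) := by
  refine S.eq_of_ipC_𝔱 ?_ (S.exists_of_sharp (S.σf_mem_Δ hα)) fun H => ?_
  · obtain ⟨h, k, hh⟩ := S.exists_of_sharp hα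
    refine ⟨⟨S.σ h, S.σ_mem_𝔱 h.2⟩, ⟨S.σ k, S.σ_mem_𝔱 k.2⟩, ?_⟩
    rw [hh, map_add, map_smul, σC_incl, σC_incl]
  · rw [(S.sharp_spec (S.σf_mem_Δ hα)).2, σf_apply, ← (S.sharp_spec hα).2, ← ipC_σC, σC_σC,
      σC_incl]

/-- The zero weight space is the complexification of `𝔱`. -/
theorem exists_of_lie_eq_zero {A : ℂ ⊗[ℝ] 𝔤} (h : ∀ H : S.𝔱, ⁅(incl (H : 𝔤) : ℂ ⊗[ℝ] 𝔤), A⁆ = 0) :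
    ∃ h k : S.𝔱, A = incl (h : 𝔤) + Complex.I • incl (k : 𝔤) := by
  obtain ⟨X, Y, rfl⟩ := exists_incl_add A
  have h1 : ∀ H : S.𝔱, ⁅(H : 𝔤), X⁆ = 0 ∧ ⁅(H : 𝔤), Y⁆ = 0 := by
    intro H
    have h2 := h H
    rw [lie_addC, lie_smulC, lie_incl, lie_incl] at h2
    exact incl_add_eq_zero h2
  exact ⟨⟨X, S.mem_𝔱_of_lie_eq_zero fun H => (h1 H).1⟩,
    ⟨Y, S.mem_𝔱_of_lie_eq_zero fun H => (h1 H).2⟩, rfl⟩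

end Sharp

/-! ### Complex root spaces. -/

section RootSpaces

variable {𝔤 : Type*} [LieRing 𝔤] [LieAlgebra ℝ 𝔤] (S : SymData 𝔤)

theorem smul_mem_rootSpC {α : S.Form} {A : ℂ ⊗[ℝ] 𝔤} (z : ℂ) (hA : A ∈ S.rootSpC α) :
    z • A ∈ S.rootSpC α := by
  intro H
  rw [lie_smulC, hA H, smul_comm]

theorem sub_mem_rootSpC {α : S.Form} {A B : ℂ ⊗[ℝ] 𝔤} (hA : A ∈ S.rootSpC α)
    (hB : B ∈ S.rootSpC α) : A - B ∈ S.rootSpC α := by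
  intro H
  rw [lie_subC, hA H, hB H, smul_sub]

theorem conjC_mem_rootSpC {α : S.Form} (hα : α ∈ S.Δ) {A : ℂ ⊗[ℝ] 𝔤} (hA : A ∈ S.rootSpC α) :
    conjC A ∈ S.rootSpC (-α) := by
  intro H
  have h := congrArg conjC (hA H)
  rw [conjC_lie, conjC_incl, conjC_smul, S.conj_root hα] at h
  exact h

theorem incl_mem_rootSpC_zero (H : S.𝔱) : (incl (H : 𝔤) : ℂ ⊗[ℝ] 𝔤) ∈ S.rootSpC 0 := by
  intro H'
  rw [lie_incl, S.lie_𝔱]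
  simp

/-- `ad(H)` is skew for the invariant form, whence `(α + β)(H) ⟨A, B⟩ = 0` for all `H`. -/
theorem ipC_rootSpC {α β : S.Form} {A B : ℂ ⊗[ℝ] 𝔤} (hA : A ∈ S.rootSpC α)
    (hB : B ∈ S.rootSpC β) (h : α + β ≠ 0) : ipC A B = 0 := by
  obtain ⟨H, hH⟩ : ∃ H, (α + β) H ≠ 0 := by
    by_contra! h2
    exact h (LinearMap.ext h2)
  have h1 : ipC ⁅(incl (H : 𝔤) : ℂ ⊗[ℝ] 𝔤), A⁆ B = -ipC A ⁅(incl (H : 𝔤) : ℂ ⊗[ℝ] 𝔤), B⁆ := by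
    rw [lie_skewC, ipC_neg_left, ipC_lie]
  rw [hA H, hB H, ipC_smul_left, ipC_smul_right] at h1
  have h2 : (α + β) H * ipC A B = 0 := by
    rw [LinearMap.add_apply]
    linear_combination h1
  exact (mul_eq_zero.1 h2).resolve_left hH

/-- With `α^♯ = ih` one has `α(h) = -i⟨h, h⟩`, so `r = ⟨h, h⟩`. The sign of this eigenvalue is what
forces root spaces to be one-dimensional. -/
theorem lie_sharp [FiniteDimensional ℝ 𝔤] {α : S.Form} (hα : α ∈ S.Δ) :
    ∃ r : ℝ, 0 < r ∧ ∀ A ∈ S.rootSpC (-α), ⁅S.sharp α, A⁆ = -(r : ℂ) • A := by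
  obtain ⟨⟨h, hh⟩, h2⟩ := S.sharp_spec hα
  have h3 := h2 h
  rw [hh, ipC_smul_left, ipC_incl] at h3
  refine ⟨ip (h : 𝔤) (h : 𝔤), S.ip_self_pos ?_, fun A hA => ?_⟩
  · intro h0
    apply S.sharp_ne_zero hα
    rw [hh, h0, map_zero, smul_zero]
  · rw [hh, smul_lieC, hA h, smul_smul]
    congr 1
    rw [LinearMap.neg_apply]
    linear_combination -Complex.I * h3 + (ip (h : 𝔤) (h : 𝔤) : ℂ) * Complex.I_mul_I

end RootSpaces

/-! ### Signs and structure constants of an adapted Chevalley basis. -/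

namespace IsAdapted

variable {𝔤 : Type*} [LieRing 𝔤] [LieAlgebra ℝ 𝔤] [FiniteDimensional ℝ 𝔤] {S : SymData 𝔤}
  {X : S.Form → ℂ ⊗[ℝ] 𝔤} {c : S.Form → S.Form → ℝ} {s : S.Form → ℂ}

theorem lie_self_neg (h : S.IsAdapted X c s) {α : S.Form} (hα : α ∈ S.Δ) :
    ⁅X α, X (-α)⁆ = S.sharp α :=
  h.lie_neg α hα _ (S.neg_mem_Δ hα) (add_neg_cancel α)

theorem ne_zero (h : S.IsAdapted X c s) {α : S.Form} (hα : α ∈ S.Δ) : X α ≠ 0 := by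
  intro h0
  have h1 := h.lie_self_neg hα
  rw [h0, zero_lieC] at h1
  exact S.sharp_ne_zero hα h1.symm

theorem conj_eq' (h : S.IsAdapted X c s) {α : S.Form} (hα : α ∈ S.Δ) :
    conjC (X α) = -X (-α) := by
  rw [h.conj_eq α hα, neg_neg]

theorem conj_neg_eq (h : S.IsAdapted X c s) {α : S.Form} (hα : α ∈ S.Δ) :
    conjC (X (-α)) = -X α := by
  rw [h.conj_eq' (S.neg_mem_Δ hα), neg_neg]

/-- By invariance `α(H) ⟨X_α, X_{-α}⟩ = ⟨H, α^♯⟩ = -α(H)`: the normalisation of `[X_α, X_{-α}]`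
determines that of the inner product. -/
theorem ipC_self_neg (h : S.IsAdapted X c s) {α : S.Form} (hα : α ∈ S.Δ) :
    ipC (X α) (X (-α)) = -1 := by
  obtain ⟨H, hH⟩ := S.exists_ne_zero hα
  have h1 := ipC_lie (incl (H : 𝔤)) (X α) (X (-α))
  rw [h.lie_self_neg hα, h.mem α hα H, ipC_smul_left, ipC_comm, ← ipC_comm (S.sharp α),
    (S.sharp_spec hα).2, ipC_comm] at h1
  have h2 : α H * (ipC (X α) (X (-α)) + 1) = 0 := by linear_combination h1
  exact eq_neg_of_add_eq_zero_left ((mul_eq_zero.1 h2).resolve_left hH)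

/-- The root spaces are one-dimensional. -/
theorem eq_smul_of_mem_rootSpC (h : S.IsAdapted X c s) {α : S.Form} (hα : α ∈ S.Δ)
    {A : ℂ ⊗[ℝ] 𝔤} (hA : A ∈ S.rootSpC α) : A = (-ipC A (X (-α))) • X α := by
  -- `A'` is the part of `A` orthogonal to `X_{-α}`; it is shown to be zero.
  set A' := A - (-ipC A (X (-α))) • X α with hA'
  have hm : A' ∈ S.rootSpC α := S.sub_mem_rootSpC hA (S.smul_mem_rootSpC _ (h.mem α hα))
  have h0 : ipC A' (X (-α)) = 0 := by
    rw [hA', ipC_sub_left, ipC_smul_left, h.ipC_self_neg hα]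
    ring
  have hn := h.mem _ (S.neg_mem_Δ hα)
  -- This bracket has weight zero, so it lies in the complexification of `𝔱`; by invariance and `h0`
  -- it is orthogonal to `𝔱`.
  have hC : ⁅X (-α), A'⁆ = 0 := by
    refine S.eq_of_ipC_𝔱 (S.exists_of_lie_eq_zero fun H => ?_) ⟨0, 0, by simp⟩ fun H => ?_
    · rw [leibniz_lieC, hn H, hm H, smul_lieC, lie_smulC, LinearMap.neg_apply, neg_smul,
        neg_add_cancel]
    · rw [ipC_zero_left, ipC_lie, lie_skewC, hm H, ipC_neg_right, ipC_smul_right, ipC_comm, h0,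
        mul_zero, neg_zero]
  obtain ⟨r, hr, hr2⟩ := S.lie_sharp hα
  have hD : ⁅X α, conjC A'⁆ = 0 := by
    have h1 := congrArg conjC hC
    rw [conjC_lie, h.conj_neg_eq hα, neg_lieC, map_zero, neg_eq_zero] at h1
    exact h1
  -- Invariance, the Jacobi identity and `hD` turn the squared norm of `[X_α, A']` into `-r` times
  -- that of `A'`. Since `r > 0`, both must vanish.
  have hB : ipC ⁅X α, A'⁆ (conjC ⁅X α, A'⁆) = -(r : ℂ) * ipC A' (conjC A') := by
    rw [conjC_lie, h.conj_eq' hα, neg_lieC, ipC_neg_right, lie_skewC (X α) A', ipC_neg_left,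
      neg_neg, ipC_lie, leibniz_lieC, h.lie_self_neg hα, hD, lie_zeroC, add_zero,
      hr2 _ (S.conjC_mem_rootSpC hα hm), ipC_smul_right]
  obtain ⟨p, hp, hp1, -⟩ := S.ipC_conjC_nonneg ⁅X α, A'⁆
  obtain ⟨q, hq, hq1, hq2⟩ := S.ipC_conjC_nonneg A'
  rw [hp1, hq1] at hB
  have h2 : p = -r * q := by exact_mod_cast hB
  have h3 : q = 0 := by nlinarith
  exact sub_eq_zero.1 (hq2 h3)

theorem s_mul_self (h : S.IsAdapted X c s) {α : S.Form} (hα : α ∈ S.Δ) : s α * s α = 1 := by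
  rcases h.s_sign α hα with h1 | h1 <;> rw [h1] <;> norm_num

theorem conj_s (h : S.IsAdapted X c s) {α : S.Form} (hα : α ∈ S.Δ) :
    starRingEnd ℂ (s α) = s α := by
  rcases h.s_sign α hα with h1 | h1 <;> rw [h1] <;> simp

theorem σC_eq (h : S.IsAdapted X c s) {α : S.Form} (hα : α ∈ S.Δ) :
    S.σC (X α) = s α • X (S.σf α) := h.σ_eq α hα

/-- `σ` commutes with conjugation, which maps `X_α` to `-X_{-α}`, and `s_α` is real. -/
theorem s_neg (h : S.IsAdapted X c s) {α : S.Form} (hα : α ∈ S.Δ) : s (-α) = s α := by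
  have hn := S.neg_mem_Δ hα
  have h1 := h.σC_eq hn
  rw [h.conj_eq α hα, map_neg, S.σC_conjC, h.σC_eq hα, conjC_smul, h.conj_s hα,
    h.conj_eq' (S.σf_mem_Δ hα), smul_neg, neg_neg, S.σf_neg] at h1
  have h2 := h.ne_zero (S.neg_mem_Δ (S.σf_mem_Δ hα))
  exact (smul_left_injective ℂ h2 h1).symm

theorem s_σf (h : S.IsAdapted X c s) {α : S.Form} (hα : α ∈ S.Δ) : s (S.σf α) = s α := by
  have h1 := congrArg S.σC (h.σC_eq hα)
  rw [S.σC_σC, map_smul, h.σC_eq (S.σf_mem_Δ hα), S.σf_σf, smul_smul] at h1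
  have h2 : s α * s (S.σf α) = 1 := by
    apply smul_left_injective ℂ (h.ne_zero hα)
    change (s α * s (S.σf α)) • X α = (1 : ℂ) • X α
    rw [one_smul]
    exact h1.symm
  linear_combination s α * h2 - s (S.σf α) * h.s_mul_self hα

theorem c_skew (h : S.IsAdapted X c s) {α β : S.Form} (hα : α ∈ S.Δ) (hβ : β ∈ S.Δ)
    (hαβ : α + β ∈ S.Δ) : c β α = -c α β := by
  have h1 := h.lie_root α hα β hβ hαβ
  have h2 := h.lie_root β hβ α hα (by rwa [add_comm])
  rw [lie_skewC, h1, add_comm β α, ← neg_smul] at h2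
  have h3 := smul_left_injective ℂ (h.ne_zero hαβ) h2
  have h4 : -c α β = c β α := by exact_mod_cast h3
  exact h4.symm

/-- `σ` is an automorphism: compare the coefficients of `X_{σ(α+β)}` in `σ[X_α, X_β] = [σ X_α, σ
X_β]`. -/
theorem c_σf (h : S.IsAdapted X c s) {α β : S.Form} (hα : α ∈ S.Δ) (hβ : β ∈ S.Δ)
    (hαβ : α + β ∈ S.Δ) :
    (c α β : ℂ) * s (α + β) = s α * s β * c (S.σf α) (S.σf β) := by
  have h1 := congrArg S.σC (h.lie_root α hα β hβ hαβ)
  have hαβ' := S.σf_mem_Δ hαβ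
  rw [S.σf_add] at hαβ'
  rw [S.σC_lie, h.σC_eq hα, h.σC_eq hβ, map_smul, h.σC_eq hαβ, smul_lieC, lie_smulC,
    h.lie_root _ (S.σf_mem_Δ hα) _ (S.σf_mem_Δ hβ) hαβ', S.σf_add, smul_smul, smul_smul,
    smul_smul] at h1
  have h3 := smul_left_injective ℂ (h.ne_zero hαβ') h1
  linear_combination -h3

theorem c_neg_left (h : S.IsAdapted X c s) {α β : S.Form} (hα : α ∈ S.Δ) (hβ : β ∈ S.Δ) :
    c (-α) β = -c α (-β) := by
  have := h.c_neg α hα (-β) (S.neg_mem_Δ hβ)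
  rwa [neg_neg] at this

end IsAdapted

theorem rt_mul_rt : rt * rt = 1 / 2 := by
  rw [rt, ← Complex.ofReal_mul, div_mul_div_comm, Real.mul_self_sqrt (by norm_num)]
  simp

theorem conj_rt : starRingEnd ℂ rt = rt := Complex.conj_ofReal _

theorem rt_ne_zero : rt ≠ 0 := by
  intro h
  have := rt_mul_rt
  rw [h] at this
  norm_num at this

/-! ### The vectors `V_α(z)` as functions of `α` and `z`. -/

section Vectors

variable {𝔤 : Type*} [LieRing 𝔤] [LieAlgebra ℝ 𝔤] (S : SymData 𝔤) (X : S.Form → ℂ ⊗[ℝ] 𝔤)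

theorem V_of_mem {α : S.Form} (hα : α ∈ S.Δ) (z : ℂ) :
    S.V X α z = rt • (z • X α - (starRingEnd ℂ z) • X (-α)) := if_pos hα

theorem V_of_not_mem {α : S.Form} (hα : α ∉ S.Δ) (z : ℂ) : S.V X α z = 0 := if_neg hα

theorem V_neg (α : S.Form) (z : ℂ) : S.V X (-α) z = -S.V X α (starRingEnd ℂ z) := by
  by_cases hα : α ∈ S.Δ
  · rw [S.V_of_mem X hα, S.V_of_mem X (S.neg_mem_Δ hα), neg_neg, Complex.conj_conj]
    module
  · rw [S.V_of_not_mem X hα, S.V_of_not_mem X (mt S.neg_mem_Δ_iff.1 hα), neg_zero]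

theorem V_add (α : S.Form) (z w : ℂ) : S.V X α (z + w) = S.V X α z + S.V X α w := by
  by_cases hα : α ∈ S.Δ
  · simp only [S.V_of_mem X hα, map_add]
    module
  · simp only [S.V_of_not_mem X hα, add_zero]

/-- `V_α` is only real linear in `z`; the hypothesis says that `r` is real. It is applied to `1/√2`,
to the signs `s_α` and to `α(H)²`. -/
theorem V_smul (α : S.Form) {r : ℂ} (hr : starRingEnd ℂ r = r) (z : ℂ) :
    S.V X α (r * z) = r • S.V X α z := by
  by_cases hα : α ∈ S.Δ
  · simp only [S.V_of_mem X hα, map_mul, hr]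
    module
  · simp only [S.V_of_not_mem X hα, smul_zero]

theorem V_neg_arg (α : S.Form) (z : ℂ) : S.V X α (-z) = -S.V X α z := by
  rw [← neg_one_mul, S.V_smul X α (by simp), neg_one_smul]

theorem V_zero (α : S.Form) : S.V X α 0 = 0 := by
  have := S.V_smul X α (r := 0) (by simp) 0
  rwa [zero_mul, zero_smul] at this

theorem V_sub (α : S.Form) (z w : ℂ) : S.V X α (z - w) = S.V X α z - S.V X α w := by
  rw [sub_eq_add_neg, V_add, V_neg_arg, sub_eq_add_neg]

end Vectors

/-! ### `V_α(z)` under conjugation, `σ` and the bracket. -/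

namespace IsAdapted

variable {𝔤 : Type*} [LieRing 𝔤] [LieAlgebra ℝ 𝔤] [FiniteDimensional ℝ 𝔤] {S : SymData 𝔤}
  {X : S.Form → ℂ ⊗[ℝ] 𝔤} {c : S.Form → S.Form → ℝ} {s : S.Form → ℂ}

theorem conjC_V (h : S.IsAdapted X c s) (α : S.Form) (z : ℂ) :
    conjC (S.V X α z) = S.V X α z := by
  by_cases hα : α ∈ S.Δ
  · rw [S.V_of_mem X hα, conjC_smul, conj_rt, map_sub, conjC_smul, conjC_smul, h.conj_eq' hα,
      h.conj_neg_eq hα, Complex.conj_conj]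
    module
  · rw [S.V_of_not_mem X hα, map_zero]

theorem σC_V (h : S.IsAdapted X c s) {α : S.Form} (hα : α ∈ S.Δ) (z : ℂ) :
    S.σC (S.V X α z) = s α • S.V X (S.σf α) z := by
  rw [S.V_of_mem X hα, S.V_of_mem X (S.σf_mem_Δ hα), map_smul, map_sub, map_smul, map_smul,
    h.σC_eq hα, h.σC_eq (S.neg_mem_Δ hα), h.s_neg hα, S.σf_neg]
  module

theorem V_s_mul (h : S.IsAdapted X c s) {α : S.Form} (hα : α ∈ S.Δ) (β : S.Form) (z : ℂ) :
    S.V X β (s α * z) = s α • S.V X β z :=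
  S.V_smul X β (h.conj_s hα) z

theorem V_σf (h : S.IsAdapted X c s) {α : S.Form} (hα : α ∈ S.Δ) (z : ℂ) :
    S.V X (S.σf α) z = s α • S.σC (S.V X α z) := by
  rw [h.σC_V hα, smul_smul, h.s_mul_self hα, one_smul]

/-- This form and that of `M_eq` mention neither `s_α` nor `σ(α)` and hold for non-roots too; the
bracket computations rest on them. -/
theorem K_eq (h : S.IsAdapted X c s) (α : S.Form) (z : ℂ) :
    S.K X s α z = rt • (S.V X α z + S.σC (S.V X α z)) := by
  by_cases hα : α ∈ S.Δ
  · rw [h.σC_V hα, K]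
  · rw [K, S.V_of_not_mem X hα, S.V_of_not_mem X (mt S.σf_mem_Δ_iff.1 hα), map_zero, smul_zero]

theorem M_eq (h : S.IsAdapted X c s) (α : S.Form) (z : ℂ) :
    S.M X s α z = rt • (S.V X α z - S.σC (S.V X α z)) := by
  by_cases hα : α ∈ S.Δ
  · rw [h.σC_V hα, M]
  · rw [M, S.V_of_not_mem X hα, S.V_of_not_mem X (mt S.σf_mem_Δ_iff.1 hα), map_zero, smul_zero]

theorem σC_K (h : S.IsAdapted X c s) (α : S.Form) (z : ℂ) :
    S.σC (S.K X s α z) = S.K X s α z := by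
  rw [h.K_eq, map_smul, map_add, S.σC_σC, add_comm]

theorem σC_M (h : S.IsAdapted X c s) (α : S.Form) (z : ℂ) :
    S.σC (S.M X s α z) = -S.M X s α z := by
  rw [h.M_eq, map_smul, map_sub, S.σC_σC, ← smul_neg, neg_sub]

theorem lie_incl_V (h : S.IsAdapted X c s) {α : S.Form} (hα : α ∈ S.Δ) (H : S.𝔱) (z : ℂ) :
    ⁅(incl (H : 𝔤) : ℂ ⊗[ℝ] 𝔤), S.V X α z⁆ = S.V X α (α H * z) := by
  rw [S.V_of_mem X hα, S.V_of_mem X hα, lie_smulC, lie_subC, lie_smulC, lie_smulC,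
    h.mem α hα H, h.mem _ (S.neg_mem_Δ hα) H, map_mul, S.conj_root hα, LinearMap.neg_apply]
  module

open Classical in
/-- The bracket of two basis vectors which are not opposite. -/
theorem lie_X (h : S.IsAdapted X c s) {α β : S.Form} (hα : α ∈ S.Δ) (hβ : β ∈ S.Δ)
    (hαβ : α + β ≠ 0) : ⁅X α, X β⁆ = (c α β : ℂ) • if α + β ∈ S.Δ then X (α + β) else 0 := by
  split_ifs with hm
  · exact h.lie_root α hα β hβ hm
  · rw [h.lie_zero α hα β hβ hm hαβ, smul_zero]

theorem lie_V_of_ne (h : S.IsAdapted X c s) {α β : S.Form} (hα : α ∈ S.Δ) (hβ : β ∈ S.Δ)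
    (h1 : β ≠ α) (h2 : β ≠ -α) (z w : ℂ) :
    ⁅S.V X α z, S.V X β w⁆ = rt • ((c α β : ℂ) • S.V X (α + β) (z * w)
      - (c α (-β) : ℂ) • S.V X (α - β) (z * starRingEnd ℂ w)) := by
  classical
  have hα' := S.neg_mem_Δ hα
  have hβ' := S.neg_mem_Δ hβ
  -- A formula for `V` valid whether or not `γ` is a root, so that `α + β` and `α - β` need no case
  -- distinction.
  have e : ∀ γ z, S.V X γ z = rt • (z • (if γ ∈ S.Δ then X γ else 0) -
      (starRingEnd ℂ z) • (if -γ ∈ S.Δ then X (-γ) else 0)) := by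
    intro γ z
    by_cases hγ : γ ∈ S.Δ
    · rw [S.V_of_mem X hγ, if_pos hγ, if_pos (S.neg_mem_Δ hγ)]
    · rw [S.V_of_not_mem X hγ, if_neg hγ, if_neg (mt S.neg_mem_Δ_iff.1 hγ)]
      simp
  have n1 : α + β ≠ 0 := fun h0 => h2 (eq_neg_of_add_eq_zero_right h0)
  have n2 : α + -β ≠ 0 := fun h0 => h1 (by rw [← sub_eq_add_neg, sub_eq_zero] at h0; exact h0.symm)
  have n3 : -α + β ≠ 0 := fun h0 => n2 (by rw [← neg_eq_zero, ← h0]; abel)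
  have n4 : -α + -β ≠ 0 := fun h0 => n1 (by rw [← neg_eq_zero, ← h0]; abel)
  rw [e (α + β), e (α - β), S.V_of_mem X hα, S.V_of_mem X hβ]
  simp only [smul_lieC, lie_smulC, sub_lieC, lie_subC]
  rw [h.lie_X hα hβ n1, h.lie_X hα hβ' n2, h.lie_X hα' hβ n3, h.lie_X hα' hβ' n4,
    h.c_neg α hα β hβ, h.c_neg_left hα hβ]
  have e1 : -(α + β) = -α + -β := by abel
  have e2 : -(α - β) = -α + β := by abel
  rw [e1, e2, sub_eq_add_neg α β]
  simp only [map_mul, Complex.conj_conj, Complex.ofReal_neg]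
  module

theorem lie_V_self (h : S.IsAdapted X c s) {α : S.Form} (hα : α ∈ S.Δ) (z w : ℂ) :
    ⁅S.V X α z, S.V X α w⁆ = (((starRingEnd ℂ z * w).im : ℂ) * Complex.I) • S.sharp α := by
  have h1 : ((starRingEnd ℂ z * w).im : ℂ) * Complex.I =
      1 / 2 * (starRingEnd ℂ z * w - z * starRingEnd ℂ w) := by
    have := Complex.sub_conj (starRingEnd ℂ z * w)
    rw [map_mul, Complex.conj_conj] at this
    rw [this]
    push_cast
    ring
  rw [h1, S.V_of_mem X hα, S.V_of_mem X hα]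
  simp only [smul_lieC, lie_smulC, sub_lieC, lie_subC, lie_selfC]
  rw [lie_skewC (X (-α)), h.lie_self_neg hα, ← rt_mul_rt]
  module

open Classical in
theorem lie_V (h : S.IsAdapted X c s) {α β : S.Form} (hα : α ∈ S.Δ) (hβ : β ∈ S.Δ) (z w : ℂ) :
    ⁅S.V X α z, S.V X β w⁆ = S.VV X c α z β w := by
  unfold VV
  split_ifs with h1 h2
  · rw [h1, h.lie_V_self hα]
  · rw [h2, S.V_neg, lie_negC, h.lie_V_self hα, ← neg_smul]
    congr 1
    rw [← map_mul, Complex.conj_im]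
    push_cast
    ring
  · exact h.lie_V_of_ne hα hβ h1 h2 z w

end IsAdapted

/-- A real root vector is the sum of a complex root vector and its conjugate. -/
theorem exists_rootSpC {𝔤 : Type*} [LieRing 𝔤] [LieAlgebra ℝ 𝔤] (S : SymData 𝔤) {α : S.Form}
    (hα : α ∈ S.Δ) {Y : 𝔤} (hY : Y ∈ S.rootSp α) :
    ∃ A ∈ S.rootSpC α, (2 : ℂ) • incl Y = A + conjC A := by
  obtain ⟨H₀, h0⟩ := S.exists_ne_zero hα
  have sq : ∀ H : S.𝔱, ⁅(incl (H : 𝔤) : ℂ ⊗[ℝ] 𝔤), ⁅(incl (H : 𝔤) : ℂ ⊗[ℝ] 𝔤), incl Y⁆⁆ =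
      (α H) ^ 2 • incl Y := by
    intro H
    rw [lie_incl, lie_incl]
    exact hY H
  have comm : ∀ (H : S.𝔱) (B : ℂ ⊗[ℝ] 𝔤), ⁅(incl (H : 𝔤) : ℂ ⊗[ℝ] 𝔤), ⁅(incl (H₀ : 𝔤) : ℂ ⊗[ℝ] 𝔤), B⁆⁆ =
      ⁅(incl (H₀ : 𝔤) : ℂ ⊗[ℝ] 𝔤), ⁅(incl (H : 𝔤) : ℂ ⊗[ℝ] 𝔤), B⁆⁆ := by
    intro H B
    rw [leibniz_lieC, lie_incl, S.lie_𝔱, map_zero, zero_lieC, zero_add]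
  -- Polarisation of the quadratic identity `sq` in `H`.
  have polar : ∀ H : S.𝔱, ⁅(incl (H₀ : 𝔤) : ℂ ⊗[ℝ] 𝔤), ⁅(incl (H : 𝔤) : ℂ ⊗[ℝ] 𝔤), incl Y⁆⁆ =
      (α H * α H₀) • incl Y := by
    intro H
    have h1 := sq (H + H₀)
    rw [Submodule.coe_add, map_add, map_add] at h1
    simp only [add_lieC, lie_addC] at h1
    rw [sq, sq, comm] at h1
    have h2 : (2 : ℂ) • ⁅(incl (H₀ : 𝔤) : ℂ ⊗[ℝ] 𝔤), ⁅(incl (H : 𝔤) : ℂ ⊗[ℝ] 𝔤), incl Y⁆⁆ =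
        (2 : ℂ) • (α H * α H₀) • incl Y := by
      have h3 := sub_eq_zero.2 h1
      rw [← sub_eq_zero, ← h3]
      module
    exact smul_right_injective _ (two_ne_zero (α := ℂ)) h2
  -- Apply `ad(H₀)` to `polar`. As `ad(H)` commutes with `ad(H₀)²`, this yields `α(H₀)² [H, Y] =
  -- α(H) α(H₀) [H₀, Y]`.
  have prop : ∀ H : S.𝔱, ⁅(incl (H : 𝔤) : ℂ ⊗[ℝ] 𝔤), incl Y⁆ =
      (α H * (α H₀)⁻¹) • ⁅(incl (H₀ : 𝔤) : ℂ ⊗[ℝ] 𝔤), incl Y⁆ := by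
    intro H
    have h1 := congrArg (fun B => ⁅(incl (H₀ : 𝔤) : ℂ ⊗[ℝ] 𝔤), B⁆) (polar H)
    simp only [lie_smulC] at h1
    rw [← comm H (incl Y), ← comm H ⁅(incl (H₀ : 𝔤) : ℂ ⊗[ℝ] 𝔤), incl Y⁆, sq, lie_smulC] at h1
    have h2 : (α H₀ ^ 2) • ⁅(incl (H : 𝔤) : ℂ ⊗[ℝ] 𝔤), incl Y⁆ =
        (α H₀ ^ 2) • (α H * (α H₀)⁻¹) • ⁅(incl (H₀ : 𝔤) : ℂ ⊗[ℝ] 𝔤), incl Y⁆ := by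
      rw [h1, smul_smul]
      congr 1
      field_simp
    exact smul_right_injective _ (pow_ne_zero 2 h0) h2
  -- Twice the projection of `Y` to the `α(H₀)`-eigenspace of `ad(H₀)`. As `α(H₀)` is imaginary,
  -- conjugation changes the sign of the second term, so the sum with the conjugate is `2Y`.
  refine ⟨incl Y + (α H₀)⁻¹ • ⁅(incl (H₀ : 𝔤) : ℂ ⊗[ℝ] 𝔤), incl Y⁆, fun H => ?_, ?_⟩
  · rw [lie_addC, lie_smulC, comm, polar, prop H, smul_smul, smul_add, smul_smul, add_comm]
    congr 2
    field_simp
  · rw [map_add, conjC_smul, conjC_lie, conjC_incl, conjC_incl, map_inv₀, S.conj_root hα, inv_neg]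
    module

/-! ### The real root spaces and the spaces `𝔨_α` and `𝔪_α`. -/

namespace IsAdapted

variable {𝔤 : Type*} [LieRing 𝔤] [LieAlgebra ℝ 𝔤] [FiniteDimensional ℝ 𝔤] {S : SymData 𝔤}
  {X : S.Form → ℂ ⊗[ℝ] 𝔤} {c : S.Form → S.Form → ℝ} {s : S.Form → ℂ}

theorem exists_eq_V (h : S.IsAdapted X c s) {α : S.Form} (hα : α ∈ S.Δ) {Y : 𝔤}
    (hY : Y ∈ S.rootSp α) : ∃ z, incl Y = S.V X α z := by
  obtain ⟨A, hA, hAY⟩ := S.exists_rootSpC hα hY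
  rw [h.eq_smul_of_mem_rootSpC hα hA] at hAY
  set a := -ipC A (X (-α))
  -- Here `2Y = a X_α - ā X_{-α}`, and `V_α` contributes a second factor `1/√2`.
  refine ⟨rt * a, ?_⟩
  rw [conjC_smul, h.conj_eq' hα] at hAY
  apply smul_right_injective _ (two_ne_zero (α := ℂ))
  change (2 : ℂ) • incl Y = (2 : ℂ) • S.V X α (rt * a)
  rw [hAY, S.V_smul X α conj_rt, S.V_of_mem X hα, smul_smul, smul_smul, mul_assoc, rt_mul_rt]
  module

theorem exists_incl_eq_V (h : S.IsAdapted X c s) {α : S.Form} (hα : α ∈ S.Δ) (z : ℂ) :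
    ∃ Y ∈ S.rootSp α, incl Y = S.V X α z := by
  obtain ⟨Y, hY⟩ := exists_incl_of_conjC (h.conjC_V α z)
  refine ⟨Y, fun H => ?_, hY⟩
  rw [← lie_incl, ← lie_incl, hY, h.lie_incl_V hα, h.lie_incl_V hα, ← mul_assoc, ← sq]
  refine S.V_smul X α ?_ z
  rw [map_pow, S.conj_root hα, neg_sq]

theorem ne_neg_self (_h : S.IsAdapted X c s) {α : S.Form} (hα : α ∈ S.Δ) : α + α ≠ 0 := by
  intro h0
  apply hα.1
  have h1 : (2 : ℂ) • α = 0 := by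
    rw [two_smul, h0]
  exact (smul_eq_zero.1 h1).resolve_left two_ne_zero

theorem ipC_X_self (h : S.IsAdapted X c s) {α : S.Form} (hα : α ∈ S.Δ) : ipC (X α) (X α) = 0 :=
  S.ipC_rootSpC (h.mem α hα) (h.mem α hα) (h.ne_neg_self hα)

theorem eq_zero_of_V (h : S.IsAdapted X c s) {α : S.Form} (hα : α ∈ S.Δ) {z : ℂ}
    (hz : S.V X α z = 0) : z = 0 := by
  have h1 : ipC (S.V X α z) (X (-α)) = -rt * z := by
    rw [S.V_of_mem X hα, ipC_smul_left, ipC_sub_left, ipC_smul_left, ipC_smul_left,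
      h.ipC_self_neg hα, h.ipC_X_self (S.neg_mem_Δ hα)]
    ring
  rw [hz, ipC_zero_left] at h1
  exact (mul_eq_zero.1 h1.symm).resolve_left (neg_ne_zero.2 rt_ne_zero)

/-- By maximality of `𝔞`, the root vectors of a `σ`-invariant root lie in `𝔨`. -/
theorem s_eq_one (h : S.IsAdapted X c s) {α : S.Form} (hα : α ∈ S.Δ) (hσ : S.σf α = α) :
    s α = 1 := by
  refine (h.s_sign α hα).resolve_right fun hs => ?_
  -- If `s_α = -1`, then `V_α(1)` is a vector of `𝔪`. It commutes with `𝔞`, on which `α` vanishes,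
  -- so by maximality it lies in `𝔞 ⊆ 𝔱`. But then it commutes with `𝔱`, contrary to `[H, V_α(1)] =
  -- V_α(α(H))`.
  obtain ⟨Y, -, hY⟩ := h.exists_incl_eq_V hα 1
  have hYm : S.σ Y = -Y := by
    apply incl_injective
    rw [← S.σC_incl, hY, h.σC_V hα, hs, hσ, map_neg, hY, neg_one_smul]
  have hcomm : ∀ A ∈ S.𝔞, ⁅Y, A⁆ = 0 := by
    intro A hA
    have hAt := S.𝔞_le_𝔱 hA
    have h1 : α ⟨A, hAt⟩ = 0 := by
      have h2 := S.σf_apply α ⟨A, hAt⟩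
      have h3 : (⟨S.σ A, S.σ_mem_𝔱 hAt⟩ : S.𝔱) = -⟨A, hAt⟩ :=
        Subtype.ext (S.𝔞_maximal.prop.1 A hA)
      rw [hσ, h3, map_neg] at h2
      exact self_eq_neg.1 h2
    apply incl_injective
    rw [← lie_incl, lie_skewC, hY, h.lie_incl_V hα ⟨A, hAt⟩, h1, zero_mul, S.V_zero, neg_zero,
      map_zero]
  have hmem : Y ∈ S.𝔞 := by
    have hle : S.𝔞 ⊔ Submodule.span ℝ {Y} ≤ S.𝔞 := by
      refine S.𝔞_maximal.le_of_ge ⟨?_, S.𝔞_maximal.prop.2.sup_span hcomm⟩ le_sup_left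
      intro Z hZ
      obtain ⟨a, ha, p, hp, rfl⟩ := Submodule.mem_sup.1 hZ
      obtain ⟨r, rfl⟩ := Submodule.mem_span_singleton.1 hp
      simp only [map_add, map_smul, hYm, S.𝔞_maximal.prop.1 a ha]
      module
    exact hle (Submodule.mem_sup_right (Submodule.mem_span_singleton_self _))
  obtain ⟨H, hH⟩ := S.exists_ne_zero hα
  have h4 := h.lie_incl_V hα H 1
  rw [← hY, lie_incl, S.lie_𝔱 H ⟨Y, S.𝔞_le_𝔱 hmem⟩, map_zero] at h4
  have h5 := h.eq_zero_of_V hα h4.symm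
  rw [mul_one] at h5
  exact hH h5

/-- This holds for every root. If `σ(α) = ±α`, the parametrisation is rescaled or made non-redundant
in `range_V_of_fixed` and `range_Kt`. -/
theorem image_𝔨r (h : S.IsAdapted X c s) {α : S.Form} (hα : α ∈ S.Δ) :
    incl '' (S.𝔨r α : Set 𝔤) = Set.range (fun z : ℂ => S.K X s α z) := by
  ext A
  constructor
  · rintro ⟨Y, ⟨hY, hYk⟩, rfl⟩
    obtain ⟨P, hP, Q, hQ, rfl⟩ := Submodule.mem_sup.1 hY
    obtain ⟨z, hz⟩ := h.exists_eq_V hα hP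
    obtain ⟨w, hw⟩ := h.exists_eq_V (S.σf_mem_Δ hα) hQ
    -- Since `V_{σ(α)}(w) = s_α σ V_α(w)`, averaging `V_α(z) + V_{σ(α)}(w)` over `σ` gives `½(1 +
    -- σ)V_α(z + s_α w)`. One of the two factors `1/√2` in `½` is already part of `K_α`.
    refine ⟨rt * (z + s α * w), ?_⟩
    have hσ : incl (P + Q) = S.σC (incl (P + Q)) := by
      rw [S.σC_incl, S.mem_𝔨.1 hYk]
    have hσ2 : incl (P + Q) = (1 / 2 : ℂ) • (incl (P + Q) + S.σC (incl (P + Q))) := by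
      rw [← hσ]
      module
    rw [hσ2]
    simp only [h.K_eq]
    rw [map_add, hz, hw, h.V_σf hα, S.V_smul X α conj_rt, S.V_add, h.V_s_mul hα]
    simp only [map_add, map_smul, S.σC_σC, ← rt_mul_rt]
    module
  · rintro ⟨z, rfl⟩
    obtain ⟨P, hP, hPz⟩ := h.exists_incl_eq_V hα (rt * z)
    obtain ⟨Q, hQ, hQz⟩ := h.exists_incl_eq_V (S.σf_mem_Δ hα) (s α * (rt * z))
    have e : incl (P + Q) = S.K X s α z := by
      rw [map_add, hPz, hQz, h.V_s_mul hα, S.V_smul X _ conj_rt, S.V_smul X _ conj_rt, K]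
      module
    refine ⟨P + Q, ⟨Submodule.add_mem_sup hP hQ, ?_⟩, e⟩
    rw [SetLike.mem_coe, S.mem_𝔨]
    apply incl_injective
    rw [← S.σC_incl, e, h.σC_K]

theorem image_𝔪r (h : S.IsAdapted X c s) {α : S.Form} (hα : α ∈ S.Δ) :
    incl '' (S.𝔪r α : Set 𝔤) = Set.range (fun z : ℂ => S.M X s α z) := by
  ext A
  constructor
  · rintro ⟨Y, ⟨hY, hYk⟩, rfl⟩
    obtain ⟨P, hP, Q, hQ, rfl⟩ := Submodule.mem_sup.1 hY
    obtain ⟨z, hz⟩ := h.exists_eq_V hα hP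
    obtain ⟨w, hw⟩ := h.exists_eq_V (S.σf_mem_Δ hα) hQ
    refine ⟨rt * (z - s α * w), ?_⟩
    have hσ : -incl (P + Q) = S.σC (incl (P + Q)) := by
      rw [S.σC_incl, S.mem_𝔪.1 hYk, map_neg]
    have hσ2 : incl (P + Q) = (1 / 2 : ℂ) • (incl (P + Q) - S.σC (incl (P + Q))) := by
      rw [← hσ]
      module
    rw [hσ2]
    simp only [h.M_eq]
    rw [map_add, hz, hw, h.V_σf hα, S.V_smul X α conj_rt, S.V_sub, h.V_s_mul hα]
    simp only [map_add, map_sub, map_smul, S.σC_σC, ← rt_mul_rt]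
    module
  · rintro ⟨z, rfl⟩
    obtain ⟨P, hP, hPz⟩ := h.exists_incl_eq_V hα (rt * z)
    obtain ⟨Q, hQ, hQz⟩ := h.exists_incl_eq_V (S.σf_mem_Δ hα) (s α * (rt * z))
    have e : incl (P - Q) = S.M X s α z := by
      rw [map_sub, hPz, hQz, h.V_s_mul hα, S.V_smul X _ conj_rt, S.V_smul X _ conj_rt, M]
      module
    refine ⟨P - Q, ⟨?_, ?_⟩, e⟩
    · rw [sub_eq_add_neg]
      exact Submodule.add_mem_sup hP (Submodule.neg_mem _ hQ)
    · rw [SetLike.mem_coe, S.mem_𝔪]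
      apply incl_injective
      rw [← S.σC_incl, e, h.σC_M, map_neg, e]

theorem σC_V_of_fixed (h : S.IsAdapted X c s) {α : S.Form} (hα : α ∈ S.Δ) (hσ : S.σf α = α)
    (z : ℂ) : S.σC (S.V X α z) = S.V X α z := by
  rw [h.σC_V hα, h.s_eq_one hα hσ, hσ, one_smul]

theorem K_of_fixed (h : S.IsAdapted X c s) {α : S.Form} (hα : α ∈ S.Δ) (hσ : S.σf α = α)
    (z : ℂ) : S.K X s α z = S.V X α (2 * rt * z) := by
  rw [h.K_eq, h.σC_V_of_fixed hα hσ, S.V_smul X α (by rw [map_mul, conj_rt, map_ofNat])]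
  module

theorem M_of_fixed (h : S.IsAdapted X c s) {α : S.Form} (hα : α ∈ S.Δ) (hσ : S.σf α = α)
    (z : ℂ) : S.M X s α z = 0 := by
  rw [h.M_eq, h.σC_V_of_fixed hα hσ, sub_self, smul_zero]

/-- So `σ` acts on the real plane of the `V_α(z)` as the reflection `z ↦ -s_α z̄`. -/
theorem σC_V_of_neg (h : S.IsAdapted X c s) {α : S.Form} (hα : α ∈ S.Δ) (hσ : S.σf α = -α)
    (z : ℂ) : S.σC (S.V X α z) = -S.V X α (s α * starRingEnd ℂ z) := by
  rw [h.σC_V hα, hσ, S.V_neg, h.V_s_mul hα, smul_neg]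

theorem Kt_eq (_h : S.IsAdapted X c s) (α : S.Form) (t : ℝ) :
    S.Kt X s α t = S.V X α (S.ζ s α * t) := by
  unfold Kt ζ
  split_ifs <;> simp

theorem Mt_eq (_h : S.IsAdapted X c s) (α : S.Form) (t : ℝ) :
    S.Mt X s α t = S.V X α ((1 + Complex.I - S.ζ s α) * t) := by
  unfold Mt ζ
  split_ifs <;> simp

/-- `ζ_α` spans the line fixed by the reflection `z ↦ -s_α z̄`; by `conj_ζ'`, the number `ζ'_α`
spans its `-1`-eigenline. -/
theorem conj_ζ (h : S.IsAdapted X c s) {α : S.Form} (hα : α ∈ S.Δ) :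
    s α * starRingEnd ℂ (S.ζ s α) = -S.ζ s α := by
  unfold ζ
  rcases h.s_sign α hα with hs | hs
  · simp [hs]
  · rw [if_neg (by rw [hs]; norm_num), hs]
    simp

theorem conj_ζ' (h : S.IsAdapted X c s) {α : S.Form} (hα : α ∈ S.Δ) :
    s α * starRingEnd ℂ (1 + Complex.I - S.ζ s α) = 1 + Complex.I - S.ζ s α := by
  unfold ζ
  rcases h.s_sign α hα with hs | hs
  · simp [hs]
  · rw [if_neg (by rw [hs]; norm_num), hs]
    simp

theorem σC_Kt (h : S.IsAdapted X c s) {α : S.Form} (hα : α ∈ S.Δ) (hσ : S.σf α = -α) (t : ℝ) :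
    S.σC (S.V X α (S.ζ s α * t)) = S.V X α (S.ζ s α * t) := by
  rw [h.σC_V_of_neg hα hσ, map_mul, ← mul_assoc, h.conj_ζ hα, Complex.conj_ofReal, neg_mul,
    S.V_neg_arg, neg_neg]

theorem σC_Mt (h : S.IsAdapted X c s) {α : S.Form} (hα : α ∈ S.Δ) (hσ : S.σf α = -α) (t : ℝ) :
    S.σC (S.V X α ((1 + Complex.I - S.ζ s α) * t)) =
      -S.V X α ((1 + Complex.I - S.ζ s α) * t) := by
  rw [h.σC_V_of_neg hα hσ, map_mul, ← mul_assoc, h.conj_ζ' hα, Complex.conj_ofReal]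

/-- Every complex number is a real combination of `ζ_α` and `ζ_α'`. -/
theorem exists_ζ (_h : S.IsAdapted X c s) (α : S.Form) (z : ℂ) :
    ∃ a b : ℝ, z = S.ζ s α * a + (1 + Complex.I - S.ζ s α) * b := by
  unfold ζ
  split_ifs
  · refine ⟨z.im, z.re, ?_⟩
    apply Complex.ext <;> simp
  · refine ⟨z.re, z.im, ?_⟩
    apply Complex.ext <;> simp

theorem range_V_of_fixed (h : S.IsAdapted X c s) {α : S.Form} (hα : α ∈ S.Δ)
    (hσ : S.σf α = α) : incl '' (S.𝔨r α : Set 𝔤) = Set.range (fun z : ℂ => S.V X α z) := by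
  rw [h.image_𝔨r hα]
  ext A
  constructor
  · rintro ⟨z, rfl⟩
    exact ⟨2 * rt * z, (h.K_of_fixed hα hσ z).symm⟩
  · rintro ⟨z, rfl⟩
    refine ⟨rt * z, ?_⟩
    change S.K X s α (rt * z) = S.V X α z
    rw [h.K_of_fixed hα hσ, mul_assoc, ← mul_assoc rt, rt_mul_rt]
    congr 1
    ring

theorem 𝔪r_of_fixed (h : S.IsAdapted X c s) {α : S.Form} (hα : α ∈ S.Δ)
    (hσ : S.σf α = α) : S.𝔪r α = ⊥ := by
  rw [eq_bot_iff]
  intro Y hY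
  have h1 : incl Y ∈ incl '' (S.𝔪r α : Set 𝔤) := ⟨Y, hY, rfl⟩
  rw [h.image_𝔪r hα] at h1
  obtain ⟨z, hz⟩ := h1
  rw [Submodule.mem_bot]
  apply incl_injective
  rw [map_zero, ← hz]
  exact h.M_of_fixed hα hσ z

theorem range_Kt (h : S.IsAdapted X c s) {α : S.Form} (hα : α ∈ S.Δ) (hσ : S.σf α = -α) :
    incl '' (S.𝔨r α : Set 𝔤) = Set.range (fun t : ℝ => S.Kt X s α t) := by
  rw [h.image_𝔨r hα]
  ext A
  constructor
  · rintro ⟨z, rfl⟩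
    obtain ⟨a, b, rfl⟩ := h.exists_ζ α z
    -- The `ζ'_α`-component is negated by `σ` and drops out of `K_α`; the `ζ_α`-component is doubled
    -- and then divided by `√2`.
    refine ⟨2 * (1 / Real.sqrt 2) * a, ?_⟩
    simp only [h.Kt_eq, h.K_eq]
    rw [S.V_add, map_add, h.σC_Kt hα hσ, h.σC_Mt hα hσ]
    have e : S.ζ s α * ((2 * (1 / Real.sqrt 2) * a : ℝ) : ℂ) = (2 * rt) * (S.ζ s α * a) := by
      rw [rt]; push_cast; ring
    rw [e, S.V_smul X α (by rw [map_mul, conj_rt, map_ofNat])]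
    module
  · rintro ⟨t, rfl⟩
    refine ⟨rt * (S.ζ s α * t), ?_⟩
    simp only [h.Kt_eq, h.K_eq]
    rw [S.V_smul X α conj_rt, map_smul, h.σC_Kt hα hσ, ← smul_add, smul_smul, rt_mul_rt]
    module

theorem range_Mt (h : S.IsAdapted X c s) {α : S.Form} (hα : α ∈ S.Δ) (hσ : S.σf α = -α) :
    incl '' (S.𝔪r α : Set 𝔤) = Set.range (fun t : ℝ => S.Mt X s α t) := by
  rw [h.image_𝔪r hα]
  ext A
  constructor
  · rintro ⟨z, rfl⟩
    obtain ⟨a, b, rfl⟩ := h.exists_ζ α z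
    refine ⟨2 * (1 / Real.sqrt 2) * b, ?_⟩
    simp only [h.Mt_eq, h.M_eq]
    rw [S.V_add, map_add, h.σC_Kt hα hσ, h.σC_Mt hα hσ]
    have e : (1 + Complex.I - S.ζ s α) * ((2 * (1 / Real.sqrt 2) * b : ℝ) : ℂ) =
        (2 * rt) * ((1 + Complex.I - S.ζ s α) * b) := by
      rw [rt]; push_cast; ring
    rw [e, S.V_smul X α (by rw [map_mul, conj_rt, map_ofNat])]
    module
  · rintro ⟨t, rfl⟩
    refine ⟨rt * ((1 + Complex.I - S.ζ s α) * t), ?_⟩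
    simp only [h.Mt_eq, h.M_eq]
    rw [S.V_smul X α conj_rt, map_smul, h.σC_Mt hα hσ, ← smul_sub, smul_smul, rt_mul_rt]
    module

/-! ### Inner products and orthogonality. -/

theorem ipC_V (h : S.IsAdapted X c s) {α : S.Form} (hα : α ∈ S.Δ) (z w : ℂ) :
    ipC (S.V X α z) (S.V X α w) = ((z * starRingEnd ℂ w).re : ℂ) := by
  have hα' := S.neg_mem_Δ hα
  have e : ((z * starRingEnd ℂ w).re : ℂ) =
      1 / 2 * (z * starRingEnd ℂ w + starRingEnd ℂ z * w) := by
    have := Complex.add_conj (z * starRingEnd ℂ w)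
    rw [map_mul, Complex.conj_conj] at this
    rw [this]
    push_cast
    ring
  rw [e, S.V_of_mem X hα, S.V_of_mem X hα]
  simp only [ipC_smul_left, ipC_smul_right, ipC_sub_left, ipC_sub_right, h.ipC_X_self hα,
    h.ipC_X_self hα', h.ipC_self_neg hα, ipC_comm (X (-α)) (X α), ← rt_mul_rt]
  ring

theorem ipC_V_of_ne (h : S.IsAdapted X c s) {α β : S.Form} (hα : α ∈ S.Δ) (hβ : β ∈ S.Δ)
    (h1 : β ≠ α) (h2 : β ≠ -α) (z w : ℂ) : ipC (S.V X α z) (S.V X β w) = 0 := by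
  have hα' := S.neg_mem_Δ hα
  have hβ' := S.neg_mem_Δ hβ
  have n1 : α + β ≠ 0 := fun h0 => h2 (eq_neg_of_add_eq_zero_right h0)
  have n2 : α + -β ≠ 0 := fun h0 => h1 (by rw [← sub_eq_add_neg, sub_eq_zero] at h0; exact h0.symm)
  have n3 : -α + β ≠ 0 := fun h0 => n2 (by rw [← neg_eq_zero, ← h0]; abel)
  have n4 : -α + -β ≠ 0 := fun h0 => n1 (by rw [← neg_eq_zero, ← h0]; abel)
  rw [S.V_of_mem X hα, S.V_of_mem X hβ]
  simp only [ipC_smul_left, ipC_smul_right, ipC_sub_left, ipC_sub_right,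
    S.ipC_rootSpC (h.mem _ hα) (h.mem _ hβ) n1, S.ipC_rootSpC (h.mem _ hα) (h.mem _ hβ') n2,
    S.ipC_rootSpC (h.mem _ hα') (h.mem _ hβ) n3, S.ipC_rootSpC (h.mem _ hα') (h.mem _ hβ') n4]
  ring

theorem ipC_incl_V (h : S.IsAdapted X c s) {α : S.Form} (hα : α ∈ S.Δ) (H : S.𝔱) (z : ℂ) :
    ipC (incl (H : 𝔤)) (S.V X α z) = 0 := by
  have hα' := S.neg_mem_Δ hα
  rw [S.V_of_mem X hα]
  simp only [ipC_smul_right, ipC_sub_right]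
  rw [S.ipC_rootSpC (S.incl_mem_rootSpC_zero H) (h.mem _ hα) (by rw [zero_add]; exact hα.1),
    S.ipC_rootSpC (S.incl_mem_rootSpC_zero H) (h.mem _ hα') (by rw [zero_add]; exact hα'.1)]
  ring

theorem ipC_K (h : S.IsAdapted X c s) {α : S.Form} (hα : α ∈ S.Δ) (hg : S.Generic α) (z w : ℂ) :
    ipC (S.K X s α z) (S.K X s α w) = ((z * starRingEnd ℂ w).re : ℂ) := by
  have hα' := S.σf_mem_Δ hα
  have n1 : S.σf α ≠ -α := hg.2
  have n2 : α ≠ -S.σf α := fun h0 => hg.2 (by rw [h0, neg_neg]; rw [← h0])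
  have hs := h.s_mul_self hα
  unfold K
  simp only [ipC_smul_left, ipC_smul_right, ipC_add_left, ipC_add_right, h.ipC_V hα, h.ipC_V hα',
    h.ipC_V_of_ne hα hα' hg.1 n1, h.ipC_V_of_ne hα' hα hg.1.symm n2]
  linear_combination (((z * starRingEnd ℂ w).re : ℂ)) * (rt * rt) * hs +
    2 * (((z * starRingEnd ℂ w).re : ℂ)) * rt_mul_rt

theorem ipC_M (h : S.IsAdapted X c s) {α : S.Form} (hα : α ∈ S.Δ) (hg : S.Generic α) (z w : ℂ) :
    ipC (S.M X s α z) (S.M X s α w) = ((z * starRingEnd ℂ w).re : ℂ) := by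
  have hα' := S.σf_mem_Δ hα
  have n1 : S.σf α ≠ -α := hg.2
  have n2 : α ≠ -S.σf α := fun h0 => hg.2 (by rw [h0, neg_neg]; rw [← h0])
  have hs := h.s_mul_self hα
  unfold M
  simp only [ipC_smul_left, ipC_smul_right, ipC_sub_left, ipC_sub_right, h.ipC_V hα, h.ipC_V hα',
    h.ipC_V_of_ne hα hα' hg.1 n1, h.ipC_V_of_ne hα' hα hg.1.symm n2]
  linear_combination (((z * starRingEnd ℂ w).re : ℂ)) * (rt * rt) * hs +
    2 * (((z * starRingEnd ℂ w).re : ℂ)) * rt_mul_rt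

theorem ipC_Kt (h : S.IsAdapted X c s) {α : S.Form} (hα : α ∈ S.Δ) (t t' : ℝ) :
    ipC (S.Kt X s α t) (S.Kt X s α t') = ((t * t' : ℝ) : ℂ) := by
  rw [h.Kt_eq, h.Kt_eq, h.ipC_V hα]
  unfold ζ
  split_ifs <;> simp

theorem ipC_Mt (h : S.IsAdapted X c s) {α : S.Form} (hα : α ∈ S.Δ) (t t' : ℝ) :
    ipC (S.Mt X s α t) (S.Mt X s α t') = ((t * t' : ℝ) : ℂ) := by
  rw [h.Mt_eq, h.Mt_eq, h.ipC_V hα]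
  unfold ζ
  split_ifs <;> simp

theorem ip_rootSp (h : S.IsAdapted X c s) {α β : S.Form} (hα : α ∈ S.Δ) (hβ : β ∈ S.Δ)
    (h1 : β ≠ α) (h2 : β ≠ -α) {Y Z : 𝔤} (hY : Y ∈ S.rootSp α) (hZ : Z ∈ S.rootSp β) :
    ip Y Z = 0 := by
  obtain ⟨z, hz⟩ := h.exists_eq_V hα hY
  obtain ⟨w, hw⟩ := h.exists_eq_V hβ hZ
  have := h.ipC_V_of_ne hα hβ h1 h2 z w
  rw [← hz, ← hw, ipC_incl] at this
  exact_mod_cast this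

theorem ip_𝔱_rootSp (h : S.IsAdapted X c s) {α : S.Form} (hα : α ∈ S.Δ)
    {H Y : 𝔤} (hH : H ∈ S.𝔱) (hY : Y ∈ S.rootSp α) : ip H Y = 0 := by
  obtain ⟨z, hz⟩ := h.exists_eq_V hα hY
  have := h.ipC_incl_V hα ⟨H, hH⟩ z
  rw [← hz, ipC_incl] at this
  exact_mod_cast this

theorem ip_𝔱_sup (h : S.IsAdapted X c s) {α : S.Form} (hα : α ∈ S.Δ)
    {H Y : 𝔤} (hH : H ∈ S.𝔱) (hY : Y ∈ S.rootSp α ⊔ S.rootSp (S.σf α)) : ip H Y = 0 := by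
  obtain ⟨P, hP, Q, hQ, rfl⟩ := Submodule.mem_sup.1 hY
  have h1 := h.ip_𝔱_rootSp hα hH hP
  have h2 := h.ip_𝔱_rootSp (S.σf_mem_Δ hα) hH hQ
  unfold ip at *
  rw [map_add]
  linarith

theorem ip_sup_sup (h : S.IsAdapted X c s) {α β : S.Form} (hα : α ∈ S.Δ) (hβ : β ∈ S.Δ)
    (hab : S.Apart α β) {Y Z : 𝔤} (hY : Y ∈ S.rootSp α ⊔ S.rootSp (S.σf α))
    (hZ : Z ∈ S.rootSp β ⊔ S.rootSp (S.σf β)) : ip Y Z = 0 := by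
  obtain ⟨P, hP, Q, hQ, rfl⟩ := Submodule.mem_sup.1 hY
  obtain ⟨P', hP', Q', hQ', rfl⟩ := Submodule.mem_sup.1 hZ
  have hα' := S.σf_mem_Δ hα
  have hβ' := S.σf_mem_Δ hβ
  obtain ⟨a1, a2, a3, a4⟩ := hab
  have h1 := h.ip_rootSp hα hβ a1 a2 hP hP'
  have h2 := h.ip_rootSp hα hβ' (fun e => a3 (by rw [← e, S.σf_σf]))
    (fun e => a4 (by rw [← S.σf_neg, ← e, S.σf_σf])) hP hQ'
  have h3 := h.ip_rootSp hα' hβ a3 a4 hQ hP'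
  have h4 := h.ip_rootSp hα' hβ' (fun e => a1 (by rw [← S.σf_σf β, e, S.σf_σf]))
    (fun e => a2 (by rw [← S.σf_σf β, e, S.σf_neg, S.σf_σf])) hQ hQ'
  unfold ip at *
  simp only [map_add, LinearMap.add_apply]
  linarith

end IsAdapted

/-- `σ` is an isometry, so its eigenspaces are orthogonal. -/
theorem ip_𝔨_𝔪 {𝔤 : Type*} [LieRing 𝔤] [LieAlgebra ℝ 𝔤] [FiniteDimensional ℝ 𝔤] (S : SymData 𝔤)
    {Y Z : 𝔤} (hY : Y ∈ S.𝔨) (hZ : Z ∈ S.𝔪) : ip Y Z = 0 := by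
  have h1 := S.ip_σ Y Z
  rw [S.mem_𝔨.1 hY, S.mem_𝔪.1 hZ, ip_neg_right] at h1
  linarith

/-- Symmetric vanishing relations between the members of a finite family of subspaces need only
be checked for increasing pairs of indices. -/
theorem pairwise_ip {𝔤 : Type*} [LieRing 𝔤] [LieAlgebra ℝ 𝔤] [FiniteDimensional ℝ 𝔤] {n : ℕ}
    {U : Fin n → Submodule ℝ 𝔤}
    (hU : ∀ i j, i < j → ∀ u ∈ U i, ∀ v ∈ U j, ip u v = 0) :
    Pairwise fun i j => ∀ u ∈ U i, ∀ v ∈ U j, ip u v = 0 := by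
  intro i j hij u hu v hv
  rcases lt_or_gt_of_ne hij with hlt | hlt
  · exact hU i j hlt u hu v hv
  · rw [ip_comm]
    exact hU j i hlt v hv u hu

namespace IsAdapted

variable {𝔤 : Type*} [LieRing 𝔤] [LieAlgebra ℝ 𝔤] [FiniteDimensional ℝ 𝔤] {S : SymData 𝔤}
  {X : S.Form → ℂ ⊗[ℝ] 𝔤} {c : S.Form → S.Form → ℝ} {s : S.Form → ℂ}

theorem pairwise_six (h : S.IsAdapted X c s) {α β : S.Form} (hα : α ∈ S.Δ) (hβ : β ∈ S.Δ)
    (hab : S.Apart α β) :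
    Pairwise fun i j : Fin 6 =>
      ∀ u ∈ ![S.𝔱 ⊓ S.𝔨, S.𝔞, S.𝔨r α, S.𝔪r α, S.𝔨r β, S.𝔪r β] i,
      ∀ v ∈ ![S.𝔱 ⊓ S.𝔨, S.𝔞, S.𝔨r α, S.𝔪r α, S.𝔨r β, S.𝔪r β] j, ip u v = 0 := by
  have h𝔞 : ∀ A ∈ S.𝔞, A ∈ S.𝔪 := fun A hA => S.mem_𝔪.2 (S.𝔞_maximal.prop.1 A hA)
  apply pairwise_ip
  intro i j hij u hu v hv
  fin_cases i <;> fin_cases j <;> first | exact absurd hij (by decide) | skip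
  · exact S.ip_𝔨_𝔪 hu.2 (h𝔞 v hv)
  · exact h.ip_𝔱_sup hα hu.1 hv.1
  · exact h.ip_𝔱_sup hα hu.1 hv.1
  · exact h.ip_𝔱_sup hβ hu.1 hv.1
  · exact h.ip_𝔱_sup hβ hu.1 hv.1
  · exact h.ip_𝔱_sup hα (S.𝔞_le_𝔱 hu) hv.1
  · exact h.ip_𝔱_sup hα (S.𝔞_le_𝔱 hu) hv.1
  · exact h.ip_𝔱_sup hβ (S.𝔞_le_𝔱 hu) hv.1
  · exact h.ip_𝔱_sup hβ (S.𝔞_le_𝔱 hu) hv.1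
  · exact S.ip_𝔨_𝔪 hu.2 hv.2
  · exact h.ip_sup_sup hα hβ hab hu.1 hv.1
  · exact h.ip_sup_sup hα hβ hab hu.1 hv.1
  · exact h.ip_sup_sup hα hβ hab hu.1 hv.1
  · exact h.ip_sup_sup hα hβ hab hu.1 hv.1
  · exact S.ip_𝔨_𝔪 hu.2 hv.2

theorem pairwise_four (h : S.IsAdapted X c s) {α : S.Form} (hα : α ∈ S.Δ) :
    Pairwise fun i j : Fin 4 =>
      ∀ u ∈ ![S.𝔱 ⊓ S.𝔨, S.𝔞, S.𝔨r α, S.𝔪r α] i,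
      ∀ v ∈ ![S.𝔱 ⊓ S.𝔨, S.𝔞, S.𝔨r α, S.𝔪r α] j, ip u v = 0 := by
  have h𝔞 : ∀ A ∈ S.𝔞, A ∈ S.𝔪 := fun A hA => S.mem_𝔪.2 (S.𝔞_maximal.prop.1 A hA)
  apply pairwise_ip
  intro i j hij u hu v hv
  fin_cases i <;> fin_cases j <;> first | exact absurd hij (by decide) | skip
  · exact S.ip_𝔨_𝔪 hu.2 (h𝔞 v hv)
  · exact h.ip_𝔱_sup hα hu.1 hv.1
  · exact h.ip_𝔱_sup hα hu.1 hv.1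
  · exact h.ip_𝔱_sup hα (S.𝔞_le_𝔱 hu) hv.1
  · exact h.ip_𝔱_sup hα (S.𝔞_le_𝔱 hu) hv.1
  · exact S.ip_𝔨_𝔪 hu.2 hv.2

/-! ### Lie brackets of the vectors `K`, `M`, `K̃` and `M̃`. -/

theorem K_σf (h : S.IsAdapted X c s) {β : S.Form} (hβ : β ∈ S.Δ) (w : ℂ) :
    S.K X s (S.σf β) w = s β • S.K X s β w := by
  simp only [h.K_eq, h.V_σf hβ, map_smul, S.σC_σC]
  module

theorem M_σf (h : S.IsAdapted X c s) {β : S.Form} (hβ : β ∈ S.Δ) (w : ℂ) :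
    S.M X s (S.σf β) w = -(s β • S.M X s β w) := by
  simp only [h.M_eq, h.V_σf hβ, map_smul, S.σC_σC]
  module

theorem K_neg (h : S.IsAdapted X c s) (β : S.Form) (w : ℂ) :
    S.K X s (-β) w = -S.K X s β (starRingEnd ℂ w) := by
  simp only [h.K_eq, S.V_neg, map_neg]
  module

theorem M_neg (h : S.IsAdapted X c s) (β : S.Form) (w : ℂ) :
    S.M X s (-β) w = -S.M X s β (starRingEnd ℂ w) := by
  simp only [h.M_eq, S.V_neg, map_neg]
  module

/-- As `[σV, σV'] = σ[V, V']` and `[V, σV'] = σ[σV, V']`, the four brackets are `A`, `B` and their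
images under `σ`. With `A` and `B` left open, this covers `β` apart from `α` as well as `β = α`. -/
theorem lie_K_K (h : S.IsAdapted X c s) (α β : S.Form) (z w : ℂ) {A B : ℂ ⊗[ℝ] 𝔤}
    (hA : ⁅S.V X α z, S.V X β w⁆ = A) (hB : ⁅S.σC (S.V X α z), S.V X β w⁆ = B) :
    ⁅S.K X s α z, S.K X s β w⁆ = (1 / 2 : ℂ) • (A + B + S.σC (A + B)) := by
  have h1 := S.σC_lie (S.V X α z) (S.V X β w)
  have h2 := S.σC_lie (S.σC (S.V X α z)) (S.V X β w)
  rw [S.σC_σC] at h2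
  simp only [h.K_eq, smul_lieC, lie_smulC, add_lieC, lie_addC]
  rw [← h1, ← h2, hA, hB, map_add, ← rt_mul_rt]
  module

theorem lie_K_M (h : S.IsAdapted X c s) (α β : S.Form) (z w : ℂ) {A B : ℂ ⊗[ℝ] 𝔤}
    (hA : ⁅S.V X α z, S.V X β w⁆ = A) (hB : ⁅S.σC (S.V X α z), S.V X β w⁆ = B) :
    ⁅S.K X s α z, S.M X s β w⁆ = (1 / 2 : ℂ) • (A + B - S.σC (A + B)) := by
  have h1 := S.σC_lie (S.V X α z) (S.V X β w)
  have h2 := S.σC_lie (S.σC (S.V X α z)) (S.V X β w)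
  rw [S.σC_σC] at h2
  simp only [h.K_eq, h.M_eq, smul_lieC, lie_smulC, add_lieC, lie_subC]
  rw [← h1, ← h2, hA, hB, map_add, ← rt_mul_rt]
  module

theorem lie_M_M (h : S.IsAdapted X c s) (α β : S.Form) (z w : ℂ) {A B : ℂ ⊗[ℝ] 𝔤}
    (hA : ⁅S.V X α z, S.V X β w⁆ = A) (hB : ⁅S.σC (S.V X α z), S.V X β w⁆ = B) :
    ⁅S.M X s α z, S.M X s β w⁆ = (1 / 2 : ℂ) • (A - B + S.σC (A - B)) := by
  have h1 := S.σC_lie (S.V X α z) (S.V X β w)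
  have h2 := S.σC_lie (S.σC (S.V X α z)) (S.V X β w)
  rw [S.σC_σC] at h2
  simp only [h.M_eq, smul_lieC, lie_smulC, sub_lieC, lie_subC]
  rw [← h1, ← h2, hA, hB, map_sub, ← rt_mul_rt]
  module

/-- The bracket of a `σ`-fixed vector `V_α(z)` with `K_β(w)` and `M_β(w)`. -/
theorem lie_fixed (h : S.IsAdapted X c s) {α β : S.Form} (hα : α ∈ S.Δ) (hβ : β ∈ S.Δ)
    (h1 : β ≠ α) (h2 : β ≠ -α) {z : ℂ} (hz : S.σC (S.V X α z) = S.V X α z) (w : ℂ) :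
    ⁅S.V X α z, S.K X s β w⁆ = rt • ((c α β : ℂ) • S.K X s (α + β) (z * w)
        - (c α (-β) : ℂ) • S.K X s (α - β) (z * starRingEnd ℂ w)) ∧
      ⁅S.V X α z, S.M X s β w⁆ = rt • ((c α β : ℂ) • S.M X s (α + β) (z * w)
        - (c α (-β) : ℂ) • S.M X s (α - β) (z * starRingEnd ℂ w)) := by
  -- Here `ad(V_α(z))` commutes with `σ`, so it maps `V ± σV` to vectors of the same kind.
  have e := S.σC_lie (S.V X α z) (S.V X β w)
  rw [hz] at e
  simp only [h.K_eq, h.M_eq, lie_smulC, lie_addC, lie_subC]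
  rw [← e, h.lie_V_of_ne hα hβ h1 h2]
  simp only [map_sub, map_smul]
  constructor <;> module

/-- The bracket of a `σ`-antifixed vector `V_α(z)` with `K_β(w)` and `M_β(w)`. -/
theorem lie_antifixed (h : S.IsAdapted X c s) {α β : S.Form} (hα : α ∈ S.Δ) (hβ : β ∈ S.Δ)
    (h1 : β ≠ α) (h2 : β ≠ -α) {z : ℂ} (hz : S.σC (S.V X α z) = -S.V X α z) (w : ℂ) :
    ⁅S.V X α z, S.K X s β w⁆ = rt • ((c α β : ℂ) • S.M X s (α + β) (z * w)
        - (c α (-β) : ℂ) • S.M X s (α - β) (z * starRingEnd ℂ w)) ∧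
      ⁅S.V X α z, S.M X s β w⁆ = rt • ((c α β : ℂ) • S.K X s (α + β) (z * w)
        - (c α (-β) : ℂ) • S.K X s (α - β) (z * starRingEnd ℂ w)) := by
  -- Here `ad(V_α(z))` anticommutes with `σ`, so it exchanges the two kinds `V ± σV`.
  have e := S.σC_lie (S.V X α z) (S.V X β w)
  rw [hz, neg_lieC, eq_neg_iff_add_eq_zero, add_comm, ← eq_neg_iff_add_eq_zero] at e
  simp only [h.K_eq, h.M_eq, lie_smulC, lie_addC, lie_subC]
  rw [e, h.lie_V_of_ne hα hβ h1 h2]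
  simp only [map_sub, map_smul]
  constructor <;> module

theorem lie_σC_V (h : S.IsAdapted X c s) {α β : S.Form} (hα : α ∈ S.Δ) (hβ : β ∈ S.Δ)
    (h1 : β ≠ S.σf α) (h2 : β ≠ -S.σf α) (z w : ℂ) :
    ⁅S.σC (S.V X α z), S.V X β w⁆ = (s α * rt) •
      ((c (S.σf α) β : ℂ) • S.V X (S.σf α + β) (z * w)
        - (c (S.σf α) (-β) : ℂ) • S.V X (S.σf α - β) (z * starRingEnd ℂ w)) := by
  rw [h.σC_V hα, smul_lieC, h.lie_V_of_ne (S.σf_mem_Δ hα) hβ h1 h2, smul_smul]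

theorem lie_apart (h : S.IsAdapted X c s) {α β : S.Form} (hα : α ∈ S.Δ) (hβ : β ∈ S.Δ)
    (hab : S.Apart α β) (z w : ℂ) :
    ⁅S.K X s α z, S.K X s β w⁆ = (1 / 2 : ℂ) •
        ((c α β : ℂ) • S.K X s (α + β) (z * w)
          - (c α (-β) : ℂ) • S.K X s (α - β) (z * starRingEnd ℂ w)
          + (s α * c (S.σf α) β) • S.K X s (S.σf α + β) (z * w)
          - (s α * c (S.σf α) (-β)) • S.K X s (S.σf α - β) (z * starRingEnd ℂ w)) ∧
      ⁅S.K X s α z, S.M X s β w⁆ = (1 / 2 : ℂ) •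
        ((c α β : ℂ) • S.M X s (α + β) (z * w)
          - (c α (-β) : ℂ) • S.M X s (α - β) (z * starRingEnd ℂ w)
          + (s α * c (S.σf α) β) • S.M X s (S.σf α + β) (z * w)
          - (s α * c (S.σf α) (-β)) • S.M X s (S.σf α - β) (z * starRingEnd ℂ w)) ∧
      ⁅S.M X s α z, S.M X s β w⁆ = (1 / 2 : ℂ) •
        ((c α β : ℂ) • S.K X s (α + β) (z * w)
          - (c α (-β) : ℂ) • S.K X s (α - β) (z * starRingEnd ℂ w)
          - (s α * c (S.σf α) β) • S.K X s (S.σf α + β) (z * w)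
          + (s α * c (S.σf α) (-β)) • S.K X s (S.σf α - β) (z * starRingEnd ℂ w)) := by
  have hA := h.lie_V_of_ne hα hβ hab.1 hab.2.1 z w
  have hB := h.lie_σC_V hα hβ hab.2.2.1 hab.2.2.2 z w
  rw [h.lie_K_K α β z w hA hB, h.lie_K_M α β z w hA hB, h.lie_M_M α β z w hA hB]
  simp only [h.K_eq, h.M_eq, map_add, map_sub, map_smul]
  refine ⟨?_, ?_, ?_⟩ <;> module

/-- For `γ = α + σ(α)` either `γ` is not a root or `c_{σ(α),α} = 0`. -/
theorem c_σf_self_smul_V (h : S.IsAdapted X c s) {α : S.Form} (hα : α ∈ S.Δ) (z : ℂ) : (c (S.σf α) α : ℂ) • S.V X (S.σf α + α) z = 0 := by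
  -- If `α + σ(α)` is a root, it is `σ`-fixed and has sign `1`. Then `σ` gives `c_{α,σ(α)} =
  -- c_{σ(α),α}`, and skew-symmetry makes both zero.
  by_cases hm : α + S.σf α ∈ S.Δ
  · have hα' := S.σf_mem_Δ hα
    have h1 := h.c_σf hα hα' hm
    have hfix : S.σf (α + S.σf α) = α + S.σf α := by
      rw [S.σf_add, S.σf_σf, add_comm]
    rw [h.s_eq_one hm hfix, S.σf_σf, h.s_σf hα, h.s_mul_self hα, mul_one, one_mul,
      h.c_skew hα hα' hm] at h1
    have h2 : (c (S.σf α) α : ℂ) = 0 := by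
      rw [h.c_skew hα hα' hm]
      push_cast at h1 ⊢
      linear_combination (-1 / 2 : ℂ) * h1
    rw [h2, zero_smul]
  · rw [S.V_of_not_mem X (by rwa [add_comm]), smul_zero]

theorem c_σf_neg_self (h : S.IsAdapted X c s) {α : S.Form} (hα : α ∈ S.Δ)
    (hm : α - S.σf α ∈ S.Δ) : c (S.σf α) (-α) = c α (-S.σf α) := by
  have hα' := S.σf_mem_Δ hα
  rw [sub_eq_add_neg] at hm
  have h1 := h.c_skew hα (S.neg_mem_Δ hα') hm
  rw [h.c_neg_left hα' hα] at h1
  linarith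

/-- For `γ = α - σ(α)` either `s_γ = 1` or `c_{α,-σ(α)} = 0`. -/
theorem c_mul_s_sub (h : S.IsAdapted X c s) {α : S.Form} (hα : α ∈ S.Δ)
    (hm : α - S.σf α ∈ S.Δ) : (c α (-S.σf α) : ℂ) = 0 ∨ s (α - S.σf α) = 1 := by
  have hα' := S.σf_mem_Δ hα
  -- With `c_{σ(α),-α} = c_{α,-σ(α)}`, compatibility with `σ` becomes `c s_γ = c` for `c =
  -- c_{α,-σ(α)}`.
  have h1 := h.c_σf hα (S.neg_mem_Δ hα') (by rwa [sub_eq_add_neg] at hm)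
  rw [← sub_eq_add_neg, h.s_neg hα', h.s_σf hα, h.s_mul_self hα, one_mul, S.σf_neg, S.σf_σf,
    h.c_σf_neg_self hα hm] at h1
  have h2 : (c α (-S.σf α) : ℂ) * (s (α - S.σf α) - 1) = 0 := by
    rw [mul_sub, h1]
    ring
  exact (mul_eq_zero.1 h2).imp_right sub_eq_zero.1

/-- Put `γ = α - σ(α)`. If `s_γ = 1`, then `σ` acts by `y ↦ -ȳ`, so `V ± σV` retains twice the
imaginary or twice the real part of `y`. The factor `c` takes care of all other cases. -/
theorem c_smul_V_sub (h : S.IsAdapted X c s) {α : S.Form} (hα : α ∈ S.Δ) (y : ℂ) :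
    (c α (-S.σf α) : ℂ) • (S.V X (α - S.σf α) y + S.σC (S.V X (α - S.σf α) y)) =
        (2 * (c α (-S.σf α) : ℂ)) • S.Kt X s (α - S.σf α) y.im ∧
      (c α (-S.σf α) : ℂ) • (S.V X (α - S.σf α) y - S.σC (S.V X (α - S.σf α) y)) =
        (2 * (c α (-S.σf α) : ℂ)) • S.Mt X s (α - S.σf α) y.re := by
  by_cases hm : α - S.σf α ∈ S.Δ
  · rcases h.c_mul_s_sub hα hm with h0 | h1
    · simp [h0]
    · have hσ : S.σf (α - S.σf α) = -(α - S.σf α) := by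
        rw [S.σf_sub, S.σf_σf, neg_sub]
      have e1 : y + -starRingEnd ℂ y = 2 * (Complex.I * (y.im : ℂ)) := by
        rw [← sub_eq_add_neg, Complex.sub_conj]
        push_cast
        ring
      have e2 : y - -starRingEnd ℂ y = 2 * (y.re : ℂ) := by
        rw [sub_neg_eq_add, Complex.add_conj]
        push_cast
        ring
      have two : starRingEnd ℂ 2 = 2 := map_ofNat _ 2
      rw [h.σC_V_of_neg hm hσ, h1, one_mul, Kt, Mt, if_pos h1, if_pos h1, ← S.V_neg_arg,
        ← S.V_add, ← S.V_sub, e1, e2, S.V_smul X _ two, S.V_smul X _ two]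
      constructor <;> module
  · rw [h.Kt_eq, h.Mt_eq]
    simp [S.V_of_not_mem X hm]

/-- Of the two terms, at `σ(α) + α` and at `σ(α) - α`, the first vanishes by `c_σf_self_smul_V`; the
second is rewritten by `V_{-γ}(y) = -V_γ(ȳ)`. -/
theorem lie_σC_V_self (h : S.IsAdapted X c s) {α : S.Form} (hα : α ∈ S.Δ) (hg : S.Generic α)
    (z w : ℂ) : ⁅S.σC (S.V X α z), S.V X α w⁆ =
      (s α * rt) • (c α (-S.σf α) : ℂ) • S.V X (α - S.σf α) (starRingEnd ℂ z * w) := by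
  have n2 : α ≠ -S.σf α := fun h0 => hg.2 (by rw [h0, neg_neg]; rw [← h0])
  rw [h.lie_σC_V hα hα hg.1.symm n2, h.c_σf_self_smul_V hα, ← neg_sub α, S.V_neg, map_mul,
    Complex.conj_conj]
  by_cases hm : α - S.σf α ∈ S.Δ
  · rw [h.c_σf_neg_self hα hm]
    module
  · simp [S.V_of_not_mem X hm]

theorem lie_diagonal (h : S.IsAdapted X c s) {α : S.Form} (hα : α ∈ S.Δ) (hg : S.Generic α)
    (z w : ℂ) :
    ⁅S.K X s α z, S.K X s α w⁆ =
        (1 / 2 * ((starRingEnd ℂ z * w).im : ℂ) * Complex.I) •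
          (S.sharp α + S.sharp (S.σf α))
        + (rt * s α * c α (-S.σf α)) •
          S.Kt X s (α - S.σf α) (starRingEnd ℂ z * w).im ∧
      ⁅S.K X s α z, S.M X s α w⁆ =
        (1 / 2 * ((starRingEnd ℂ z * w).im : ℂ) * Complex.I) •
          (S.sharp α - S.sharp (S.σf α))
        + (rt * s α * c α (-S.σf α)) •
          S.Mt X s (α - S.σf α) (starRingEnd ℂ z * w).re ∧
      ⁅S.M X s α z, S.M X s α w⁆ =
        (1 / 2 * ((starRingEnd ℂ z * w).im : ℂ) * Complex.I) •
          (S.sharp α + S.sharp (S.σf α))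
        - (rt * s α * c α (-S.σf α)) •
          S.Kt X s (α - S.σf α) (starRingEnd ℂ z * w).im := by
  have hA := h.lie_V_self hα z w
  have hB := h.lie_σC_V_self hα hg z w
  obtain ⟨e1, e2⟩ := h.c_smul_V_sub hα (starRingEnd ℂ z * w)
  rw [h.lie_K_K α α z w hA hB, h.lie_K_M α α z w hA hB, h.lie_M_M α α z w hA hB]
  simp only [map_add, map_sub, map_smul, S.σC_sharp hα]
  refine ⟨?_, ?_, ?_⟩
  · linear_combination (norm := module) (1 / 2 * (s α * rt)) • e1
  · linear_combination (norm := module) (1 / 2 * (s α * rt)) • e2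
  · linear_combination (norm := module) (-(1 / 2 * (s α * rt))) • e1

theorem c_mul_s_of_neg_of_fixed (h : S.IsAdapted X c s) {α β : S.Form} (hα : α ∈ S.Δ)
    (hβ : β ∈ S.Δ) (h1 : S.σf α = -α) (h2 : S.σf β = β) (hm : α + β ∈ S.Δ) :
    (c α β : ℂ) * s (α + β) = -(s α * c α (-β)) := by
  rw [h.c_σf hα hβ hm, h1, h2, h.s_eq_one hβ h2, h.c_neg_left hα hβ]
  push_cast
  ring

/-- For `σ(α) = -α` and `σ(β) = β` the bracket `[V_α(y), V_β(z)]` only involves the pair of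
roots `±(α ± β)`, which `σ` permutes. -/
theorem lie_V_of_neg_of_fixed (h : S.IsAdapted X c s) {α β : S.Form} (hα : α ∈ S.Δ)
    (hβ : β ∈ S.Δ) (h1 : S.σf α = -α) (h2 : S.σf β = β) {y ε : ℂ}
    (hy : s α * starRingEnd ℂ y = -(ε * y)) (hε : ε = 1 ∨ ε = -1) (z : ℂ) :
    ⁅S.V X α y, S.V X β z⁆ = (c α β : ℂ) • rt •
      (S.V X (α + β) (y * z) + ε • S.σC (S.V X (α + β) (y * z))) := by
  have n1 : β ≠ α := by
    rintro rfl
    exact h.ne_neg_self hβ (by nth_rewrite 1 [← h2]; rw [h1, neg_add_cancel])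
  have n2 : β ≠ -α := by
    rintro rfl
    rw [S.σf_neg, h1, neg_neg] at h2
    exact h.ne_neg_self hα (by nth_rewrite 1 [h2]; rw [neg_add_cancel])
  -- The hypothesis `hy` says `σ V_α(y) = ε V_α(y)`, with `ε = 1` for `K̃` and `ε = -1` for `M̃`. As
  -- `σ` carries `α + β` to `-(α - β)`, the term at `α - β` is `ε` times the image under `σ` of the
  -- term at `α + β`.
  have e : S.σf (α + β) = -(α - β) := by
    rw [S.σf_add, h1, h2]
    abel
  rw [h.lie_V_of_ne hα hβ n1 n2]
  by_cases hm : α + β ∈ S.Δ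
  · have h3 := h.c_mul_s_of_neg_of_fixed hα hβ h1 h2 hm
    have h4 : starRingEnd ℂ (y * z) = s α * ((-ε) * (y * starRingEnd ℂ z)) := by
      have hs := h.s_mul_self hα
      rw [map_mul]
      linear_combination (s α * starRingEnd ℂ z) * hy - starRingEnd ℂ y * starRingEnd ℂ z * hs
    have hε2 : starRingEnd ℂ (-ε) = -ε := by rcases hε with rfl | rfl <;> simp
    rw [h.σC_V hm, e, S.V_neg, h4, h.V_s_mul hα, S.V_smul X _ hε2]
    have h5 : (c α (-β) : ℂ) = -(s α * (c α β * s (α + β))) := by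
      rw [h3]
      linear_combination (-(c α (-β) : ℂ)) * h.s_mul_self hα
    rw [h5]
    rcases hε with rfl | rfl <;> module
  · have hm' : α - β ∉ S.Δ := by
      rwa [← S.neg_mem_Δ_iff, ← e, S.σf_mem_Δ_iff]
    simp [S.V_of_not_mem X hm, S.V_of_not_mem X hm']

theorem s_mul_conj_ζ_mul (h : S.IsAdapted X c s) {α : S.Form} (hα : α ∈ S.Δ) (t : ℝ) :
    s α * starRingEnd ℂ (S.ζ s α * t) = -(1 * (S.ζ s α * t)) := by
  rw [map_mul, ← mul_assoc, h.conj_ζ hα, Complex.conj_ofReal]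
  ring

theorem s_mul_conj_ζ'_mul (h : S.IsAdapted X c s) {α : S.Form} (hα : α ∈ S.Δ) (t : ℝ) :
    s α * starRingEnd ℂ ((1 + Complex.I - S.ζ s α) * t) =
      -(-1 * ((1 + Complex.I - S.ζ s α) * t)) := by
  rw [map_mul, ← mul_assoc, h.conj_ζ' hα, Complex.conj_ofReal]
  ring

theorem lie_Kt_V (h : S.IsAdapted X c s) {α β : S.Form} (hα : α ∈ S.Δ) (hβ : β ∈ S.Δ)
    (h1 : S.σf α = -α) (h2 : S.σf β = β) (t : ℝ) (z : ℂ) :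
    ⁅S.Kt X s α t, S.V X β z⁆ = (c α β : ℂ) • S.K X s (α + β) (S.ζ s α * t * z) := by
  rw [h.Kt_eq, h.lie_V_of_neg_of_fixed hα hβ h1 h2 (h.s_mul_conj_ζ_mul hα t) (Or.inl rfl),
    h.K_eq, one_smul]

theorem lie_Mt_V (h : S.IsAdapted X c s) {α β : S.Form} (hα : α ∈ S.Δ) (hβ : β ∈ S.Δ)
    (h1 : S.σf α = -α) (h2 : S.σf β = β) (t : ℝ) (z : ℂ) :
    ⁅S.Mt X s α t, S.V X β z⁆ =
      (c α β : ℂ) • S.M X s (α + β) ((1 + Complex.I - S.ζ s α) * t * z) := by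
  rw [h.Mt_eq, h.lie_V_of_neg_of_fixed hα hβ h1 h2 (h.s_mul_conj_ζ'_mul hα t) (Or.inr rfl),
    h.M_eq, neg_one_smul, ← sub_eq_add_neg]

end IsAdapted

theorem Generic.ne_of_fixed {𝔤 : Type*} [LieRing 𝔤] [LieAlgebra ℝ 𝔤] {S : SymData 𝔤}
    {α β : S.Form} (hβ : S.Generic β) (hα : S.σf α = α) : β ≠ α ∧ β ≠ -α :=
  ⟨fun e => hβ.1 (by rw [e, hα]), fun e => hβ.1 (by rw [e, S.σf_neg, hα])⟩

theorem Generic.ne_of_neg {𝔤 : Type*} [LieRing 𝔤] [LieAlgebra ℝ 𝔤] {S : SymData 𝔤}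
    {α β : S.Form} (hβ : S.Generic β) (hα : S.σf α = -α) : β ≠ α ∧ β ≠ -α :=
  ⟨fun e => hβ.2 (by rw [e, hα]), fun e => hβ.2 (by rw [e, S.σf_neg, hα])⟩

end SymData

/-! ### Derivatives of pull-backs of vector fields. -/

section Geometry

open VectorField Filter Topology

/-- Infinitesimal description of the pull-back of a vector field along a one-parameter family of
maps of a normed space. -/
theorem hasDerivAt_pullback_lieBracket {E : Type*} [NormedAddCommGroup E] [NormedSpace ℝ E]
    [CompleteSpace E] {ψ : ℝ → E → E} {y₀ : E} {ξ V : E → E} {F : ℝ → E}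
    (hψ : ContDiffAt ℝ 2 (fun p : ℝ × E => ψ p.1 p.2) (0, y₀))
    (hψ0 : ∀ᶠ y in 𝓝 y₀, ψ 0 y = y)
    (hξ : ∀ᶠ y in 𝓝 y₀, HasDerivAt (fun t => ψ t y) (ξ y) 0)
    (hV : DifferentiableAt ℝ V y₀)
    (hF : ∀ᶠ t in 𝓝 (0 : ℝ), fderiv ℝ (ψ t) y₀ (F t) = V (ψ t y₀)) :
    HasDerivAt F (lieBracket ℝ ξ V y₀) 0 := by
  set Ψ : ℝ × E → E := fun p => ψ p.1 p.2 with hΨ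
  have hdiff : ∀ᶠ p in 𝓝 ((0 : ℝ), y₀), DifferentiableAt ℝ Ψ p :=
    (hψ.eventually (by simp)).mono fun p hp => hp.differentiableAt (by simp)
  have hD : DifferentiableAt ℝ (fderiv ℝ Ψ) (0, y₀) :=
    (hψ.fderiv_right (m := 1) (by norm_num)).differentiableAt (by simp)
  have hsymm := (hψ.isSymmSndFDerivAt (by simp)).eq
  have hψ0' : ψ 0 y₀ = y₀ := hψ0.self_of_nhds
  have hc1 : ContinuousAt (fun t : ℝ => (t, y₀)) 0 := by fun_prop
  have hc2 : ContinuousAt (fun y : E => ((0 : ℝ), y)) y₀ := by fun_prop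
  -- `A t` is the differential of `ψ t` at `y₀`, so near `0` the curve is `F t = (A t)⁻¹ V(ψ t y₀)`.
  -- Its derivative at `0` is `DV(ξ) - A'V`, and symmetry of the second derivative of `Ψ` identifies
  -- `A'` with `Dξ`.
  set A : ℝ → E →L[ℝ] E := fun t => (fderiv ℝ Ψ (t, y₀)).comp (ContinuousLinearMap.inr ℝ ℝ E)
  have hA : HasDerivAt A ((fderiv ℝ (fderiv ℝ Ψ) (0, y₀) (1, 0)).comp
      (ContinuousLinearMap.inr ℝ ℝ E)) 0 := by
    have h1 : HasDerivAt (fun t : ℝ => (t, y₀)) ((1 : ℝ), (0 : E)) 0 :=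
      (hasDerivAt_id _).prodMk (hasDerivAt_const _ _)
    have h2 := (hD.hasFDerivAt.comp_hasDerivAt (0 : ℝ) h1)
    exact h2.clm_comp (hasDerivAt_const _ _) |>.congr_deriv (by simp)
  have hAt : ∀ᶠ t in 𝓝 (0 : ℝ), fderiv ℝ (ψ t) y₀ = A t := by
    filter_upwards [hc1.eventually hdiff] with t ht
    have h1 : HasFDerivAt (fun y : E => (t, y)) (ContinuousLinearMap.inr ℝ ℝ E) y₀ :=
      hasFDerivAt_prodMk_right t y₀
    exact (ht.hasFDerivAt.comp y₀ h1).fderiv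
  have hA0 : A 0 = 1 := by
    rw [← hAt.self_of_nhds]
    have : ψ 0 =ᶠ[𝓝 y₀] id := hψ0
    rw [this.fderiv_eq, fderiv_id]
    rfl
  have hξ' : ∀ᶠ y in 𝓝 y₀, ξ y = fderiv ℝ Ψ (0, y) (1, 0) := by
    filter_upwards [hξ, hc2.eventually hdiff] with y h1 h2
    have h3 : HasDerivAt (fun t : ℝ => (t, y)) ((1 : ℝ), (0 : E)) 0 :=
      (hasDerivAt_id _).prodMk (hasDerivAt_const _ _)
    exact h1.unique (h2.hasFDerivAt.comp_hasDerivAt (f := fun t : ℝ => (t, y)) (0 : ℝ) h3)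
  have hξd : ∀ v, fderiv ℝ ξ y₀ v = fderiv ℝ (fderiv ℝ Ψ) (0, y₀) (0, v) (1, 0) := by
    intro v
    have h1 : HasFDerivAt (fun y : E => ((0 : ℝ), y)) (ContinuousLinearMap.inr ℝ ℝ E) y₀ :=
      hasFDerivAt_prodMk_right 0 y₀
    have h2 := (hD.hasFDerivAt.comp y₀ h1).clm_apply (hasFDerivAt_const ((1 : ℝ), (0 : E)) y₀)
    have h3 : ξ =ᶠ[𝓝 y₀] fun y => fderiv ℝ Ψ (0, y) (1, 0) := hξ'
    rw [h3.fderiv_eq]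
    refine (congrArg (fun L => L v) h2.fderiv).trans ?_
    simp
  have hG : HasDerivAt (fun t => V (ψ t y₀)) (fderiv ℝ V y₀ (ξ y₀)) 0 := by
    have : HasFDerivAt V (fderiv ℝ V y₀) (ψ 0 y₀) := by rw [hψ0']; exact hV.hasFDerivAt
    exact this.comp_hasDerivAt (0 : ℝ) hξ.self_of_nhds
  have hunit : ∀ᶠ t in 𝓝 (0 : ℝ), IsUnit (A t) := by
    apply hA.continuousAt.eventually
    rw [hA0]
    exact Units.isOpen.mem_nhds isUnit_one
  have hFe : F =ᶠ[𝓝 0] fun t => Ring.inverse (A t) (V (ψ t y₀)) := by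
    filter_upwards [hunit, hAt, hF] with t h1 h2 h3
    rw [← h3, h2, ← mul_apply_eq_comp, Ring.inverse_mul_cancel _ h1]
    rfl
  have hinv := hasFDerivAt_ringInverse (𝕜 := ℝ) (1 : (E →L[ℝ] E)ˣ)
  have hA0' : A 0 = ((1 : (E →L[ℝ] E)ˣ) : E →L[ℝ] E) := hA0
  rw [← hA0'] at hinv
  set A' := (fderiv ℝ (fderiv ℝ Ψ) (0, y₀) (1, 0)).comp (ContinuousLinearMap.inr ℝ ℝ E) with hA'
  have hB : HasDerivAt (fun t => Ring.inverse (A t)) (-A') 0 := by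
    refine (hinv.comp_hasDerivAt (0 : ℝ) hA).congr_deriv ?_
    rw [neg_apply, ContinuousLinearMap.mulLeftRight_apply]
    simp
  have hfin := hB.clm_apply hG
  refine (hfin.congr_of_eventuallyEq hFe).congr_deriv ?_
  have e1 : Ring.inverse (A 0) = 1 := by rw [hA0, Ring.inverse_one]
  have e2 : fderiv ℝ ξ y₀ (V y₀) = A' (V y₀) := by rw [hξd, hsymm]; rfl
  rw [e1, hψ0', lieBracket, e2, hξ'.self_of_nhds, neg_apply, one_apply_eq_self]
  abel

theorem hasFDerivAt_of_hasMFDerivAt {E E' : Type*} [NormedAddCommGroup E] [NormedSpace ℝ E]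
    [NormedAddCommGroup E'] [NormedSpace ℝ E'] {f : E → E'} {x : E} {f' : E →L[ℝ] E'}
    (h : HasMFDerivAt 𝓘(ℝ, E) 𝓘(ℝ, E') f x f') : HasFDerivAt f f' x := by
  have := h.hasFDerivAt
  exact this

/-- The differential of the chart at its own centre is the identity, and the model has no boundary.
-/
theorem mlieBracket_eq_lieBracket {E : Type*} [NormedAddCommGroup E] [NormedSpace ℝ E]
    {N : Type*} [TopologicalSpace N] [ChartedSpace E N] [IsManifold 𝓘(ℝ, E) 1 N]
    (V W : ∀ x : N, TangentSpace 𝓘(ℝ, E) x) (x₀ : N) :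
    (mlieBracket 𝓘(ℝ, E) V W x₀ : E) = lieBracket ℝ
      (mpullbackWithin 𝓘(ℝ, E) 𝓘(ℝ, E) (extChartAt 𝓘(ℝ, E) x₀).symm V (Set.range 𝓘(ℝ, E)))
      (mpullbackWithin 𝓘(ℝ, E) 𝓘(ℝ, E) (extChartAt 𝓘(ℝ, E) x₀).symm W (Set.range 𝓘(ℝ, E)))
      (extChartAt 𝓘(ℝ, E) x₀ x₀) := by
  have hr : (extChartAt 𝓘(ℝ, E) x₀).symm ⁻¹' Set.univ ∩ Set.range 𝓘(ℝ, E) = Set.univ := by simp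
  have aux : ∀ (a b : E → E) (s : Set E) (y : E), s = Set.univ →
      lieBracketWithin ℝ a b s y = lieBracket ℝ a b y := by
    rintro a b _ y rfl
    rw [lieBracketWithin_univ]
  have hid : ∀ v : E, (ContinuousLinearMap.id ℝ (TangentSpace 𝓘(ℝ, E) x₀)).inverse v = v := by
    intro v
    rw [ContinuousLinearMap.inverse_id]
    rfl
  have h := mlieBracketWithin_apply (I := 𝓘(ℝ, E)) (V := V) (W := W) (s := Set.univ) (x₀ := x₀)
  rw [mfderiv_extChartAt_self] at h
  exact h.trans ((hid _).trans (aux _ _ _ _ hr))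

/-- The vector space case read in the chart at `x₀`. The family need not be a flow: besides
smoothness only `ψ₀ = id` and its velocity at `t = 0` enter, so any curve in a Lie group can replace
a one-parameter subgroup. -/
theorem hasDerivAt_pullback_mlieBracket {E : Type*} [NormedAddCommGroup E] [NormedSpace ℝ E]
    [CompleteSpace E] {N : Type*} [TopologicalSpace N] [ChartedSpace E N]
    [IsManifold 𝓘(ℝ, E) 2 N] {ψ : ℝ → N → N} {x₀ : N}
    {ξ V : ∀ x : N, TangentSpace 𝓘(ℝ, E) x} {F : ℝ → E}
    (hψ : ContMDiffAt (𝓘(ℝ, ℝ).prod 𝓘(ℝ, E)) 𝓘(ℝ, E) 2 (fun p : ℝ × N => ψ p.1 p.2) (0, x₀))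
    (hψ0 : ∀ y, ψ 0 y = y)
    (hξ : ∀ y, (mfderiv 𝓘(ℝ, ℝ) 𝓘(ℝ, E) (fun t => ψ t y) 0 (1 : ℝ) : E) = ξ y)
    (hV : MDifferentiableAt 𝓘(ℝ, E) 𝓘(ℝ, E).tangent
      (fun x => (⟨x, V x⟩ : TangentBundle 𝓘(ℝ, E) N)) x₀)
    (hF : ∀ᶠ t in 𝓝 (0 : ℝ),
      mfderiv 𝓘(ℝ, E) 𝓘(ℝ, E) (ψ t) x₀ (F t : E) = V (ψ t x₀)) :
    HasDerivAt F (mlieBracket 𝓘(ℝ, E) ξ V x₀ : E) 0 := by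
  have : IsManifold 𝓘(ℝ, E) 1 N := IsManifold.of_le (n := 2) (by norm_num)
  set φ := extChartAt 𝓘(ℝ, E) x₀ with hφ
  set y₀ : E := φ x₀ with hy₀
  have hx₀ : φ.symm y₀ = x₀ := extChartAt_to_inv x₀
  have htar : ∀ᶠ y in 𝓝 y₀, y ∈ φ.target := extChartAt_target_mem_nhds x₀
  have hdiff : ∀ᶠ p in 𝓝 ((0 : ℝ), x₀), ContMDiffAt (𝓘(ℝ, ℝ).prod 𝓘(ℝ, E)) 𝓘(ℝ, E) 2
      (fun p : ℝ × N => ψ p.1 p.2) p :=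
    contMDiffAt_iff_contMDiffAt_nhds (by simp) |>.1 hψ
  have hsrc : ∀ᶠ p in 𝓝 ((0 : ℝ), x₀), ψ p.1 p.2 ∈ φ.source := by
    apply hψ.continuousAt.eventually
    simp only [hψ0]
    exact extChartAt_source_mem_nhds x₀
  have hsymm : ContMDiffAt 𝓘(ℝ, E) 𝓘(ℝ, E) 2 φ.symm y₀ :=
    (contMDiffOn_extChartAt_symm (n := 2) x₀).contMDiffAt (extChartAt_target_mem_nhds x₀)
  have hchart : ∀ p ∈ φ.source, MDifferentiableAt 𝓘(ℝ, E) 𝓘(ℝ, E) φ p := fun p hp =>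
    mdifferentiableAt_extChartAt (by simpa [hφ] using hp)
  have hinv : ∀ (W : ∀ x : N, TangentSpace 𝓘(ℝ, E) x), ∀ y ∈ φ.target,
      (mpullbackWithin 𝓘(ℝ, E) 𝓘(ℝ, E) φ.symm W (Set.range 𝓘(ℝ, E)) y : E)
        = mfderiv 𝓘(ℝ, E) 𝓘(ℝ, E) φ (φ.symm y) (W (φ.symm y)) := by
    intro W y hy
    rw [mpullbackWithin_apply, ContinuousLinearMap.inverse_eq
      (mfderivWithin_extChartAt_symm_comp_mfderiv_extChartAt hy)
      (mfderiv_extChartAt_comp_mfderivWithin_extChartAt_symm hy)]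
    rfl
  have hinv' : ∀ (W : ∀ x : N, TangentSpace 𝓘(ℝ, E) x), ∀ p ∈ φ.source,
      (mpullbackWithin 𝓘(ℝ, E) 𝓘(ℝ, E) φ.symm W (Set.range 𝓘(ℝ, E)) (φ p) : E)
        = mfderiv 𝓘(ℝ, E) 𝓘(ℝ, E) φ p (W p) := by
    intro W p hp
    rw [hinv W _ (φ.map_source hp), φ.left_inv hp]
  have key := hasDerivAt_pullback_lieBracket (ψ := fun t y => φ (ψ t (φ.symm y))) (y₀ := y₀)
    (ξ := mpullbackWithin 𝓘(ℝ, E) 𝓘(ℝ, E) φ.symm ξ (Set.range 𝓘(ℝ, E)))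
    (V := mpullbackWithin 𝓘(ℝ, E) 𝓘(ℝ, E) φ.symm V (Set.range 𝓘(ℝ, E))) (F := F)
    ?_ ?_ ?_ ?_ ?_
  · rw [mlieBracket_eq_lieBracket]
    exact key
  · have h1 : ContMDiffAt (𝓘(ℝ, ℝ).prod 𝓘(ℝ, E)) (𝓘(ℝ, ℝ).prod 𝓘(ℝ, E)) 2
        (fun p : ℝ × E => (p.1, φ.symm p.2)) (0, y₀) :=
      contMDiffAt_fst.prodMk (ContMDiffAt.comp _ hsymm contMDiffAt_snd)
    have h2 : ContMDiffAt (𝓘(ℝ, ℝ).prod 𝓘(ℝ, E)) 𝓘(ℝ, E) 2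
        (fun p : ℝ × E => ψ p.1 (φ.symm p.2)) (0, y₀) :=
      ContMDiffAt.comp_of_eq (g := fun p : ℝ × N => ψ p.1 p.2) hψ h1 (by simp [hx₀])
    have h3 : ContMDiffAt (𝓘(ℝ, ℝ).prod 𝓘(ℝ, E)) 𝓘(ℝ, E) 2
        (fun p : ℝ × E => φ (ψ p.1 (φ.symm p.2))) (0, y₀) :=
      ContMDiffAt.comp_of_eq (contMDiffAt_extChartAt (n := 2) (x := x₀)) h2 (by simp [hx₀, hψ0])
    rw [← modelWithCornersSelf_prod, chartedSpaceSelf_prod] at h3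
    exact h3.contDiffAt
  · filter_upwards [htar] with y hy
    simp [hψ0, φ.right_inv hy]
  · have hc : ContinuousAt (fun y : E => ((0 : ℝ), φ.symm y)) y₀ :=
      continuousAt_const.prodMk hsymm.continuousAt
    have h2 : ∀ᶠ y in 𝓝 y₀, MDifferentiableAt (𝓘(ℝ, ℝ).prod 𝓘(ℝ, E)) 𝓘(ℝ, E)
        (fun p : ℝ × N => ψ p.1 p.2) (0, φ.symm y) := by
      apply hc.eventually
      simp only [hx₀]
      exact hdiff.mono fun p hp => hp.mdifferentiableAt (by simp)
    filter_upwards [htar, h2] with y hy h2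
    have h3 : MDifferentiableAt 𝓘(ℝ, ℝ) 𝓘(ℝ, E) (fun t => ψ t (φ.symm y)) 0 :=
      MDifferentiableAt.comp (I' := 𝓘(ℝ, ℝ).prod 𝓘(ℝ, E)) (0 : ℝ) h2
        (f := fun t : ℝ => (t, φ.symm y))
        (mdifferentiableAt_id.prodMk mdifferentiableAt_const)
    have h4 : MDifferentiableAt 𝓘(ℝ, E) 𝓘(ℝ, E) φ (ψ 0 (φ.symm y)) :=
      hchart _ (by rw [hψ0]; exact φ.map_target hy)
    have h5 : HasMFDerivAt 𝓘(ℝ, ℝ) 𝓘(ℝ, E) (fun t => φ (ψ t (φ.symm y))) 0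
        ((mfderiv 𝓘(ℝ, E) 𝓘(ℝ, E) φ (ψ 0 (φ.symm y)) : E →L[ℝ] E).comp
          (mfderiv 𝓘(ℝ, ℝ) 𝓘(ℝ, E) (fun t => ψ t (φ.symm y)) 0 : ℝ →L[ℝ] E)) :=
      h4.hasMFDerivAt.comp (0 : ℝ) h3.hasMFDerivAt
    refine (hasFDerivAt_of_hasMFDerivAt h5).hasDerivAt.congr_deriv ?_
    rw [hinv _ _ hy, ← hξ (φ.symm y), hψ0]
    rfl
  · have := hV.mdifferentiableWithinAt.differentiableWithinAt_mpullbackWithin_vectorField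
      (s := Set.univ)
    have hr : (extChartAt 𝓘(ℝ, E) x₀).symm ⁻¹' Set.univ ∩ Set.range 𝓘(ℝ, E) = Set.univ := by simp
    have aux : ∀ (a : E → E) (s : Set E) (y : E), s = Set.univ →
        DifferentiableWithinAt ℝ a s y → DifferentiableAt ℝ a y := by
      rintro a _ y rfl h
      exact differentiableWithinAt_univ.1 h
    exact aux _ _ _ hr this
  · have hc : ContinuousAt (fun t : ℝ => (t, x₀)) 0 := by fun_prop
    filter_upwards [hF, hc.eventually hdiff, hc.eventually hsrc] with t ht h2 h3
    have h4 : MDifferentiableAt 𝓘(ℝ, E) 𝓘(ℝ, E) (ψ t) x₀ :=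
      MDifferentiableAt.comp (I' := 𝓘(ℝ, ℝ).prod 𝓘(ℝ, E)) x₀ (h2.mdifferentiableAt (by simp))
        (f := fun x : N => (t, x)) (mdifferentiableAt_const.prodMk mdifferentiableAt_id)
    have h5 : HasMFDerivAt 𝓘(ℝ, E) 𝓘(ℝ, E) φ.symm y₀ (ContinuousLinearMap.id ℝ E) := by
      have := (hsymm.mdifferentiableAt (by simp)).hasMFDerivAt
      have e := mfderivWithin_range_extChartAt_symm (I := 𝓘(ℝ, E)) (x := x₀)
      simp only [modelWithCornersSelf_coe, Set.range_id, mfderivWithin_univ] at e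
      rwa [e] at this
    rw [hx₀, hinv' _ _ h3, ← ht]
    have h6 : HasMFDerivAt 𝓘(ℝ, E) 𝓘(ℝ, E) (φ ∘ ψ t) x₀
      ((mfderiv 𝓘(ℝ, E) 𝓘(ℝ, E) φ (ψ t x₀) : E →L[ℝ] E).comp
          (mfderiv 𝓘(ℝ, E) 𝓘(ℝ, E) (ψ t) x₀ : E →L[ℝ] E)) :=
      (hchart _ h3).hasMFDerivAt.comp x₀ h4.hasMFDerivAt
    have h7 : HasMFDerivAt 𝓘(ℝ, E) 𝓘(ℝ, E) (fun y => φ (ψ t (φ.symm y))) y₀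
      (((mfderiv 𝓘(ℝ, E) 𝓘(ℝ, E) φ (ψ t x₀) : E →L[ℝ] E).comp
          (mfderiv 𝓘(ℝ, E) 𝓘(ℝ, E) (ψ t) x₀ : E →L[ℝ] E)).comp (ContinuousLinearMap.id ℝ E)) := by
      rw [← hx₀] at h6
      have := h6.comp y₀ h5
      rw [hx₀] at this
      exact this
    rw [(hasFDerivAt_of_hasMFDerivAt h7).fderiv]
    rfl

/-! ### Differentials read in the model spaces. -/

section Differential

/-- The differential of a map of manifolds, as a map of the model spaces. -/
noncomputable def diff (E E' : Type*) [NormedAddCommGroup E] [NormedSpace ℝ E]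
    [NormedAddCommGroup E'] [NormedSpace ℝ E'] {N N' : Type*} [TopologicalSpace N]
    [ChartedSpace E N] [TopologicalSpace N'] [ChartedSpace E' N'] (f : N → N') (x : N) :
    E →L[ℝ] E' :=
  mfderiv 𝓘(ℝ, E) 𝓘(ℝ, E') f x

variable {E E' E'' : Type*} [NormedAddCommGroup E] [NormedSpace ℝ E]
    [NormedAddCommGroup E'] [NormedSpace ℝ E'] [NormedAddCommGroup E''] [NormedSpace ℝ E'']
    {N N' N'' : Type*} [TopologicalSpace N]
    [ChartedSpace E N] [TopologicalSpace N'] [ChartedSpace E' N'] [TopologicalSpace N'']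
    [ChartedSpace E'' N'']

theorem diff_comp {g : N' → N''} {f : N → N'} {x : N}
    (hg : MDifferentiableAt 𝓘(ℝ, E') 𝓘(ℝ, E'') g (f x))
    (hf : MDifferentiableAt 𝓘(ℝ, E) 𝓘(ℝ, E') f x) :
    diff E E'' (fun y => g (f y)) x = (diff E' E'' g (f x)).comp (diff E E' f x) :=
  mfderiv_comp x hg hf

theorem diff_const (x : N) (p : N') : diff E E' (fun _ => p) x = 0 := mfderiv_const

theorem diff_id (x : N) : diff E E (fun y => y) x = ContinuousLinearMap.id ℝ E := mfderiv_id

theorem diff_uncurry {f : N × N' → N''} {p : N × N'}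
    (hf : MDifferentiableAt (𝓘(ℝ, E).prod 𝓘(ℝ, E')) 𝓘(ℝ, E'') f p) {g : ℝ → N} {h : ℝ → N'}
    {t : ℝ} (hg : MDifferentiableAt 𝓘(ℝ, ℝ) 𝓘(ℝ, E) g t)
    (hh : MDifferentiableAt 𝓘(ℝ, ℝ) 𝓘(ℝ, E') h t) (hp : p = (g t, h t)) (v : ℝ) :
    diff ℝ E'' (fun s => f (g s, h s)) t v =
      diff E E'' (fun y => f (y, h t)) (g t) (diff ℝ E g t v)
        + diff E' E'' (fun y => f (g t, y)) (h t) (diff ℝ E' h t v) := by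
  subst hp
  have h1 : HasMFDerivAt 𝓘(ℝ, ℝ) (𝓘(ℝ, E).prod 𝓘(ℝ, E')) (fun s => (g s, h s)) t _ :=
    hg.hasMFDerivAt.prodMk hh.hasMFDerivAt
  have h2 := (hf.hasMFDerivAt.comp t h1).mfderiv
  have h3 := mfderiv_prod_eq_add_apply (v := (diff ℝ E g t v, diff ℝ E' h t v)) hf
  have h4 := congrArg (fun L => L v) h2
  exact h4.trans h3

end Differential

/-! ### The adjoint action and its derivative. -/

section Group

variable {EG : Type*} [NormedAddCommGroup EG] [NormedSpace ℝ EG]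
  {G : Type*} [TopologicalSpace G] [ChartedSpace EG G] [Group G] [LieGroup 𝓘(ℝ, EG) ∞ G]

theorem two_le_infty : (2 : WithTop ℕ∞) ≤ ∞ := ENat.LEInfty.out

/-- A straight line in the chart at `1`; only the velocity at `0` is needed later. -/
theorem exists_curve (X : EG) : ∃ c : ℝ → G, c 0 = 1 ∧
    ContMDiffAt 𝓘(ℝ, ℝ) 𝓘(ℝ, EG) ∞ c 0 ∧ diff ℝ EG c 0 1 = X := by
  have : IsManifold 𝓘(ℝ, EG) ∞ G := inferInstance
  have : IsManifold 𝓘(ℝ, EG) 1 G := IsManifold.of_le (n := ∞) (by simp)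
  set φ := extChartAt 𝓘(ℝ, EG) (1 : G) with hφ
  have hl : ContMDiffAt 𝓘(ℝ, ℝ) 𝓘(ℝ, EG) ∞ (fun t : ℝ => φ 1 + t • X) 0 := by
    apply ContDiffAt.contMDiffAt
    fun_prop
  have hs : ContMDiffAt 𝓘(ℝ, EG) 𝓘(ℝ, EG) ∞ φ.symm (φ 1) :=
    (contMDiffOn_extChartAt_symm (n := ∞) 1).contMDiffAt (extChartAt_target_mem_nhds 1)
  refine ⟨fun t => φ.symm (φ 1 + t • X), by simp [hφ], ?_, ?_⟩
  · exact ContMDiffAt.comp_of_eq hs hl (by simp)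
  · rw [diff_comp (E' := EG)
      (by simpa using hs.mdifferentiableAt (by simp)) (hl.mdifferentiableAt (by simp))]
    have h1 : diff EG EG φ.symm (φ 1) = ContinuousLinearMap.id ℝ EG := by
      have e := mfderivWithin_range_extChartAt_symm (I := 𝓘(ℝ, EG)) (x := (1 : G))
      have hr : Set.range 𝓘(ℝ, EG) = Set.univ := by simp
      rw [hr, mfderivWithin_univ] at e
      exact e
    have h2 : diff ℝ EG (fun t : ℝ => φ 1 + t • X) 0 = fderiv ℝ (fun t : ℝ => φ 1 + t • X) 0 :=
      mfderiv_eq_fderiv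
    simp only [zero_smul, add_zero]
    rw [h1, h2, ContinuousLinearMap.comp_apply, ContinuousLinearMap.id_apply]
    have h3 : HasDerivAt (fun t : ℝ => φ 1 + t • X) X 0 := by
      simpa using ((hasDerivAt_id (0 : ℝ)).smul_const X).const_add (φ 1)
    rw [fderiv_apply_one_eq_deriv, h3.deriv]

theorem diff_inv_curve {c : ℝ → G} (hc0 : c 0 = 1)
    (hc : MDifferentiableAt 𝓘(ℝ, ℝ) 𝓘(ℝ, EG) c 0) :
    diff ℝ EG (fun t => (c t)⁻¹) 0 1 = -diff ℝ EG c 0 1 := by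
  have hi : MDifferentiableAt 𝓘(ℝ, ℝ) 𝓘(ℝ, EG) (fun t => (c t)⁻¹) 0 :=
    ((contMDiff_inv 𝓘(ℝ, EG) ∞).mdifferentiable (by simp) (c 0)).comp 0 hc
  have hm : MDifferentiableAt (𝓘(ℝ, EG).prod 𝓘(ℝ, EG)) 𝓘(ℝ, EG)
      (fun p : G × G => p.1 * p.2) (c 0, (c 0)⁻¹) :=
    (contMDiff_mul 𝓘(ℝ, EG) ∞).mdifferentiable (by simp) _
  have h := diff_uncurry hm hc hi rfl 1
  simp only [mul_inv_cancel, hc0, inv_one, mul_one, one_mul, diff_id, diff_const] at h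
  simp only [ContinuousLinearMap.id_apply] at h
  exact (neg_eq_of_add_eq_zero_right h.symm).symm

/-- The adjoint action of `G` on its Lie algebra. -/
noncomputable def Ad (EG : Type*) [NormedAddCommGroup EG] [NormedSpace ℝ EG] {G : Type*}
    [TopologicalSpace G] [ChartedSpace EG G] [Group G] (g : G) : EG →L[ℝ] EG :=
  diff EG EG (fun h : G => g * h * g⁻¹) 1

theorem mdifferentiable_mul_left' (g : G) :
    MDifferentiable 𝓘(ℝ, EG) 𝓘(ℝ, EG) (fun h : G => g * h) :=
  (contMDiff_mul_left (n := ∞)).mdifferentiable (by simp)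

theorem mdifferentiable_mul_right' (g : G) :
    MDifferentiable 𝓘(ℝ, EG) 𝓘(ℝ, EG) (fun h : G => h * g) :=
  (contMDiff_mul_right (n := ∞)).mdifferentiable (by simp)

theorem mdifferentiable_conj (g : G) :
    MDifferentiable 𝓘(ℝ, EG) 𝓘(ℝ, EG) (fun h : G => g * h * g⁻¹) :=
  (mdifferentiable_mul_right' g⁻¹).comp (mdifferentiable_mul_left' g)

/-- The right translations `h ↦ h c(t)` have the left invariant field of `X` as velocity at `t = 0`,
and `Ad(c(t)) Y` is the value at `1` of the pull-back of the left invariant field of `Y`. -/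
theorem hasDerivAt_Ad [CompleteSpace EG] {c : ℝ → G} (hc0 : c 0 = 1)
    (hc : ContMDiffAt 𝓘(ℝ, ℝ) 𝓘(ℝ, EG) ∞ c 0) (X Y Z : GroupLieAlgebra 𝓘(ℝ, EG) G)
    (hX : diff ℝ EG c 0 1 = X) (hZ : ⁅X, Y⁆ = Z) :
    HasDerivAt (fun t => Ad EG (c t) Y) Z 0 := by
  subst hZ
  have : IsManifold 𝓘(ℝ, EG) ∞ G := inferInstance
  have : IsManifold 𝓘(ℝ, EG) 2 G := IsManifold.of_le (n := ∞) two_le_infty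
  apply hasDerivAt_pullback_mlieBracket (ψ := fun t h => h * c t)
  · have h1 : ContMDiffAt (𝓘(ℝ, ℝ).prod 𝓘(ℝ, EG)) 𝓘(ℝ, EG) ∞ (fun p : ℝ × G => p.2 * c p.1)
        (0, 1) := contMDiffAt_snd.mul (ContMDiffAt.comp_of_eq hc contMDiffAt_fst rfl)
    exact h1.of_le two_le_infty
  · intro h
    simp [hc0]
  · intro h
    have := diff_comp (E := ℝ) (E' := EG) (E'' := EG) (g := fun x : G => h * x) (f := c) (x := 0)
      (mdifferentiable_mul_left' h _) (hc.mdifferentiableAt (by simp))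
    rw [hc0] at this
    have h2 := congrArg (fun L => L 1) this
    refine h2.trans ?_
    rw [ContinuousLinearMap.comp_apply, hX]
    rfl
  · exact mdifferentiableAt_mulInvariantVectorField _
  · refine Eventually.of_forall fun t => ?_
    have := diff_comp (E := EG) (E' := EG) (E'' := EG) (g := fun x : G => x * c t)
      (f := fun h => c t * h * (c t)⁻¹) (x := 1)
      (mdifferentiable_mul_right' _ _) (mdifferentiable_conj _ _)
    simp only [mul_one, mul_inv_cancel, inv_mul_cancel_right] at this
    have h2 := congrArg (fun L => L Y) this
    rw [one_mul]
    exact h2.symm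

end Group

/-! ### Fundamental vector fields of a smooth action. -/

section Action

theorem tangentBundle_mk_eq {E : Type*} [NormedAddCommGroup E] [NormedSpace ℝ E] {N : Type*}
    [TopologicalSpace N] [ChartedSpace E N] {x y : N} {v w : E} (hx : x = y) (hv : v = w) :
    (⟨x, v⟩ : TangentBundle 𝓘(ℝ, E) N) = ⟨y, w⟩ := by
  subst hx hv
  rfl

theorem SmoothField.mdifferentiableAt {EM : Type*} [NormedAddCommGroup EM] [NormedSpace ℝ EM]
    {M : Type*} [TopologicalSpace M] [ChartedSpace EM M] [IsManifold 𝓘(ℝ, EM) ∞ M]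
    {X : ∀ x : M, TangentSpace 𝓘(ℝ, EM) x}
    (hX : SmoothField X) (x : M) : MDifferentiableAt 𝓘(ℝ, EM) 𝓘(ℝ, EM).tangent
      (fun x : M => (⟨x, X x⟩ : TangentBundle 𝓘(ℝ, EM) M)) x :=
  hX.mdifferentiable (by simp) x

/-- The differential at `1` of the orbit map of `x`. -/
noncomputable def orb (EG EM : Type*) [NormedAddCommGroup EG] [NormedSpace ℝ EG]
    (G : Type*) [TopologicalSpace G] [ChartedSpace EG G] [Group G]
    [NormedAddCommGroup EM] [NormedSpace ℝ EM]
    {M : Type*} [TopologicalSpace M] [ChartedSpace EM M] [MulAction G M] (x : M) : EG →L[ℝ] EM :=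
  diff EG EM (fun g : G => g • x) 1

/-- The fundamental vector field on `M` of an element of the Lie algebra of `G`. -/
noncomputable def fund {EG : Type*} [NormedAddCommGroup EG] [NormedSpace ℝ EG]
    {G : Type*} [TopologicalSpace G] [ChartedSpace EG G] [Group G]
    (EM : Type*) [NormedAddCommGroup EM] [NormedSpace ℝ EM]
    {M : Type*} [TopologicalSpace M] [ChartedSpace EM M] [MulAction G M]
    (X : GroupLieAlgebra 𝓘(ℝ, EG) G) (x : M) : TangentSpace 𝓘(ℝ, EM) x :=
  orb EG EM G x X

section

variable (EG : Type*) [NormedAddCommGroup EG] [NormedSpace ℝ EG]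
  {G : Type*} [TopologicalSpace G] [ChartedSpace EG G] [Group G]
  (EM : Type*) [NormedAddCommGroup EM] [NormedSpace ℝ EM]
  {M : Type*} [TopologicalSpace M] [ChartedSpace EM M]
  [MulAction G M] [ContMDiffSMul 𝓘(ℝ, EG) 𝓘(ℝ, EM) ∞ G M]

theorem mdifferentiable_smul_uncurry :
    MDifferentiable (𝓘(ℝ, EG).prod 𝓘(ℝ, EM)) 𝓘(ℝ, EM) (fun p : G × M => p.1 • p.2) :=
  (ContMDiffSMul.contMDiff_smul (n := ∞)).mdifferentiable (by simp)

theorem contMDiff_orbit (x : M) : ContMDiff 𝓘(ℝ, EG) 𝓘(ℝ, EM) ∞ (fun g : G => g • x) :=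
  (ContMDiffSMul.contMDiff_smul (n := ∞)).comp (contMDiff_id.prodMk contMDiff_const)

theorem mdifferentiable_orbit (x : M) : MDifferentiable 𝓘(ℝ, EG) 𝓘(ℝ, EM) (fun g : G => g • x) :=
  (contMDiff_orbit EG EM x).mdifferentiable (by simp)

end

theorem contMDiff_smul_left (EG : Type*) [NormedAddCommGroup EG] [NormedSpace ℝ EG]
    {G : Type*} [TopologicalSpace G] [ChartedSpace EG G] [Group G]
    (EM : Type*) [NormedAddCommGroup EM] [NormedSpace ℝ EM]
    {M : Type*} [TopologicalSpace M] [ChartedSpace EM M]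
    [MulAction G M] [ContMDiffSMul 𝓘(ℝ, EG) 𝓘(ℝ, EM) ∞ G M] (g : G) :
    ContMDiff 𝓘(ℝ, EM) 𝓘(ℝ, EM) ∞ (fun x : M => g • x) :=
  (ContMDiffSMul.contMDiff_smul (I := 𝓘(ℝ, EG)) (G := G) (n := ∞)).comp
    (contMDiff_const.prodMk contMDiff_id)

theorem mdifferentiable_smul_left (EG : Type*) [NormedAddCommGroup EG] [NormedSpace ℝ EG]
    {G : Type*} [TopologicalSpace G] [ChartedSpace EG G] [Group G]
    (EM : Type*) [NormedAddCommGroup EM] [NormedSpace ℝ EM]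
    {M : Type*} [TopologicalSpace M] [ChartedSpace EM M]
    [MulAction G M] [ContMDiffSMul 𝓘(ℝ, EG) 𝓘(ℝ, EM) ∞ G M] (g : G) :
    MDifferentiable 𝓘(ℝ, EM) 𝓘(ℝ, EM) (fun x : M => g • x) :=
  (contMDiff_smul_left EG EM g).mdifferentiable (by simp)

variable {EG : Type*} [NormedAddCommGroup EG] [NormedSpace ℝ EG]
  {G : Type*} [TopologicalSpace G] [ChartedSpace EG G] [Group G] [LieGroup 𝓘(ℝ, EG) ∞ G]
  {EM : Type*} [NormedAddCommGroup EM] [NormedSpace ℝ EM]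
  {M : Type*} [TopologicalSpace M] [ChartedSpace EM M]
  [MulAction G M] [ContMDiffSMul 𝓘(ℝ, EG) 𝓘(ℝ, EM) ∞ G M]

/-- Fundamental vector fields are equivariant. -/
theorem diff_smul_fund_Ad (g : G) (Y : GroupLieAlgebra 𝓘(ℝ, EG) G) (x : M) :
    diff EM EM (fun y : M => g⁻¹ • y) x (orb EG EM G x (Ad EG g Y)) = orb EG EM G (g⁻¹ • x) Y := by
  have h1 := diff_comp (E := EG) (E' := EG) (E'' := EM) (g := fun h : G => h • x)
    (f := fun h : G => g * h * g⁻¹) (x := 1) (mdifferentiable_orbit EG EM x _)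
    (mdifferentiable_conj _ _)
  have h2 := diff_comp (E := EG) (E' := EM) (E'' := EM) (g := fun y : M => g⁻¹ • y)
    (f := fun h : G => (g * h * g⁻¹) • x) (x := 1) (mdifferentiable_smul_left EG EM _ _)
    ((mdifferentiable_orbit EG EM x _).comp _ (mdifferentiable_conj _ _))
  simp only [mul_one, mul_inv_cancel, one_smul] at h1 h2
  rw [h1] at h2
  have h3 : (fun h : G => g⁻¹ • (g * h * g⁻¹) • x) = fun h : G => h • (g⁻¹ • x) := by
    ext h
    simp only [smul_smul]
    congr 1
    group
  rw [h3] at h2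
  exact (congrArg (fun L => L Y) h2).symm

theorem orb_curve_inv {c : ℝ → G} (hc0 : c 0 = 1)
    (hc : MDifferentiableAt 𝓘(ℝ, ℝ) 𝓘(ℝ, EG) c 0) (x : M) :
    diff ℝ EM (fun t => (c t)⁻¹ • x) 0 1 = -orb EG EM G x (diff ℝ EG c 0 1) := by
  have hi : MDifferentiableAt 𝓘(ℝ, ℝ) 𝓘(ℝ, EG) (fun t => (c t)⁻¹) 0 :=
    ((contMDiff_inv 𝓘(ℝ, EG) ∞).mdifferentiable (by simp) (c 0)).comp 0 hc
  rw [diff_comp (E' := EG) (g := fun g : G => g • x) (mdifferentiable_orbit EG EM x _) hi,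
    ContinuousLinearMap.comp_apply, diff_inv_curve hc0 hc, map_neg, hc0, inv_one]
  rfl

variable [IsManifold 𝓘(ℝ, EM) ∞ M]

/-- The field is the tangent map of the action `G × M → M` applied to the smooth section `x ↦ (X,
0)` over `(1, x)`. -/
theorem smoothField_fund (X : GroupLieAlgebra 𝓘(ℝ, EG) G) :
    SmoothField (EM := EM) (M := M) (fund EM X) := by
  have h0 : IsManifold 𝓘(ℝ, EG) ∞ G := inferInstance
  have S₁ : ContMDiff 𝓘(ℝ, EM) (𝓘(ℝ, EG).tangent.prod 𝓘(ℝ, EM).tangent) ∞ (fun x : M =>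
      ((⟨1, X⟩ : TangentBundle 𝓘(ℝ, EG) G), (⟨x, 0⟩ : TangentBundle 𝓘(ℝ, EM) M))) :=
    contMDiff_const.prodMk (contMDiff_zeroSection _ _)
  have S₂ : ContMDiff (𝓘(ℝ, EG).tangent.prod 𝓘(ℝ, EM).tangent) (𝓘(ℝ, EG).prod 𝓘(ℝ, EM)).tangent ∞
      (equivTangentBundleProd 𝓘(ℝ, EG) G 𝓘(ℝ, EM) M).symm := contMDiff_equivTangentBundleProd_symm
  have S₃ : ContMDiff (𝓘(ℝ, EG).prod 𝓘(ℝ, EM)).tangent 𝓘(ℝ, EM).tangent ∞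
      (tangentMap (𝓘(ℝ, EG).prod 𝓘(ℝ, EM)) 𝓘(ℝ, EM) (fun p : G × M => p.1 • p.2)) :=
    (ContMDiffSMul.contMDiff_smul (n := ∞)).contMDiff_tangentMap (by simp)
  have S := (S₃.comp S₂).comp S₁
  unfold SmoothField
  convert S using 2 with x
  have h := mfderiv_prod_eq_add_apply (v := (show EG × EM from (X, 0)))
    (mdifferentiable_smul_uncurry EG EM ((1 : G), x))
  refine tangentBundle_mk_eq (one_smul G x).symm ?_
  refine Eq.trans ?_ h.symm
  have h2 : mfderiv 𝓘(ℝ, EM) 𝓘(ℝ, EM) (fun y : M => (1 : G) • y) x (0 : EM) = 0 := map_zero _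
  exact ((congrArg (fun w : EM => orb EG EM G x X + w) h2).trans (add_zero _)).symm

/-- The value at `x` of `(Ad(c(t)) Y)*` is also the pull-back of `Y*` under `y ↦ c(t)⁻¹ y`, whose
velocity is `-X*`. Its derivative at `0` is therefore both `[X, Y]*` and `-[X*, Y*]`. -/
theorem mlieBracket_fund [CompleteSpace EG] [CompleteSpace EM]
    (X Y : GroupLieAlgebra 𝓘(ℝ, EG) G) (x : M) :
    mlieBracket 𝓘(ℝ, EM) (fund EM X) (fund EM Y) x = -fund EM ⁅X, Y⁆ x := by
  have : IsManifold 𝓘(ℝ, EM) 2 M := IsManifold.of_le (n := ∞) two_le_infty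
  obtain ⟨c, hc0, hc, hcX⟩ := exists_curve (EG := EG) (G := G) X
  have hcd := hc.mdifferentiableAt (n := ∞) (by simp)
  have h1 : HasDerivAt (fun t => orb EG EM G x (Ad EG (c t) Y)) _ 0 :=
    (orb EG EM G x).hasFDerivAt.comp_hasDerivAt (0 : ℝ) (hasDerivAt_Ad hc0 hc X Y _ hcX rfl)
  have h2 : HasDerivAt (fun t => orb EG EM G x (Ad EG (c t) Y)) _ 0 :=
    hasDerivAt_pullback_mlieBracket (E := EM) (ψ := fun t y => (c t)⁻¹ • y) (x₀ := x)
      (ξ := (-1 : ℝ) • fund EM X) (V := fund EM Y) ?_ ?_ ?_ ?_ ?_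
  · have h3 := h1.unique h2
    rw [mlieBracket_const_smul_left ((smoothField_fund X).mdifferentiableAt x)] at h3
    have h4 : ∀ a b : EM, b = (-1 : ℝ) • a → a = -b := by
      rintro a _ rfl
      simp
    exact h4 _ _ h3
  · have h3 : ContMDiffAt (𝓘(ℝ, ℝ).prod 𝓘(ℝ, EM)) 𝓘(ℝ, EG) ∞
        (fun p : ℝ × M => (c p.1)⁻¹) (0, x) :=
      (ContMDiffAt.comp_of_eq hc contMDiffAt_fst rfl).inv
    have h4 : ContMDiffAt (𝓘(ℝ, ℝ).prod 𝓘(ℝ, EM)) 𝓘(ℝ, EM) ∞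
        (fun p : ℝ × M => (c p.1)⁻¹ • p.2) (0, x) :=
      (ContMDiffSMul.contMDiff_smul (I := 𝓘(ℝ, EG)) (I' := 𝓘(ℝ, EM)) (G := G) (M := M)
        (n := ∞)).contMDiffAt.comp (0, x) (h3.prodMk contMDiffAt_snd)
    exact h4.of_le two_le_infty
  · intro y
    simp [hc0]
  · intro y
    refine (orb_curve_inv (EM := EM) hc0 hcd y).trans ?_
    rw [hcX]
    exact (neg_one_smul ℝ (orb EG EM G y X)).symm
  · exact (smoothField_fund Y).mdifferentiableAt x
  · exact Eventually.of_forall fun t => diff_smul_fund_Ad (EM := EM) (c t) Y x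

end Action

/-! ### The metric and isometric actions. -/

section Metric

/-- The inner product of a tangent space, as a bilinear form on the model space. -/
noncomputable def innerB (EM : Type*) [NormedAddCommGroup EM] [NormedSpace ℝ EM]
    {M : Type*} [TopologicalSpace M] [ChartedSpace EM M]
    [RiemannianBundle (fun x : M => TangentSpace 𝓘(ℝ, EM) x)] (x : M) : EM →ₗ[ℝ] EM →ₗ[ℝ] ℝ :=
  LinearMap.mk₂ ℝ (fun u v : EM => inner ℝ (show TangentSpace 𝓘(ℝ, EM) x from u) v)
    (fun u u' v => inner_add_left (E := TangentSpace 𝓘(ℝ, EM) x) u u' v)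
    (fun a u v => real_inner_smul_left (F := TangentSpace 𝓘(ℝ, EM) x) u v a)
    (fun u v v' => inner_add_right (E := TangentSpace 𝓘(ℝ, EM) x) u v v')
    (fun a u v => real_inner_smul_right (F := TangentSpace 𝓘(ℝ, EM) x) u v a)

section

variable {EM : Type*} [NormedAddCommGroup EM] [NormedSpace ℝ EM] 
  {M : Type*} [TopologicalSpace M] [ChartedSpace EM M]
  [RiemannianBundle (fun x : M => TangentSpace 𝓘(ℝ, EM) x)]

theorem innerB_comm (x : M) (u v : EM) : innerB EM x u v = innerB EM x v u :=
  real_inner_comm (F := TangentSpace 𝓘(ℝ, EM) x) v u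

theorem eq_zero_of_innerB (x : M) {u : EM} (h : ∀ v, innerB EM x u v = 0) : u = 0 :=
  inner_self_eq_zero (𝕜 := ℝ) (E := TangentSpace 𝓘(ℝ, EM) x).1 (h u)

theorem hasDerivAt_innerB [FiniteDimensional ℝ EM] (x : M) {f g : ℝ → EM} {f' g' : EM} {t : ℝ}
    (hf : HasDerivAt f f' t) (hg : HasDerivAt g g' t) :
    HasDerivAt (fun s => innerB EM x (f s) (g s)) (innerB EM x f' (g t) + innerB EM x (f t) g') t := by
  have h := ((innerB EM x).toContinuousBilinearMap.hasFDerivAt.comp_hasDerivAt t hf).clm_apply hg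
  exact h

variable [IsManifold 𝓘(ℝ, EM) ∞ M]
  [IsContMDiffRiemannianBundle 𝓘(ℝ, EM) ∞ EM (fun x : M => TangentSpace 𝓘(ℝ, EM) x)]

theorem mdifferentiable_innerB {σ τ : ∀ x : M, TangentSpace 𝓘(ℝ, EM) x} (hσ : SmoothField σ)
    (hτ : SmoothField τ) :
    MDifferentiable 𝓘(ℝ, EM) 𝓘(ℝ, ℝ) (fun x => innerB EM x (σ x) (τ x)) := by
  have : IsContMDiffRiemannianBundle 𝓘(ℝ, EM) 1 EM (fun x : M => TangentSpace 𝓘(ℝ, EM) x) :=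
    IsContMDiffRiemannianBundle.of_le (n := ∞) (by simp)
  intro x
  have h : MDifferentiableAt 𝓘(ℝ, EM) 𝓘(ℝ, ℝ) (fun y => inner ℝ (σ y) (τ y)) x :=
    MDifferentiableAt.inner_bundle (IB := 𝓘(ℝ, EM)) (F := EM)
      (E := fun x : M => TangentSpace 𝓘(ℝ, EM) x) (b := fun x => x)
      (hσ.mdifferentiableAt x) (hτ.mdifferentiableAt x)
  exact h

variable [FiniteDimensional ℝ EM]

theorem IsLeviCivita.diff_innerB
    {cov : CovariantDerivative 𝓘(ℝ, EM) EM (fun x : M => TangentSpace 𝓘(ℝ, EM) x)}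
    (hcov : IsLeviCivita cov) {σ τ : ∀ x : M, TangentSpace 𝓘(ℝ, EM) x} (hσ : SmoothField σ)
    (hτ : SmoothField τ) (x : M) (v : EM) :
    diff EM ℝ (fun x => innerB EM x (σ x) (τ x)) x v =
      innerB EM x (cov σ x v) (τ x) + innerB EM x (σ x) (cov τ x v) :=
  hcov.2.1.mvfderiv_inner_eq (fun _ => v) (hσ.mdifferentiableAt x) (hτ.mdifferentiableAt x)

theorem IsLeviCivita.torsion_free
    {cov : CovariantDerivative 𝓘(ℝ, EM) EM (fun x : M => TangentSpace 𝓘(ℝ, EM) x)}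
    (hcov : IsLeviCivita cov) {X Y : ∀ x : M, TangentSpace 𝓘(ℝ, EM) x} (hX : SmoothField X)
    (hY : SmoothField Y) (x : M) :
    cov Y x (X x) - cov X x (Y x) = mlieBracket 𝓘(ℝ, EM) X Y x :=
  cov.torsion_eq_zero_iff.1 hcov.2.2 (hX.mdifferentiableAt x) (hY.mdifferentiableAt x)

end

section Isometric

variable {EG : Type*} [NormedAddCommGroup EG] [NormedSpace ℝ EG]
  {G : Type*} [TopologicalSpace G] [ChartedSpace EG G] [Group G] [LieGroup 𝓘(ℝ, EG) ∞ G]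
  {EM : Type*} [NormedAddCommGroup EM] [NormedSpace ℝ EM] [FiniteDimensional ℝ EM]
  {M : Type*} [TopologicalSpace M] [ChartedSpace EM M] [IsManifold 𝓘(ℝ, EM) ∞ M]
  [RiemannianBundle (fun x : M => TangentSpace 𝓘(ℝ, EM) x)]
  [IsContMDiffRiemannianBundle 𝓘(ℝ, EM) ∞ EM (fun x : M => TangentSpace 𝓘(ℝ, EM) x)]
  [MulAction G M] [ContMDiffSMul 𝓘(ℝ, EG) 𝓘(ℝ, EM) ∞ G M]

/-- The inner product of two fundamental vector fields at a point. -/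
noncomputable def gram {EG : Type*} [NormedAddCommGroup EG] [NormedSpace ℝ EG]
    {G : Type*} [TopologicalSpace G] [ChartedSpace EG G] [Group G]
    (EM : Type*) [NormedAddCommGroup EM] [NormedSpace ℝ EM]
    {M : Type*} [TopologicalSpace M] [ChartedSpace EM M] [MulAction G M]
    [RiemannianBundle (fun x : M => TangentSpace 𝓘(ℝ, EM) x)]
    (X Y : GroupLieAlgebra 𝓘(ℝ, EG) G) (x : M) : ℝ :=
  innerB EM x (orb EG EM G x X) (orb EG EM G x Y)

/-- Fundamental vector fields of an isometric action are Killing fields. -/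
theorem diff_gram [CompleteSpace EG]
    (hiso : ∀ (g : G) (x : M) (u v : TangentSpace 𝓘(ℝ, EM) x),
      inner ℝ (mfderiv 𝓘(ℝ, EM) 𝓘(ℝ, EM) (fun y : M => g • y) x u)
        (mfderiv 𝓘(ℝ, EM) 𝓘(ℝ, EM) (fun y : M => g • y) x v) = inner ℝ u v)
    (X Y Z : GroupLieAlgebra 𝓘(ℝ, EG) G) (x : M) :
    diff EM ℝ (gram EM Y Z) x (orb EG EM G x X) = -(gram EM ⁅X, Y⁆ Z x + gram EM Y ⁅X, Z⁆ x) := by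
  obtain ⟨c, hc0, hc, hcX⟩ := exists_curve (EG := EG) (G := G) X
  have hcd := hc.mdifferentiableAt (n := ∞) (by simp)
  have hA : ∀ Y : GroupLieAlgebra 𝓘(ℝ, EG) G,
      HasDerivAt (fun t => orb EG EM G x (Ad EG (c t) Y)) (orb EG EM G x
        (⁅X, Y⁆ : GroupLieAlgebra 𝓘(ℝ, EG) G)) 0 := fun Y =>
    (orb EG EM G x).hasFDerivAt.comp_hasDerivAt (0 : ℝ) (hasDerivAt_Ad hc0 hc X Y _ hcX rfl)
  have hA0 : ∀ Y : GroupLieAlgebra 𝓘(ℝ, EG) G, Ad EG (c 0) Y = Y := by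
    intro Y
    have h : Ad EG (c 0) = ContinuousLinearMap.id ℝ EG := by
      rw [hc0, Ad]
      simp [diff_id]
    rw [h]
    rfl
  have h1 := hasDerivAt_innerB x (hA Y) (hA Z)
  -- Equivariance and the isometry `c(t)⁻¹` shift the variation from the Lie algebra elements to the
  -- base point.
  have h2 : (fun t => innerB EM x (orb EG EM G x (Ad EG (c t) Y)) (orb EG EM G x (Ad EG (c t) Z)))
      = fun t => gram EM Y Z ((c t)⁻¹ • x) := by
    ext t
    rw [gram, ← diff_smul_fund_Ad, ← diff_smul_fund_Ad]
    exact (hiso _ _ _ _).symm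
  rw [h2] at h1
  have hi : MDifferentiableAt 𝓘(ℝ, ℝ) 𝓘(ℝ, EM) (fun t => (c t)⁻¹ • x) 0 :=
    ((contMDiff_orbit EG EM x).mdifferentiable (by simp) _).comp 0
      (((contMDiff_inv 𝓘(ℝ, EG) ∞).mdifferentiable (by simp) (c 0)).comp 0 hcd)
  have h3 := diff_comp (E := ℝ) (E' := EM) (E'' := ℝ) (g := gram (M := M) EM Y Z)
    (mdifferentiable_innerB (smoothField_fund Y) (smoothField_fund Z) _) hi
  have h4 : diff ℝ ℝ (fun t => gram EM Y Z ((c t)⁻¹ • x)) 0 1 =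
      gram EM ⁅X, Y⁆ Z x + gram EM Y ⁅X, Z⁆ x := by
    have : diff ℝ ℝ (fun t => gram EM Y Z ((c t)⁻¹ • x)) 0 =
      fderiv ℝ (fun t => gram EM Y Z ((c t)⁻¹ • x)) 0 := mfderiv_eq_fderiv
    rw [this, fderiv_apply_one_eq_deriv, h1.deriv, hA0, hA0]
    rfl
  rw [h3, ContinuousLinearMap.comp_apply, orb_curve_inv hc0 hcd, hcX, map_neg, hc0, inv_one,
    one_smul] at h4
  linarith

end Isometric

end Metric

/-! ### The Levi-Civita connection and tensoriality of its curvature. -/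

section Connection

variable {EM : Type*} [NormedAddCommGroup EM] [NormedSpace ℝ EM] [FiniteDimensional ℝ EM]
  {M : Type*} [TopologicalSpace M] [ChartedSpace EM M] [IsManifold 𝓘(ℝ, EM) ∞ M]
  [RiemannianBundle (fun x : M => TangentSpace 𝓘(ℝ, EM) x)]
  [IsContMDiffRiemannianBundle 𝓘(ℝ, EM) ∞ EM (fun x : M => TangentSpace 𝓘(ℝ, EM) x)]
  {cov : CovariantDerivative 𝓘(ℝ, EM) EM (fun x : M => TangentSpace 𝓘(ℝ, EM) x)}

theorem IsLeviCivita.contMDiff_cov (hcov : IsLeviCivita cov)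
    {W : ∀ x : M, TangentSpace 𝓘(ℝ, EM) x} (hW : SmoothField W) :
    ContMDiff 𝓘(ℝ, EM) (𝓘(ℝ, EM).prod 𝓘(ℝ, EM →L[ℝ] EM)) ∞
      (fun x : M => (⟨x, cov W x⟩ : TotalSpace (EM →L[ℝ] EM)
        fun x : M => TangentSpace 𝓘(ℝ, EM) x →L[ℝ] TangentSpace 𝓘(ℝ, EM) x)) := by
  rw [← contMDiffOn_univ]
  exact hcov.1.contMDiff.contMDiff (σ := W) (contMDiffOn_univ.2 hW)

theorem IsLeviCivita.smoothField_cov (hcov : IsLeviCivita cov)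
    {W Y : ∀ x : M, TangentSpace 𝓘(ℝ, EM) x} (hW : SmoothField W) (hY : SmoothField Y) :
    SmoothField (fun y => cov W y (Y y)) :=
  ContMDiff.clm_bundle_apply (F₁ := EM) (F₂ := EM) (E₁ := fun x : M => TangentSpace 𝓘(ℝ, EM) x)
    (E₂ := fun x : M => TangentSpace 𝓘(ℝ, EM) x) (b := fun x : M => x)
    (hcov.contMDiff_cov hW) hY

theorem IsLeviCivita.mdifferentiableAt_cov (hcov : IsLeviCivita cov)
    {W Y : ∀ x : M, TangentSpace 𝓘(ℝ, EM) x} (hW : SmoothField W) {x : M}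
    (hY : MDifferentiableAt 𝓘(ℝ, EM) 𝓘(ℝ, EM).tangent
      (fun x : M => (⟨x, Y x⟩ : TangentBundle 𝓘(ℝ, EM) M)) x) :
    MDifferentiableAt 𝓘(ℝ, EM) 𝓘(ℝ, EM).tangent
      (fun y : M => (⟨y, cov W y (Y y)⟩ : TangentBundle 𝓘(ℝ, EM) M)) x :=
  MDifferentiableAt.clm_bundle_apply (F₁ := EM) (F₂ := EM)
    (E₁ := fun x : M => TangentSpace 𝓘(ℝ, EM) x)
    (E₂ := fun x : M => TangentSpace 𝓘(ℝ, EM) x) (b := fun x : M => x)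
    ((hcov.contMDiff_cov hW).mdifferentiable (by simp) x) hY

theorem curvature_swap {EM : Type*} [NormedAddCommGroup EM] [NormedSpace ℝ EM]
    {M : Type*} [TopologicalSpace M] [ChartedSpace EM M] [IsManifold 𝓘(ℝ, EM) ∞ M]
    {cov : CovariantDerivative 𝓘(ℝ, EM) EM (fun x : M => TangentSpace 𝓘(ℝ, EM) x)}
    (U V W : ∀ x : M, TangentSpace 𝓘(ℝ, EM) x) (x : M) :
    curvature cov U V W x = -curvature cov V U W x := by
  unfold curvature
  rw [mlieBracket_swap_apply, map_neg]
  abel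

/-- The term with `V(f)` from `∇_V(f ∇_U W)` cancels the one from `∇_{[fU, V]} W`. Smoothness of the
connection makes `∇_U W` differentiable. -/
theorem IsLeviCivita.tensorialAt_curvature (hcov : IsLeviCivita cov)
    {W : ∀ x : M, TangentSpace 𝓘(ℝ, EM) x} (hW : SmoothField W)
    (V : ∀ x : M, TangentSpace 𝓘(ℝ, EM) x) (x : M) :
    TensorialAt 𝓘(ℝ, EM) EM (fun U => curvature cov U V W x) x where
  smul {f U} hf hU := by
    have h1 : (fun y => cov W y ((f • U) y)) = f • fun y => cov W y (U y) := by
      ext y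
      exact map_smul (cov W y) (f y) (U y)
    unfold curvature
    rw [h1, cov.isCovariantDerivativeOn.leibniz (hcov.mdifferentiableAt_cov hW hU) hf,
      mlieBracket_smul_left hf hU]
    simp only [map_add, map_smul, neg_smul, map_neg]
    simp
    module
  add {U U'} hU hU' := by
    have h1 : (fun y => cov W y ((U + U') y)) = (fun y => cov W y (U y)) +
        fun y => cov W y (U' y) := by
      ext y
      exact map_add (cov W y) (U y) (U' y)
    unfold curvature
    rw [h1, cov.isCovariantDerivativeOn.add (hcov.mdifferentiableAt_cov hW hU)
      (hcov.mdifferentiableAt_cov hW hU'), mlieBracket_add_left hU hU']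
    simp only [map_add]
    simp
    abel

/-- The curvature at a point depends only on the values of its first two arguments there. -/
theorem IsLeviCivita.curvature_congr (hcov : IsLeviCivita cov)
    {U U' V V' W : ∀ x : M, TangentSpace 𝓘(ℝ, EM) x} (hU : SmoothField U) (hU' : SmoothField U')
    (hV : SmoothField V) (hV' : SmoothField V') (hW : SmoothField W) {x : M}
    (hUU' : U x = U' x) (hVV' : V x = V' x) :
    curvature cov U V W x = curvature cov U' V' W x := by
  rw [(hcov.tensorialAt_curvature hW V x).pointwise
    (hU.mdifferentiableAt x) (hU'.mdifferentiableAt x) hUU', curvature_swap, curvature_swap U',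
    (hcov.tensorialAt_curvature hW U' x).pointwise
    (hV.mdifferentiableAt x) (hV'.mdifferentiableAt x) hVV']

end Connection

/-! ### Second derivatives along commuting directions. -/

section Commute

variable {EM : Type*} [NormedAddCommGroup EM] [NormedSpace ℝ EM] [FiniteDimensional ℝ EM]
  {M : Type*} [TopologicalSpace M] [ChartedSpace EM M] [IsManifold 𝓘(ℝ, EM) ∞ M]

/-- Subtract `f(o)` times the Jacobi identity for `X, Y, w` from the one for `X, Y, fw`. What
remains at `o` is `(XYf - YXf) w`, the left-hand sides cancelling because `[X, Y]` vanishes there.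
-/
theorem diff_diff_comm {X Y w : ∀ x : M, TangentSpace 𝓘(ℝ, EM) x} (hX : SmoothField X)
    (hY : SmoothField Y) (hw : SmoothField w) {f : M → ℝ} (hf : ContMDiff 𝓘(ℝ, EM) 𝓘(ℝ, ℝ) ∞ f)
    {o : M} (hXf : MDifferentiableAt 𝓘(ℝ, EM) 𝓘(ℝ, ℝ) (fun p => diff EM ℝ f p (X p)) o)
    (hYf : MDifferentiableAt 𝓘(ℝ, EM) 𝓘(ℝ, ℝ) (fun p => diff EM ℝ f p (Y p)) o)
    (hXY : mlieBracket 𝓘(ℝ, EM) X Y o = 0) (hwo : w o ≠ 0) :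
    diff EM ℝ (fun p => diff EM ℝ f p (Y p)) o (X o) =
      diff EM ℝ (fun p => diff EM ℝ f p (X p)) o (Y o) := by
  have hCS : CompleteSpace EM := FiniteDimensional.complete ℝ EM
  have i1 : minSmoothness ℝ 2 + 1 ≤ (∞ : WithTop ℕ∞) := by
    rw [minSmoothness_of_isRCLikeNormedField]
    exact WithTop.coe_le_coe.2 le_top
  have i2 : minSmoothness ℝ 2 ≤ (∞ : WithTop ℕ∞) := by
    rw [minSmoothness_of_isRCLikeNormedField]; exact ENat.LEInfty.out
  have i3 : minSmoothness ℝ (((1 : ℕ∞) : WithTop ℕ∞) + 1) ≤ ((2 : ℕ∞) : WithTop ℕ∞) := by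
    rw [minSmoothness_of_isRCLikeNormedField]
    exact le_rfl
  have : IsManifold 𝓘(ℝ, EM) (((2 : ℕ∞) : WithTop ℕ∞) + 1) M :=
    IsManifold.of_le (n := ∞) (WithTop.coe_le_coe.2 le_top)
  have : IsManifold 𝓘(ℝ, EM) (minSmoothness ℝ 3) M := IsManifold.of_le (n := ∞) ENat.LEInfty.out
  have hfm : ∀ x, MDifferentiableAt 𝓘(ℝ, EM) 𝓘(ℝ, ℝ) f x := hf.mdifferentiable (by simp)
  have hfw : SmoothField (f • w) := ContMDiff.smul_section hf hw
  have hbr : ∀ {A B : ∀ x : M, TangentSpace 𝓘(ℝ, EM) x}, SmoothField A → SmoothField B →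
      MDifferentiableAt 𝓘(ℝ, EM) 𝓘(ℝ, EM).tangent
        (fun x : M => (⟨x, mlieBracket 𝓘(ℝ, EM) A B x⟩ : TangentBundle 𝓘(ℝ, EM) M)) o := by
    intro A B hA hB
    have := ContMDiffAt.mlieBracket_vectorField (m := 1) (n := 2)
      ((hA o).of_le two_le_infty) ((hB o).of_le two_le_infty) i3
    exact this.mdifferentiableAt (by simp)
  have key : ∀ {A B : ∀ x : M, TangentSpace 𝓘(ℝ, EM) x}, SmoothField A → SmoothField B →
      MDifferentiableAt 𝓘(ℝ, EM) 𝓘(ℝ, ℝ) (fun p => diff EM ℝ f p (B p)) o →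
      mlieBracket 𝓘(ℝ, EM) A (mlieBracket 𝓘(ℝ, EM) B (f • w)) o =
      (diff EM ℝ (fun p => diff EM ℝ f p (B p)) o (A o) • w o +
        diff EM ℝ f o (B o) • mlieBracket 𝓘(ℝ, EM) A w o) +
      (diff EM ℝ f o (A o) • mlieBracket 𝓘(ℝ, EM) B w o +
        f o • mlieBracket 𝓘(ℝ, EM) A (mlieBracket 𝓘(ℝ, EM) B w) o) := by
    intro A B hA hB hBf
    have h1 : mlieBracket 𝓘(ℝ, EM) B (f • w) =
        (fun p => diff EM ℝ f p (B p)) • w + f • mlieBracket 𝓘(ℝ, EM) B w := by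
      ext p
      exact mlieBracket_smul_right (hfm p) (hw.mdifferentiableAt p)
    rw [h1, mlieBracket_add_right, mlieBracket_smul_right hBf (hw.mdifferentiableAt o),
      mlieBracket_smul_right (hfm o) (hbr hB hw)]
    · rfl
    · exact hBf.smul_section (hw.mdifferentiableAt o)
    · exact (hfm o).smul_section (hbr hB hw)
  have e1 := leibniz_identity_mlieBracket_apply (I := 𝓘(ℝ, EM)) (U := X) (V := Y) (W := f • w)
    ((hX o).of_le i2) ((hY o).of_le i2) ((hfw o).of_le i2)
  have e2 := leibniz_identity_mlieBracket_apply (I := 𝓘(ℝ, EM)) (U := X) (V := Y) (W := w)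
    ((hX o).of_le i2) ((hY o).of_le i2) ((hw o).of_le i2)
  have e3 := mlieBracket_smul_right (V := mlieBracket 𝓘(ℝ, EM) X Y) (hfm o) (hw.mdifferentiableAt o)
  rw [hXY, map_zero, zero_smul, zero_add] at e3
  rw [e3, key hX hY hYf, key hY hX hXf, e2] at e1
  have e4 : ∀ (a b c d r : ℝ) (p q u v z : EM),
      (a • p + b • q) + (c • u + r • (v + z)) = r • v + ((d • p + c • u) + (b • q + r • z)) →
      p ≠ 0 → a = d := by
    intro a b c d r p q u v z h hp
    have : (a - d) • p = 0 := by
      have h2 := sub_eq_zero.2 h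
      rw [← h2]
      module
    rcases smul_eq_zero.1 this with h3 | h3
    · linarith
    · exact absurd h3 hp
  exact e4 _ _ _ _ _ _ _ _ _ _ e1 hwo

end Commute

/-! ### The Koszul formula for fundamental fields. -/

section Gram

theorem gram_comm {EG : Type*} [NormedAddCommGroup EG] [NormedSpace ℝ EG]
    {G : Type*} [TopologicalSpace G] [ChartedSpace EG G] [Group G]
    {EM : Type*} [NormedAddCommGroup EM] [NormedSpace ℝ EM]
    {M : Type*} [TopologicalSpace M] [ChartedSpace EM M]
    [RiemannianBundle (fun x : M => TangentSpace 𝓘(ℝ, EM) x)] [MulAction G M]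
    (X Y : GroupLieAlgebra 𝓘(ℝ, EG) G) (p : M) : gram EM X Y p = gram EM Y X p :=
  innerB_comm _ _ _

section

variable {EG : Type*} [NormedAddCommGroup EG] [NormedSpace ℝ EG]
  {G : Type*} [TopologicalSpace G] [ChartedSpace EG G] [Group G]
  {EM : Type*} [NormedAddCommGroup EM] [NormedSpace ℝ EM]
  {M : Type*} [TopologicalSpace M] [ChartedSpace EM M]
  [RiemannianBundle (fun x : M => TangentSpace 𝓘(ℝ, EM) x)] [MulAction G M]
  (X Y Z : GroupLieAlgebra 𝓘(ℝ, EG) G) (p : M)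

theorem gram_add_left : gram EM (X + Y) Z p = gram EM X Z p + gram EM Y Z p := by
  have h : orb EG EM G p (X + Y) = orb EG EM G p X + orb EG EM G p Y :=
    map_add (orb EG EM G p) X Y
  unfold gram
  rw [h, map_add]
  rfl

theorem gram_neg_left : gram EM (-X) Z p = -gram EM X Z p := by
  have h : orb EG EM G p (-X) = -orb EG EM G p X := map_neg (orb EG EM G p) X
  unfold gram
  rw [h, map_neg]
  rfl

theorem gram_eq_zero_left {X : GroupLieAlgebra 𝓘(ℝ, EG) G} {p : M} (h : orb EG EM G p X = 0) :
    gram EM X Z p = 0 := by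
  unfold gram
  rw [h, map_zero]
  rfl

theorem gram_eq_zero_right {X : GroupLieAlgebra 𝓘(ℝ, EG) G} {p : M} (h : orb EG EM G p X = 0) :
    gram EM Z X p = 0 := by
  rw [gram_comm, gram_eq_zero_left _ h]

end

section

variable {EG : Type*} [NormedAddCommGroup EG] [NormedSpace ℝ EG] [CompleteSpace EG]
  {G : Type*} [TopologicalSpace G] [ChartedSpace EG G] [Group G] [LieGroup 𝓘(ℝ, EG) ∞ G]
  {EM : Type*} [NormedAddCommGroup EM] [NormedSpace ℝ EM]
  {M : Type*} [TopologicalSpace M] [ChartedSpace EM M]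
  [RiemannianBundle (fun x : M => TangentSpace 𝓘(ℝ, EM) x)] [MulAction G M]

theorem gram_lie_skew (X Y Z : GroupLieAlgebra 𝓘(ℝ, EG) G) (p : M) :
    gram EM ⁅Y, X⁆ Z p = -gram EM ⁅X, Y⁆ Z p := by
  rw [← gram_neg_left, lie_skew]

/-- The Jacobi identity, paired with a further vector. -/
theorem gram_jacobi (X Y Z W : GroupLieAlgebra 𝓘(ℝ, EG) G) (p : M) :
    gram EM ⁅X, ⁅Y, Z⁆⁆ W p = gram EM ⁅⁅X, Y⁆, Z⁆ W p + gram EM ⁅Y, ⁅X, Z⁆⁆ W p := by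
  rw [← gram_add_left, leibniz_lie]

end

section

variable {EG : Type*} [NormedAddCommGroup EG] [NormedSpace ℝ EG] [CompleteSpace EG]
  {G : Type*} [TopologicalSpace G] [ChartedSpace EG G] [Group G] [LieGroup 𝓘(ℝ, EG) ∞ G]
  {EM : Type*} [NormedAddCommGroup EM] [NormedSpace ℝ EM] [FiniteDimensional ℝ EM]
  {M : Type*} [TopologicalSpace M] [ChartedSpace EM M] [IsManifold 𝓘(ℝ, EM) ∞ M]
  [RiemannianBundle (fun x : M => TangentSpace 𝓘(ℝ, EM) x)]
  [IsContMDiffRiemannianBundle 𝓘(ℝ, EM) ∞ EM (fun x : M => TangentSpace 𝓘(ℝ, EM) x)]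
  [MulAction G M] [ContMDiffSMul 𝓘(ℝ, EG) 𝓘(ℝ, EM) ∞ G M]
  {cov : CovariantDerivative 𝓘(ℝ, EM) EM (fun x : M => TangentSpace 𝓘(ℝ, EM) x)}

/-- The Koszul formula for fundamental vector fields of an isometric action. -/
theorem IsLeviCivita.cov_fund (hcov : IsLeviCivita cov)
    (hiso : ∀ (g : G) (x : M) (u v : TangentSpace 𝓘(ℝ, EM) x),
      inner ℝ (mfderiv 𝓘(ℝ, EM) 𝓘(ℝ, EM) (fun y : M => g • y) x u)
        (mfderiv 𝓘(ℝ, EM) 𝓘(ℝ, EM) (fun y : M => g • y) x v) = inner ℝ u v)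
    (X Y Z : GroupLieAlgebra 𝓘(ℝ, EG) G) (p : M) :
    innerB EM p (cov (fund EM Y) p (fund EM X p)) (fund EM Z p) =
      -(1 / 2) * (gram EM ⁅X, Y⁆ Z p + gram EM ⁅X, Z⁆ Y p + gram EM X ⁅Y, Z⁆ p) := by
  have hCS : CompleteSpace EM := FiniteDimensional.complete ℝ EM
  -- Metric compatibility, with the derivative evaluated by the Killing property. Three such
  -- equations and three torsion equations `tor` form a linear system for the Koszul formula.
  have met : ∀ X Y Z : GroupLieAlgebra 𝓘(ℝ, EG) G,
      innerB EM p (cov (fund EM Y) p (fund EM X p)) (fund EM Z p) +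
        innerB EM p (cov (fund EM Z) p (fund EM X p)) (fund EM Y p) =
        -(gram EM ⁅X, Y⁆ Z p + gram EM Y ⁅X, Z⁆ p) := by
    intro X Y Z
    rw [← diff_gram hiso]
    exact (congrArg₂ (· + ·) rfl (innerB_comm (EM := EM) p _ _)).trans
      (hcov.diff_innerB (smoothField_fund Y) (smoothField_fund Z) p _).symm
  have tor : ∀ X Y Z : GroupLieAlgebra 𝓘(ℝ, EG) G,
      innerB EM p (cov (fund EM Y) p (fund EM X p)) (fund EM Z p) -
        innerB EM p (cov (fund EM X) p (fund EM Y p)) (fund EM Z p) = -gram EM ⁅X, Y⁆ Z p := by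
    intro X Y Z
    have h := hcov.torsion_free (smoothField_fund (EM := EM) (M := M) X) (smoothField_fund Y) p
    rw [mlieBracket_fund] at h
    have h2 : ∀ a b c w : EM, a - b = -c → innerB EM p a w - innerB EM p b w = -innerB EM p c w := by
      intro a b c w h
      rw [← LinearMap.sub_apply, ← map_sub, h, map_neg, LinearMap.neg_apply]
    exact h2 _ _ _ _ h
  have m1 := met X Y Z
  have m2 := met Y Z X
  have m3 := met Z X Y
  have t1 := tor X Y Z
  have t2 := tor Z X Y
  have t3 := tor Z Y X
  have s1 := gram_lie_skew (EM := EM) X Y Z p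
  have s2 := gram_lie_skew (EM := EM) X Z Y p
  have s3 := gram_lie_skew (EM := EM) Y Z X p
  rw [gram_comm Y] at m1
  rw [gram_comm Z] at m2
  rw [gram_comm X] at m3 ⊢
  linarith

end

end Gram

/-! ### Curvature on fundamental fields. -/

section Curvature

theorem diff_mul_add {E : Type*} [NormedAddCommGroup E] [NormedSpace ℝ E] {N : Type*}
    [TopologicalSpace N] [ChartedSpace E N] {f g h : N → ℝ} {x : N}
    (hf : MDifferentiableAt 𝓘(ℝ, E) 𝓘(ℝ, ℝ) f x) (hg : MDifferentiableAt 𝓘(ℝ, E) 𝓘(ℝ, ℝ) g x)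
    (hh : MDifferentiableAt 𝓘(ℝ, E) 𝓘(ℝ, ℝ) h x) (r : ℝ) (v : E) :
    diff E ℝ (fun y => r * (f y + g y + h y)) x v =
      r * (diff E ℝ f x v + diff E ℝ g x v + diff E ℝ h x v) := by
  have h1 := ((((hf.hasMFDerivAt.add hg.hasMFDerivAt).add hh.hasMFDerivAt).const_smul r)).mfderiv
  exact congrArg (fun L => L v) h1

variable {EG : Type*} [NormedAddCommGroup EG] [NormedSpace ℝ EG] [CompleteSpace EG]
  {G : Type*} [TopologicalSpace G] [ChartedSpace EG G] [Group G] [LieGroup 𝓘(ℝ, EG) ∞ G]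
  {EM : Type*} [NormedAddCommGroup EM] [NormedSpace ℝ EM] [FiniteDimensional ℝ EM]
  {M : Type*} [TopologicalSpace M] [ChartedSpace EM M] [IsManifold 𝓘(ℝ, EM) ∞ M]
  [RiemannianBundle (fun x : M => TangentSpace 𝓘(ℝ, EM) x)]
  [IsContMDiffRiemannianBundle 𝓘(ℝ, EM) ∞ EM (fun x : M => TangentSpace 𝓘(ℝ, EM) x)]
  [MulAction G M] [ContMDiffSMul 𝓘(ℝ, EG) 𝓘(ℝ, EM) ∞ G M]
  {cov : CovariantDerivative 𝓘(ℝ, EM) EM (fun x : M => TangentSpace 𝓘(ℝ, EM) x)}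

/-- Every bracket in the Koszul formula lies in `[m, m]` and vanishes at `o`. Here `m` stands for
`𝔪`, of which only this and surjectivity onto the tangent space are needed. -/
theorem IsLeviCivita.cov_fund_eq_zero (hcov : IsLeviCivita cov)
    (hiso : ∀ (g : G) (x : M) (u v : TangentSpace 𝓘(ℝ, EM) x),
      inner ℝ (mfderiv 𝓘(ℝ, EM) 𝓘(ℝ, EM) (fun y : M => g • y) x u)
        (mfderiv 𝓘(ℝ, EM) 𝓘(ℝ, EM) (fun y : M => g • y) x v) = inner ℝ u v)
    {m : Set (GroupLieAlgebra 𝓘(ℝ, EG) G)} {o : M}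
    (hm : ∀ X ∈ m, ∀ Y ∈ m, orb EG EM G o (⁅X, Y⁆ : GroupLieAlgebra 𝓘(ℝ, EG) G) = 0)
    (hspan : ∀ v : EM, ∃ X ∈ m, orb EG EM G o X = v)
    {Y : GroupLieAlgebra 𝓘(ℝ, EG) G} (hY : Y ∈ m) (v : EM) :
    cov (fund EM Y) o v = (0 : EM) := by
  obtain ⟨X, hX, rfl⟩ := hspan v
  refine eq_zero_of_innerB (EM := EM) o fun w => ?_
  obtain ⟨Z, hZ, rfl⟩ := hspan w
  refine (hcov.cov_fund hiso X Y Z o).trans ?_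
  rw [gram_eq_zero_left _ (hm X hX Y hY), gram_eq_zero_left _ (hm X hX Z hZ),
    gram_eq_zero_right _ (hm Y hY Z hZ)]
  simp

/-- Elements of the isotropy algebra act by skew endomorphisms. -/
theorem gram_skew
    (hiso : ∀ (g : G) (x : M) (u v : TangentSpace 𝓘(ℝ, EM) x),
      inner ℝ (mfderiv 𝓘(ℝ, EM) 𝓘(ℝ, EM) (fun y : M => g • y) x u)
        (mfderiv 𝓘(ℝ, EM) 𝓘(ℝ, EM) (fun y : M => g • y) x v) = inner ℝ u v)
    {o : M} {T : GroupLieAlgebra 𝓘(ℝ, EG) G} (hT : orb EG EM G o T = 0)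
    (Z W : GroupLieAlgebra 𝓘(ℝ, EG) G) :
    gram EM ⁅T, Z⁆ W o = -gram EM ⁅T, W⁆ Z o := by
  have h := diff_gram (EM := EM) hiso T Z W o
  rw [hT, map_zero, gram_comm Z] at h
  change (0 : ℝ) = _ at h
  linarith

theorem IsLeviCivita.curvature_fund (hcov : IsLeviCivita cov)
    (hiso : ∀ (g : G) (x : M) (u v : TangentSpace 𝓘(ℝ, EM) x),
      inner ℝ (mfderiv 𝓘(ℝ, EM) 𝓘(ℝ, EM) (fun y : M => g • y) x u)
        (mfderiv 𝓘(ℝ, EM) 𝓘(ℝ, EM) (fun y : M => g • y) x v) = inner ℝ u v)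
    {m : Set (GroupLieAlgebra 𝓘(ℝ, EG) G)} {o : M}
    (hm : ∀ X ∈ m, ∀ Y ∈ m, orb EG EM G o (⁅X, Y⁆ : GroupLieAlgebra 𝓘(ℝ, EG) G) = 0)
    (hspan : ∀ v : EM, ∃ X ∈ m, orb EG EM G o X = v)
    {X Y Z W : GroupLieAlgebra 𝓘(ℝ, EG) G} (hX : X ∈ m) (hY : Y ∈ m) (hZ : Z ∈ m) (hW : W ∈ m) :
    innerB EM o (curvature cov (fund EM X) (fund EM Y) (fund EM Z) o) (orb EG EM G o W) =
      -gram EM ⁅⁅X, Y⁆, Z⁆ W o := by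
  have hz : ∀ {Y : GroupLieAlgebra 𝓘(ℝ, EG) G}, Y ∈ m → ∀ v : EM, cov (fund EM Y) o v = (0 : EM) :=
    fun hY v => hcov.cov_fund_eq_zero hiso hm hspan hY v
  have hg : ∀ X Y : GroupLieAlgebra 𝓘(ℝ, EG) G,
      MDifferentiableAt 𝓘(ℝ, EM) 𝓘(ℝ, ℝ) (gram (M := M) EM X Y) o := fun X Y =>
    mdifferentiable_innerB (smoothField_fund X) (smoothField_fund Y) o
  -- The Koszul formula holds at every point, so it may be differentiated along `X*`. At `o` the
  -- inner products containing an unnested bracket from `[m, m]` vanish, and so does `⟨∇Z*, ∇W*⟩`.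
  have key : ∀ {X Y : GroupLieAlgebra 𝓘(ℝ, EG) G}, X ∈ m → Y ∈ m →
      innerB EM o (cov (fun y => cov (fund EM Z) y (fund EM Y y)) o (fund EM X o))
        (orb EG EM G o W) = 1 / 2 * (gram EM ⁅X, ⁅Y, Z⁆⁆ W o + gram EM ⁅X, ⁅Y, W⁆⁆ Z o +
          gram EM ⁅X, ⁅Z, W⁆⁆ Y o) := by
    intro X Y hX hY
    have h1 := hcov.diff_innerB (hcov.smoothField_cov (smoothField_fund (EM := EM) Z)
      (smoothField_fund Y)) (smoothField_fund W) o (fund EM X o)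
    have h2 : (fun p => innerB EM p (cov (fund EM Z) p (fund EM Y p)) (fund EM W p)) = fun p =>
        -(1 / 2) * (gram EM ⁅Y, Z⁆ W p + gram EM ⁅Y, W⁆ Z p + gram EM Y ⁅Z, W⁆ p) :=
      funext fun p => hcov.cov_fund hiso Y Z W p
    have h3 := (congrArg (fun f => diff EM ℝ f o (fund EM X o)) h2).symm.trans h1
    have h4 := diff_mul_add (hg ⁅Y, Z⁆ W) (hg ⁅Y, W⁆ Z) (hg Y ⁅Z, W⁆) (-(1 / 2)) (orb EG EM G o X)
    rw [diff_gram hiso, diff_gram hiso, diff_gram hiso, gram_eq_zero_left _ (hm Y hY Z hZ),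
      gram_eq_zero_left _ (hm Y hY W hW), gram_eq_zero_left _ (hm X hX Y hY)] at h4
    have h5 := h4.symm.trans h3
    have h6 : innerB EM o (cov (fund EM Z) o (fund EM Y o)) (cov (fund EM W) o (fund EM X o)) = 0 :=
      (congrArg (innerB EM o _) (hz hW _)).trans (map_zero _)
    have h7 : ∀ a b c : ℝ, a = b + c → c = 0 → b = a := by
      intros; linarith
    refine (h7 _ _ _ h5 h6).trans ?_
    rw [gram_comm Y]
    ring
  have h1 : innerB EM o (curvature cov (fund EM X) (fund EM Y) (fund EM Z) o) (orb EG EM G o W) =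
      innerB EM o (cov (fun y => cov (fund EM Z) y (fund EM Y y)) o (fund EM X o))
        (orb EG EM G o W) -
      innerB EM o (cov (fun y => cov (fund EM Z) y (fund EM X y)) o (fund EM Y o))
        (orb EG EM G o W) := by
    have h2 : ∀ a b c w : EM, c = 0 → innerB EM o (a - b - c) w =
        innerB EM o a w - innerB EM o b w := by
      rintro a b _ w rfl
      rw [sub_zero, map_sub, LinearMap.sub_apply]
    exact h2 _ _ _ _ (hz hZ _)
  rw [h1, key hX hY, key hY hX]
  -- The form `⟨[[A, B], C], D⟩` on `m` is skew in `A, B` and in `C, D` and satisfies the Bianchi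
  -- identity, which is the Jacobi identity. It is therefore symmetric under exchange of the two
  -- pairs, and the linear combination rests on this.
  have sk : ∀ {A B : GroupLieAlgebra 𝓘(ℝ, EG) G}, A ∈ m → B ∈ m →
      ∀ Z W : GroupLieAlgebra 𝓘(ℝ, EG) G, gram EM ⁅⁅A, B⁆, Z⁆ W o = -gram EM ⁅⁅A, B⁆, W⁆ Z o :=
    fun hA hB Z W => gram_skew hiso (hm _ hA _ hB) Z W
  have s0 := sk hX hY Z W
  have s1 := sk hZ hW X Y
  have s2 := sk hX hZ Y W
  have s3 := sk hX hW Y Z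
  have s4 := sk hY hZ X W
  have s5 := sk hY hW X Z
  have j := fun X Y Z W : GroupLieAlgebra 𝓘(ℝ, EG) G => gram_jacobi (EM := EM) X Y Z W o
  have k := fun X Y Z : GroupLieAlgebra 𝓘(ℝ, EG) G => gram_lie_skew (EM := EM) X Y Z o
  linarith [j X Y Z W, j X Y W Z, j X Z W Y, j Y Z W X, k ⁅X, Z⁆ W Y, k ⁅X, W⁆ Z Y, k ⁅Y, Z⁆ W X,
    k ⁅Y, W⁆ Z X, k ⁅Z, W⁆ X Y, k ⁅Z, W⁆ Y X, k ⁅X, Z⁆ Y W, k ⁅X, W⁆ Y Z, k ⁅Y, Z⁆ X W, k ⁅Y, W⁆ X Z]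

end Curvature

/-! ### Skewness of the curvature and arbitrary vector fields. -/

section Curvature

theorem contMDiff_innerB {EM : Type*} [NormedAddCommGroup EM] [NormedSpace ℝ EM]
    {M : Type*} [TopologicalSpace M] [ChartedSpace EM M] [IsManifold 𝓘(ℝ, EM) ∞ M]
    [RiemannianBundle (fun x : M => TangentSpace 𝓘(ℝ, EM) x)]
    [IsContMDiffRiemannianBundle 𝓘(ℝ, EM) ∞ EM (fun x : M => TangentSpace 𝓘(ℝ, EM) x)]
    {σ τ : ∀ x : M, TangentSpace 𝓘(ℝ, EM) x} (hσ : SmoothField σ) (hτ : SmoothField τ) :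
    ContMDiff 𝓘(ℝ, EM) 𝓘(ℝ, ℝ) ∞ (fun x => innerB EM x (σ x) (τ x)) := by
  have h : ContMDiff 𝓘(ℝ, EM) 𝓘(ℝ, ℝ) ∞ (fun y => inner ℝ (σ y) (τ y)) :=
    ContMDiff.inner_bundle (IB := 𝓘(ℝ, EM)) (F := EM)
      (E := fun x : M => TangentSpace 𝓘(ℝ, EM) x) (b := fun x => x) hσ hτ
  exact h

theorem diff_add {E : Type*} [NormedAddCommGroup E] [NormedSpace ℝ E] {N : Type*}
    [TopologicalSpace N] [ChartedSpace E N] {f g : N → ℝ} {x : N}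
    (hf : MDifferentiableAt 𝓘(ℝ, E) 𝓘(ℝ, ℝ) f x) (hg : MDifferentiableAt 𝓘(ℝ, E) 𝓘(ℝ, ℝ) g x)
    (v : E) :
    diff E ℝ (fun y => f y + g y) x v = diff E ℝ f x v + diff E ℝ g x v :=
  congrArg (fun L => L v) (hf.hasMFDerivAt.add hg.hasMFDerivAt).mfderiv

/-- The curvature is a skew endomorphism. -/
theorem IsLeviCivita.curvature_skew {EM : Type*} [NormedAddCommGroup EM] [NormedSpace ℝ EM]
    [FiniteDimensional ℝ EM]
    {M : Type*} [TopologicalSpace M] [ChartedSpace EM M] [IsManifold 𝓘(ℝ, EM) ∞ M]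
    [RiemannianBundle (fun x : M => TangentSpace 𝓘(ℝ, EM) x)]
    [IsContMDiffRiemannianBundle 𝓘(ℝ, EM) ∞ EM (fun x : M => TangentSpace 𝓘(ℝ, EM) x)]
    {cov : CovariantDerivative 𝓘(ℝ, EM) EM (fun x : M => TangentSpace 𝓘(ℝ, EM) x)}
    (hcov : IsLeviCivita cov) {X Y W Z : ∀ x : M, TangentSpace 𝓘(ℝ, EM) x}
    (hX : SmoothField X) (hY : SmoothField Y) (hW : SmoothField W) (hZ : SmoothField Z) {o : M}
    (hXY : mlieBracket 𝓘(ℝ, EM) X Y o = 0) (hZo : Z o ≠ 0) :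
    innerB EM o (curvature cov X Y W o) (Z o) =
      -innerB EM o (curvature cov X Y Z o) (W o) := by
  have D : ∀ {Y : ∀ x : M, TangentSpace 𝓘(ℝ, EM) x}, SmoothField Y →
      (fun p => diff EM ℝ (fun x => innerB EM x (W x) (Z x)) p (Y p)) = fun p =>
        innerB EM p (cov W p (Y p)) (Z p) + innerB EM p (W p) (cov Z p (Y p)) :=
    fun {Y} _ => funext fun p => hcov.diff_innerB hW hZ p (Y p)
  have m1 : ∀ {Y : ∀ x : M, TangentSpace 𝓘(ℝ, EM) x}, SmoothField Y →
      MDifferentiableAt 𝓘(ℝ, EM) 𝓘(ℝ, ℝ) (fun p => innerB EM p (cov W p (Y p)) (Z p)) o :=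
    fun hY => mdifferentiable_innerB (hcov.smoothField_cov hW hY) hZ o
  have m2 : ∀ {Y : ∀ x : M, TangentSpace 𝓘(ℝ, EM) x}, SmoothField Y →
      MDifferentiableAt 𝓘(ℝ, EM) 𝓘(ℝ, ℝ) (fun p => innerB EM p (W p) (cov Z p (Y p))) o :=
    fun hY => mdifferentiable_innerB hW (hcov.smoothField_cov hZ hY) o
  have key : ∀ {X Y : ∀ x : M, TangentSpace 𝓘(ℝ, EM) x}, SmoothField X → SmoothField Y →
      diff EM ℝ (fun p => diff EM ℝ (fun x => innerB EM x (W x) (Z x)) p (Y p)) o (X o) =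
      (innerB EM o (cov (fun y => cov W y (Y y)) o (X o)) (Z o) +
        innerB EM o (cov W o (Y o)) (cov Z o (X o))) +
      (innerB EM o (cov W o (X o)) (cov Z o (Y o)) +
        innerB EM o (W o) (cov (fun y => cov Z y (Y y)) o (X o))) := by
    intro X Y hX hY
    rw [D hY]
    refine (diff_add (m1 hY) (m2 hY) (X o)).trans ?_
    exact congrArg₂ (· + ·) (hcov.diff_innerB (hcov.smoothField_cov hW hY) hZ o (X o))
      (hcov.diff_innerB hW (hcov.smoothField_cov hZ hY) o (X o))
  have mD : ∀ {Y : ∀ x : M, TangentSpace 𝓘(ℝ, EM) x}, SmoothField Y →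
      MDifferentiableAt 𝓘(ℝ, EM) 𝓘(ℝ, ℝ)
        (fun p => diff EM ℝ (fun x => innerB EM x (W x) (Z x)) p (Y p)) o := by
    intro Y hY
    rw [D hY]
    exact (m1 hY).add (m2 hY)
  -- The two second derivatives of `⟨W, Z⟩` agree at `o`. The mixed products of `∇W` and `∇Z` cancel
  -- in the difference. `Z` doubles as the auxiliary field, whence the condition on `Z o`.
  have h := diff_diff_comm hX hY hZ (contMDiff_innerB hW hZ) (mD hX) (mD hY) hXY hZo
  have h1 := ((key hX hY).symm.trans h).trans (key hY hX)
  unfold curvature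
  rw [hXY, map_zero, map_zero, sub_zero, sub_zero]
  have e : ∀ a b c d z w p q r s : EM,
      (innerB EM o a z + innerB EM o p q) + (innerB EM o r s + innerB EM o w c) =
      (innerB EM o b z + innerB EM o r s) + (innerB EM o p q + innerB EM o w d) →
      innerB EM o (a - b) z = -innerB EM o (c - d) w := by
    intro a b c d z w p q r s h
    rw [innerB_comm o (c - d)]
    simp only [map_sub, LinearMap.sub_apply]
    linarith
  exact e _ _ _ _ _ _ _ _ _ _ h1

variable {EG : Type*} [NormedAddCommGroup EG] [NormedSpace ℝ EG] [CompleteSpace EG]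
  {G : Type*} [TopologicalSpace G] [ChartedSpace EG G] [Group G] [LieGroup 𝓘(ℝ, EG) ∞ G]
  {EM : Type*} [NormedAddCommGroup EM] [NormedSpace ℝ EM] [FiniteDimensional ℝ EM]
  {M : Type*} [TopologicalSpace M] [ChartedSpace EM M] [IsManifold 𝓘(ℝ, EM) ∞ M]
  [RiemannianBundle (fun x : M => TangentSpace 𝓘(ℝ, EM) x)]
  [IsContMDiffRiemannianBundle 𝓘(ℝ, EM) ∞ EM (fun x : M => TangentSpace 𝓘(ℝ, EM) x)]
  [MulAction G M] [ContMDiffSMul 𝓘(ℝ, EG) 𝓘(ℝ, EM) ∞ G M]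
  {cov : CovariantDerivative 𝓘(ℝ, EM) EM (fun x : M => TangentSpace 𝓘(ℝ, EM) x)}

/-- By tensoriality `U` and `V` may be taken fundamental, while `W` stays arbitrary: paired with a
fundamental field `Z*`, the value `R(U, V)W` is `-⟨R(U, V)Z*, W⟩`, which involves `W` only through
its value at `o`. -/
theorem IsLeviCivita.curvature_eq (hcov : IsLeviCivita cov)
    (hiso : ∀ (g : G) (x : M) (u v : TangentSpace 𝓘(ℝ, EM) x),
      inner ℝ (mfderiv 𝓘(ℝ, EM) 𝓘(ℝ, EM) (fun y : M => g • y) x u)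
        (mfderiv 𝓘(ℝ, EM) 𝓘(ℝ, EM) (fun y : M => g • y) x v) = inner ℝ u v)
    {m : Set (GroupLieAlgebra 𝓘(ℝ, EG) G)} {o : M}
    (hm : ∀ X ∈ m, ∀ Y ∈ m, orb EG EM G o (⁅X, Y⁆ : GroupLieAlgebra 𝓘(ℝ, EG) G) = 0)
    (hspan : ∀ v : EM, ∃ X ∈ m, orb EG EM G o X = v)
    {U V W : ∀ x : M, TangentSpace 𝓘(ℝ, EM) x}
    (hU : SmoothField U) (hV : SmoothField V) (hW : SmoothField W)
    {u v w : GroupLieAlgebra 𝓘(ℝ, EG) G} (hu : u ∈ m) (hv : v ∈ m) (hw : w ∈ m)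
    (hUo : U o = orb EG EM G o u) (hVo : V o = orb EG EM G o v) (hWo : W o = orb EG EM G o w) :
    curvature cov U V W o = -orb EG EM G o (⁅⁅u, v⁆, w⁆ : GroupLieAlgebra 𝓘(ℝ, EG) G) := by
  have hCS : CompleteSpace EM := FiniteDimensional.complete ℝ EM
  rw [hcov.curvature_congr hU (smoothField_fund u) hV (smoothField_fund v) hW hUo hVo]
  have hbr : mlieBracket 𝓘(ℝ, EM) (fund EM u) (fund EM v) o = 0 := by
    rw [mlieBracket_fund]
    have e : ∀ a : EM, a = 0 → -a = 0 := by simp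
    exact e _ (hm u hu v hv)
  have e1 : ∀ a b : EM, (∀ z, innerB EM o a z = innerB EM o b z) → a = b := by
    intro a b h
    refine sub_eq_zero.1 (eq_zero_of_innerB (EM := EM) o fun z => ?_)
    rw [map_sub, LinearMap.sub_apply, h, sub_self]
  refine e1 _ _ fun z => ?_
  obtain ⟨Z, hZ, rfl⟩ := hspan z
  by_cases hZo : orb EG EM G o Z = 0
  · rw [hZo, map_zero, map_zero]
  have h := hcov.curvature_skew (smoothField_fund u) (smoothField_fund v) hW
    (smoothField_fund Z) hbr hZo
  refine h.trans ?_
  rw [hWo]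
  refine (congrArg Neg.neg (hcov.curvature_fund hiso hm hspan hu hv hZ hw)).trans ?_
  rw [gram_skew hiso (hm u hu v hv), map_neg, LinearMap.neg_apply]
  simp [gram]

end Curvature

/-! ### The kernel of the orbit map's differential, by integral curves. -/

section IntegralCurve

theorem isMIntegralCurveAt_iff_diff {E : Type*} [NormedAddCommGroup E] [NormedSpace ℝ E]
    {N : Type*} [TopologicalSpace N] [ChartedSpace E N] {γ : ℝ → N}
    {v : ∀ x : N, TangentSpace 𝓘(ℝ, E) x} {t₀ : ℝ} :
    IsMIntegralCurveAt (I := 𝓘(ℝ, E)) γ v t₀ ↔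
      ∀ᶠ t in 𝓝 t₀, MDifferentiableAt 𝓘(ℝ, ℝ) 𝓘(ℝ, E) γ t ∧ diff ℝ E γ t 1 = v (γ t) := by
  refine eventually_congr (Eventually.of_forall fun t => ⟨fun h => ⟨h.mdifferentiableAt, ?_⟩, ?_⟩)
  · have e : ∀ w : E, ((1 : ℝ →L[ℝ] ℝ).smulRight w) 1 = w := by simp
    exact (congrArg (fun L => L 1) h.mfderiv).trans (e _)
  · rintro ⟨h1, h2⟩
    have h3 := h1.hasMFDerivAt
    have e : ∀ (L : ℝ →L[ℝ] E) (w : E), L 1 = w → L = (1 : ℝ →L[ℝ] ℝ).smulRight w := by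
      rintro L _ rfl
      ext
      simp
    have h4 : mfderiv 𝓘(ℝ, ℝ) 𝓘(ℝ, E) γ t = _ := e _ _ h2
    rw [h4] at h3
    exact h3

variable {EG : Type*} [NormedAddCommGroup EG] [NormedSpace ℝ EG]
  {G : Type*} [TopologicalSpace G] [ChartedSpace EG G] [Group G] [LieGroup 𝓘(ℝ, EG) ∞ G]

theorem exists_integralCurve [CompleteSpace EG] (X : GroupLieAlgebra 𝓘(ℝ, EG) G) :
    ∃ γ : ℝ → G, γ 0 = 1 ∧
      IsMIntegralCurveAt (I := 𝓘(ℝ, EG)) γ (mulInvariantVectorField X) 0 := by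
  have : IsManifold 𝓘(ℝ, EG) ∞ G := inferInstance
  have : IsManifold 𝓘(ℝ, EG) 1 G := IsManifold.of_le (n := ∞) (by simp)
  refine exists_isMIntegralCurveAt_of_contMDiffAt_boundaryless 0
    ((contMDiffAt_mulInvariantVectorField X).of_le ?_)
  rw [minSmoothness_of_isRCLikeNormedField]
  exact one_le_two

/-- A homomorphism of Lie groups maps integral curves to integral curves. -/
theorem IsMIntegralCurveAt.map_mulEquiv {Θ : G ≃* G}
    (hΘ : ContMDiff 𝓘(ℝ, EG) 𝓘(ℝ, EG) ∞ Θ) {X Y : GroupLieAlgebra 𝓘(ℝ, EG) G}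
    (hXY : diff EG EG Θ 1 X = Y) {γ : ℝ → G}
    (hγ : IsMIntegralCurveAt (I := 𝓘(ℝ, EG)) γ (mulInvariantVectorField X) 0) :
    IsMIntegralCurveAt (I := 𝓘(ℝ, EG)) (fun t => Θ (γ t)) (mulInvariantVectorField Y) 0 := by
  have hd : MDifferentiable 𝓘(ℝ, EG) 𝓘(ℝ, EG) Θ := hΘ.mdifferentiable (by simp)
  rw [isMIntegralCurveAt_iff_diff] at hγ ⊢
  filter_upwards [hγ] with t ⟨h1, h2⟩
  refine ⟨(hd _).comp t h1, ?_⟩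
  rw [diff_comp (g := Θ) (hd _) h1, ContinuousLinearMap.comp_apply, h2]
  have e1 := diff_comp (E := EG) (E' := EG) (E'' := EG) (g := Θ) (f := fun h => γ t * h) (x := 1)
    (hd _) (mdifferentiable_mul_left' (γ t) 1)
  have e2 := diff_comp (E := EG) (E' := EG) (E'' := EG) (g := fun h => Θ (γ t) * h) (f := Θ)
    (x := 1) (mdifferentiable_mul_left' (Θ (γ t)) _) (hd _)
  simp only [map_mul, mul_one, map_one] at e1 e2
  have e3 := congrArg (fun L => L X) (e1.symm.trans e2)
  refine Eq.trans e3 ?_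
  exact congrArg (diff EG EG (fun h => Θ (γ t) * h) 1) hXY

variable {EM : Type*} [NormedAddCommGroup EM] [NormedSpace ℝ EM]
  {M : Type*} [TopologicalSpace M] [ChartedSpace EM M]
  [MulAction G M] [ContMDiffSMul 𝓘(ℝ, EG) 𝓘(ℝ, EM) ∞ G M]

/-- The differential of the orbit map along a left invariant vector field. -/
theorem diff_orbit_mulInvariantVectorField (g : G) (o : M) (X : GroupLieAlgebra 𝓘(ℝ, EG) G) :
    diff EG EM (fun h : G => h • o) g (mulInvariantVectorField X g) =
      diff EM EM (fun y : M => g • y) o (orb EG EM G o X) := by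
  have e1 := diff_comp (E := EG) (E' := EG) (E'' := EM) (g := fun h : G => h • o)
    (f := fun h => g * h) (x := 1) (mdifferentiable_orbit EG EM o _) (mdifferentiable_mul_left' g 1)
  have e2 := diff_comp (E := EG) (E' := EM) (E'' := EM) (g := fun y : M => g • y)
    (f := fun h : G => h • o) (x := 1) (mdifferentiable_smul_left EG EM g _)
    (mdifferentiable_orbit EG EM o _)
  simp only [mul_smul, mul_one, one_smul] at e1 e2
  exact congrArg (fun L => L X) (e1.symm.trans e2)

theorem diff_curve_orbit {EG : Type*} [NormedAddCommGroup EG] [NormedSpace ℝ EG]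
    {G : Type*} [TopologicalSpace G] [ChartedSpace EG G] [Group G]
    {EM : Type*} [NormedAddCommGroup EM] [NormedSpace ℝ EM]
    {M : Type*} [TopologicalSpace M] [ChartedSpace EM M]
    [MulAction G M] [ContMDiffSMul 𝓘(ℝ, EG) 𝓘(ℝ, EM) ∞ G M] {γ : ℝ → G} {t : ℝ}
    (h1 : MDifferentiableAt 𝓘(ℝ, ℝ) 𝓘(ℝ, EG) γ t) (o : M) :
    diff ℝ EM (fun t => γ t • o) t 1 = diff EG EM (fun h : G => h • o) (γ t) (diff ℝ EG γ t 1) := by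
  rw [diff_comp (E' := EG) (g := fun h : G => h • o) (mdifferentiable_orbit EG EM o _) h1]
  rfl

/-- A vector of the Lie algebra fixed by an automorphism of `G` is tangent to the isotropy group,
if this contains the identity component of the group of fixed points. -/
theorem orb_eq_zero_of_fixed [CompleteSpace EG] {Θ : G ≃* G}
    (hΘ : ContMDiff 𝓘(ℝ, EG) 𝓘(ℝ, EG) ∞ Θ) {o : M}
    (hle : ∀ g ∈ connectedComponentIn {g : G | Θ g = g} 1, g • o = o)
    {X : GroupLieAlgebra 𝓘(ℝ, EG) G} (hX : diff EG EG Θ 1 X = X) :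
    orb EG EM G o X = 0 := by
  have : IsManifold 𝓘(ℝ, EG) ∞ G := inferInstance
  have : IsManifold 𝓘(ℝ, EG) 1 G := IsManifold.of_le (n := ∞) (by simp)
  obtain ⟨γ, hγ0, hγ⟩ := exists_integralCurve X
  -- `Θ ∘ γ` is an integral curve of the same left invariant field with the same initial value.
  have h1 : γ =ᶠ[𝓝 0] fun t => Θ (γ t) := by
    refine isMIntegralCurveAt_eventuallyEq_of_contMDiffAt_boundaryless (I := 𝓘(ℝ, EG)) ?_ hγ
      (IsMIntegralCurveAt.map_mulEquiv hΘ hX hγ) (by simp [hγ0])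
    refine (contMDiffAt_mulInvariantVectorField X).of_le ?_
    rw [minSmoothness_of_isRCLikeNormedField]
    exact one_le_two
  have h2 := isMIntegralCurveAt_iff_diff.1 hγ
  have h3 : (fun t => γ t • o) =ᶠ[𝓝 0] fun _ => o := by
    obtain ⟨ε, hε, hb⟩ := Metric.eventually_nhds_iff_ball.1 (h1.and h2)
    filter_upwards [Metric.ball_mem_nhds (0 : ℝ) hε] with t ht
    apply hle
    -- The image of a small interval is connected, contains `1` and is fixed by `Θ`, so it lies in
    -- the identity component of the fixed point set.
    have hc : IsPreconnected (γ '' Metric.ball 0 ε) :=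
      (convex_ball (0 : ℝ) ε).isPreconnected.image _
        fun s hs => (hb s hs).2.1.continuousAt.continuousWithinAt
    refine hc.subset_connectedComponentIn ⟨0, Metric.mem_ball_self hε, hγ0⟩ ?_ ⟨t, ht, rfl⟩
    rintro _ ⟨s, hs, rfl⟩
    exact (hb s hs).1.symm
  have h4 : diff ℝ EM (fun t => γ t • o) 0 = diff ℝ EM (fun _ : ℝ => o) 0 := h3.mfderiv_eq
  rw [diff_const] at h4
  have h5 := diff_curve_orbit (EM := EM) h2.self_of_nhds.1 o
  rw [h4, h2.self_of_nhds.2, hγ0] at h5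
  rw [diff_orbit_mulInvariantVectorField] at h5
  simp only [one_smul, diff_id] at h5
  exact h5.symm

/-- A vector tangent to the isotropy group is fixed by an automorphism of `G` which fixes the
isotropy group. -/
theorem fixed_of_orb_eq_zero [CompleteSpace EG] [IsManifold 𝓘(ℝ, EM) ∞ M] {Θ : G ≃* G}
    (hΘ : ContMDiff 𝓘(ℝ, EG) 𝓘(ℝ, EG) ∞ Θ) {o : M} (hle : ∀ g : G, g • o = o → Θ g = g)
    {X : GroupLieAlgebra 𝓘(ℝ, EG) G} (hX : orb EG EM G o X = 0) : diff EG EG Θ 1 X = X := by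
  have : IsManifold 𝓘(ℝ, EM) 1 M := IsManifold.of_le (n := ∞) (by simp)
  obtain ⟨γ, hγ0, hγ⟩ := exists_integralCurve X
  have h2 := isMIntegralCurveAt_iff_diff.1 hγ
  -- The velocity of `γ(t) • o` is a translate of `orb X = 0`. By uniqueness this curve is constant
  -- near `0`, so `γ(t)` is in the isotropy group and fixed by `Θ`.
  have h3 : IsMIntegralCurveAt (I := 𝓘(ℝ, EM)) (fun t => γ t • o) (fun _ => (0 : EM)) 0 := by
    refine isMIntegralCurveAt_iff_diff.2 ?_
    filter_upwards [h2] with t ⟨ht1, ht2⟩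
    refine ⟨(mdifferentiable_orbit EG EM o _).comp t ht1, ?_⟩
    rw [diff_curve_orbit ht1, ht2, diff_orbit_mulInvariantVectorField, hX, map_zero]
  have h4 : IsMIntegralCurveAt (I := 𝓘(ℝ, EM)) (fun _ => o) (fun _ => (0 : EM)) 0 := by
    refine isMIntegralCurveAt_iff_diff.2 (Eventually.of_forall fun t => ⟨mdifferentiableAt_const, ?_⟩)
    rw [diff_const]
    rfl
  have h5 : (fun t => γ t • o) =ᶠ[𝓝 0] fun _ => o :=
    isMIntegralCurveAt_eventuallyEq_of_contMDiffAt_boundaryless (I := 𝓘(ℝ, EM))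
      (contMDiff_zeroSection _ _ _) h3 h4 (by simp [hγ0])
  have h6 : (fun t => Θ (γ t)) =ᶠ[𝓝 0] γ := h5.mono fun t ht => hle _ ht
  have h7 : diff ℝ EG (fun t => Θ (γ t)) 0 = diff ℝ EG γ 0 := h6.mfderiv_eq
  rw [diff_comp (g := Θ) (hΘ.mdifferentiable (by simp) _) h2.self_of_nhds.1] at h7
  have h8 := congrArg (fun L => L 1) h7
  simp only [ContinuousLinearMap.comp_apply] at h8
  rw [h2.self_of_nhds.2, hγ0] at h8
  have h9 : (mulInvariantVectorField X (1 : G) : EG) = X := by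
    have : diff EG EG (fun h : G => 1 * h) 1 = ContinuousLinearMap.id ℝ EG := by
      simp only [one_mul]
      exact diff_id _
    exact congrArg (fun L => L X) this
  rwa [h9] at h8

end IntegralCurve

/-! ### The tangent space and the curvature of `G/K`. -/

section Space

variable {𝔤 : Type*} [LieRing 𝔤] [LieAlgebra ℝ 𝔤] {S : SymData 𝔤}
  {EG : Type*} [NormedAddCommGroup EG] [NormedSpace ℝ EG] [FiniteDimensional ℝ EG]
  {G : Type*} [TopologicalSpace G] [ChartedSpace EG G] [Group G] [LieGroup 𝓘(ℝ, EG) ∞ G]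
  {EM : Type*} [NormedAddCommGroup EM] [NormedSpace ℝ EM]
  {M : Type*} [TopologicalSpace M] [ChartedSpace EM M] [IsManifold 𝓘(ℝ, EM) ∞ M]
  [RiemannianBundle (fun x : M => TangentSpace 𝓘(ℝ, EM) x)] [MulAction G M]
  [ContMDiffSMul 𝓘(ℝ, EG) 𝓘(ℝ, EM) ∞ G M]
  {ι : 𝔤 ≃ₗ⁅ℝ⁆ GroupLieAlgebra 𝓘(ℝ, EG) G} {Θ : G ≃* G} {o : M}

/-- The kernel of the differential of the orbit map is `𝔨`. -/
theorem IsSymmetricSpace.orb_eq_zero_iff (h : IsSymmetricSpace (EM := EM) S ι Θ o) (X : 𝔤) :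
    orb EG EM G o (ι X) = 0 ↔ X ∈ S.𝔨 := by
  have hd : diff EG EG Θ 1 (ι X) = ι (S.σ X) :=
    congrArg (fun p : TangentBundle 𝓘(ℝ, EG) G => (p.2 : EG)) (h.Θ_deriv X)
  rw [S.mem_𝔨]
  constructor
  · intro h0
    exact ι.injective (hd.symm.trans (fixed_of_orb_eq_zero h.Θ_smooth h.isotropy_le h0))
  · intro h0
    rw [h0] at hd
    exact orb_eq_zero_of_fixed h.Θ_smooth h.le_isotropy hd

theorem IsSymmetricSpace.exists_orb (h : IsSymmetricSpace (EM := EM) S ι Θ o) (v : EM) :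
    ∃ X ∈ S.𝔪, orb EG EM G o (ι X) = v := by
  obtain ⟨Y, hY⟩ := h.submersion v
  obtain ⟨Z, rfl⟩ := ι.surjective Y
  -- The `𝔨`-component of a preimage lies in the kernel, so its `𝔪`-component has the same image.
  have hk : Z - (1 / 2 : ℝ) • (Z - S.σ Z) ∈ S.𝔨 := by
    rw [S.mem_𝔨]
    simp only [map_sub, map_smul, S.σ_invol]
    module
  refine ⟨(1 / 2 : ℝ) • (Z - S.σ Z), ?_, ?_⟩
  · rw [S.mem_𝔪]
    simp only [map_sub, map_smul, S.σ_invol]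
    module
  · have h1 := (h.orb_eq_zero_iff _).2 hk
    rw [map_sub] at h1
    have h2 : orb EG EM G o (ι Z) - orb EG EM G o (ι ((1 / 2 : ℝ) • (Z - S.σ Z))) = 0 :=
      (map_sub (orb EG EM G o) _ _).symm.trans h1
    exact (sub_eq_zero.1 h2).symm.trans hY

theorem IsSymmetricSpace.bijective (h : IsSymmetricSpace (EM := EM) S ι Θ o) :
    Function.Bijective (fun u : S.𝔪 => orbitDeriv EG (G := G) (EM := EM) o (ι u)) := by
  constructor
  · rintro ⟨u, hu⟩ ⟨v, hv⟩ huv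
    have h1 : orb EG EM G o (ι u) = orb EG EM G o (ι v) := huv
    have h2 : orb EG EM G o (ι (u - v)) = 0 := by
      rw [map_sub]
      exact (map_sub (orb EG EM G o) _ _).trans (sub_eq_zero.2 h1)
    exact Subtype.ext (sub_eq_zero.1
      (S.eq_zero_of_mem ((h.orb_eq_zero_iff _).1 h2) (S.𝔪.sub_mem hu hv)))
  · intro v
    obtain ⟨X, hX, hXv⟩ := h.exists_orb v
    exact ⟨⟨X, hX⟩, hXv⟩

/-- The point `x` with `x = o` is there for `1 • o`, over which the differential of the orbit map at
`1` takes its values. -/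
theorem IsSymmetricSpace.curvature_eq [FiniteDimensional ℝ EM]
    [IsContMDiffRiemannianBundle 𝓘(ℝ, EM) ∞ EM (fun x : M => TangentSpace 𝓘(ℝ, EM) x)]
    (h : IsSymmetricSpace (EM := EM) S ι Θ o)
    {cov : CovariantDerivative 𝓘(ℝ, EM) EM (fun x : M => TangentSpace 𝓘(ℝ, EM) x)}
    (hcov : IsLeviCivita cov) {U V W : ∀ x : M, TangentSpace 𝓘(ℝ, EM) x}
    (hU : SmoothField U) (hV : SmoothField V) (hW : SmoothField W)
    {u v w : 𝔤} (hu : u ∈ S.𝔪) (hv : v ∈ S.𝔪) (hw : w ∈ S.𝔪) {x : M} (hx : x = o)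
    (hUo : U x = orb EG EM G o (ι u)) (hVo : V x = orb EG EM G o (ι v))
    (hWo : W x = orb EG EM G o (ι w)) :
    curvature cov U V W x = -orb EG EM G o (ι ⁅⁅u, v⁆, w⁆) := by
  subst hx
  have hCS : CompleteSpace EG := FiniteDimensional.complete ℝ EG
  have key := hcov.curvature_eq (EG := EG) (G := G) (m := ι '' (S.𝔪 : Set 𝔤)) h.isometric ?_ ?_
    hU hV hW ⟨u, hu, rfl⟩ ⟨v, hv, rfl⟩ ⟨w, hw, rfl⟩ hUo hVo hWo
  · rw [key, LieEquiv.map_lie, LieEquiv.map_lie]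
  · rintro _ ⟨X, hX, rfl⟩ _ ⟨Y, hY, rfl⟩
    rw [← LieEquiv.map_lie]
    exact (h.orb_eq_zero_iff _).2 (S.lie_𝔪_𝔪 hX hY)
  · intro v
    obtain ⟨X, hX, hXv⟩ := h.exists_orb v
    exact ⟨ι X, ⟨X, hX, rfl⟩, hXv⟩

end Space

end Geometry

end SymmetricSpace

/-! ### The main theorem. -/

open SymmetricSpace in
theorem mainTheorem4 {𝔤 : Type*} [LieRing 𝔤] [LieAlgebra ℝ 𝔤] [FiniteDimensional ℝ 𝔤]
    (S : SymData 𝔤) :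
    (∀ (X : S.Form → ℂ ⊗[ℝ] 𝔤) (c : S.Form → S.Form → ℝ) (s : S.Form → ℂ),
      S.IsAdapted X c s →
      -- (a) the spaces `𝔨_α` and `𝔪_α`
      (∀ α ∈ S.Δ,
        (S.Generic α →
          incl '' (S.𝔨r α : Set 𝔤) = Set.range (fun z : ℂ => S.K X s α z) ∧
          incl '' (S.𝔪r α : Set 𝔤) = Set.range (fun z : ℂ => S.M X s α z)) ∧
        (S.σf α = α →
          incl '' (S.𝔨r α : Set 𝔤) = Set.range (fun z : ℂ => S.V X α z) ∧ S.𝔪r α = ⊥) ∧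
        (S.σf α = -α →
          incl '' (S.𝔨r α : Set 𝔤) = Set.range (fun t : ℝ => S.Kt X s α t) ∧
          incl '' (S.𝔪r α : Set 𝔤) = Set.range (fun t : ℝ => S.Mt X s α t))) ∧
      -- (b) the inner product
      (∀ α ∈ S.Δ, Pairwise fun i j : Fin 4 =>
        ∀ u ∈ ![S.𝔱 ⊓ S.𝔨, S.𝔞, S.𝔨r α, S.𝔪r α] i,
        ∀ v ∈ ![S.𝔱 ⊓ S.𝔨, S.𝔞, S.𝔨r α, S.𝔪r α] j, ip u v = 0) ∧
      (∀ α ∈ S.Δ, ∀ β ∈ S.Δ, S.Apart α β →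
        Pairwise fun i j : Fin 6 =>
          ∀ u ∈ ![S.𝔱 ⊓ S.𝔨, S.𝔞, S.𝔨r α, S.𝔪r α, S.𝔨r β, S.𝔪r β] i,
          ∀ v ∈ ![S.𝔱 ⊓ S.𝔨, S.𝔞, S.𝔨r α, S.𝔪r α, S.𝔨r β, S.𝔪r β] j, ip u v = 0) ∧
      (∀ α ∈ S.Δ,
        (S.Generic α → ∀ z w : ℂ,
          ipC (S.K X s α z) (S.K X s α w) = ((z * starRingEnd ℂ w).re : ℂ) ∧
          ipC (S.M X s α z) (S.M X s α w) = ((z * starRingEnd ℂ w).re : ℂ)) ∧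
        (S.σf α = α → ∀ z w : ℂ,
          ipC (S.V X α z) (S.V X α w) = ((z * starRingEnd ℂ w).re : ℂ)) ∧
        (S.σf α = -α → ∀ t t' : ℝ,
          ipC (S.Kt X s α t) (S.Kt X s α t') = ((t * t' : ℝ) : ℂ) ∧
          ipC (S.Mt X s α t) (S.Mt X s α t') = ((t * t' : ℝ) : ℂ))) ∧
      -- (c) the Lie brackets; first the general rules for `V`, which settle case (iv)
      (∀ α ∈ S.Δ, ∀ β ∈ S.Δ, ∀ z w : ℂ, ⁅S.V X α z, S.V X β w⁆ = S.VV X c α z β w) ∧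
      (∀ α ∈ S.Δ, ∀ (H : S.𝔱) (z : ℂ),
        ⁅(incl (H : 𝔤) : ℂ ⊗[ℝ] 𝔤), S.V X α z⁆ = S.V X α (α H * z)) ∧
      -- (c)(i)
      (∀ β ∈ S.Δ, S.Generic β → ∀ w : ℂ,
        S.K X s (S.σf β) w = s β • S.K X s β w ∧
        S.M X s (S.σf β) w = -(s β • S.M X s β w) ∧
        S.K X s (-β) w = -S.K X s β (starRingEnd ℂ w) ∧
        S.M X s (-β) w = -S.M X s β (starRingEnd ℂ w)) ∧
      (∀ α ∈ S.Δ, ∀ β ∈ S.Δ, S.Generic α → S.Generic β → S.Apart α β → ∀ z w : ℂ,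
        ⁅S.K X s α z, S.K X s β w⁆ = (1 / 2 : ℂ) •
          ((c α β : ℂ) • S.K X s (α + β) (z * w)
            - (c α (-β) : ℂ) • S.K X s (α - β) (z * starRingEnd ℂ w)
            + (s α * c (S.σf α) β) • S.K X s (S.σf α + β) (z * w)
            - (s α * c (S.σf α) (-β)) • S.K X s (S.σf α - β) (z * starRingEnd ℂ w)) ∧
        ⁅S.K X s α z, S.M X s β w⁆ = (1 / 2 : ℂ) •
          ((c α β : ℂ) • S.M X s (α + β) (z * w)
            - (c α (-β) : ℂ) • S.M X s (α - β) (z * starRingEnd ℂ w)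
            + (s α * c (S.σf α) β) • S.M X s (S.σf α + β) (z * w)
            - (s α * c (S.σf α) (-β)) • S.M X s (S.σf α - β) (z * starRingEnd ℂ w)) ∧
        ⁅S.M X s α z, S.M X s β w⁆ = (1 / 2 : ℂ) •
          ((c α β : ℂ) • S.K X s (α + β) (z * w)
            - (c α (-β) : ℂ) • S.K X s (α - β) (z * starRingEnd ℂ w)
            - (s α * c (S.σf α) β) • S.K X s (S.σf α + β) (z * w)
            + (s α * c (S.σf α) (-β)) • S.K X s (S.σf α - β) (z * starRingEnd ℂ w))) ∧
      (∀ α ∈ S.Δ, S.Generic α → ∀ z w : ℂ,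
        ⁅S.K X s α z, S.K X s α w⁆ =
          (1 / 2 * ((starRingEnd ℂ z * w).im : ℂ) * Complex.I) •
            (S.sharp α + S.sharp (S.σf α))
          + (SymData.rt * s α * c α (-S.σf α)) •
            S.Kt X s (α - S.σf α) (starRingEnd ℂ z * w).im ∧
        ⁅S.K X s α z, S.M X s α w⁆ =
          (1 / 2 * ((starRingEnd ℂ z * w).im : ℂ) * Complex.I) •
            (S.sharp α - S.sharp (S.σf α))
          + (SymData.rt * s α * c α (-S.σf α)) •
            S.Mt X s (α - S.σf α) (starRingEnd ℂ z * w).re ∧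
        ⁅S.M X s α z, S.M X s α w⁆ =
          (1 / 2 * ((starRingEnd ℂ z * w).im : ℂ) * Complex.I) •
            (S.sharp α + S.sharp (S.σf α))
          - (SymData.rt * s α * c α (-S.σf α)) •
            S.Kt X s (α - S.σf α) (starRingEnd ℂ z * w).im) ∧
      -- (c)(ii)
      (∀ α ∈ S.Δ, ∀ β ∈ S.Δ, S.σf α = α → S.Generic β → ∀ z w : ℂ,
        ⁅S.V X α z, S.K X s β w⁆ = SymData.rt •
          ((c α β : ℂ) • S.K X s (α + β) (z * w)
            - (c α (-β) : ℂ) • S.K X s (α - β) (z * starRingEnd ℂ w)) ∧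
        ⁅S.V X α z, S.M X s β w⁆ = SymData.rt •
          ((c α β : ℂ) • S.M X s (α + β) (z * w)
            - (c α (-β) : ℂ) • S.M X s (α - β) (z * starRingEnd ℂ w))) ∧
      -- (c)(iii)
      (∀ α ∈ S.Δ, ∀ β ∈ S.Δ, S.σf α = -α → S.Generic β → ∀ (t : ℝ) (z : ℂ),
        ⁅S.Kt X s α t, S.K X s β z⁆ = SymData.rt •
          ((c α β : ℂ) • S.K X s (α + β) (S.ζ s α * t * z)
            - (c α (-β) : ℂ) • S.K X s (α - β) (S.ζ s α * t * starRingEnd ℂ z)) ∧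
        ⁅S.Kt X s α t, S.M X s β z⁆ = SymData.rt •
          ((c α β : ℂ) • S.M X s (α + β) (S.ζ s α * t * z)
            - (c α (-β) : ℂ) • S.M X s (α - β) (S.ζ s α * t * starRingEnd ℂ z)) ∧
        ⁅S.Mt X s α t, S.K X s β z⁆ = SymData.rt •
          ((c α β : ℂ) • S.M X s (α + β) ((1 + Complex.I - S.ζ s α) * t * z)
            - (c α (-β) : ℂ) •
              S.M X s (α - β) ((1 + Complex.I - S.ζ s α) * t * starRingEnd ℂ z)) ∧
        ⁅S.Mt X s α t, S.M X s β z⁆ = SymData.rt •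
          ((c α β : ℂ) • S.K X s (α + β) ((1 + Complex.I - S.ζ s α) * t * z)
            - (c α (-β) : ℂ) •
              S.K X s (α - β) ((1 + Complex.I - S.ζ s α) * t * starRingEnd ℂ z))) ∧
      -- (c)(v)
      (∀ α ∈ S.Δ, ∀ β ∈ S.Δ, S.σf α = -α → S.σf β = β → ∀ (t : ℝ) (z : ℂ),
        ⁅S.Kt X s α t, S.V X β z⁆ = (c α β : ℂ) • S.K X s (α + β) (S.ζ s α * t * z) ∧
        ⁅S.Mt X s α t, S.V X β z⁆ =
          (c α β : ℂ) • S.M X s (α + β) ((1 + Complex.I - S.ζ s α) * t * z)) ∧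
      -- (c)(vi)
      (∀ α ∈ S.Δ, ∀ β ∈ S.Δ, S.σf α = -α → S.σf β = -β → ∀ t t' : ℝ,
        ⁅S.Kt X s α t, S.Kt X s β t'⁆ = S.VV X c α (S.ζ s α * t) β (S.ζ s β * t') ∧
        ⁅S.Kt X s α t, S.Mt X s β t'⁆ =
          S.VV X c α (S.ζ s α * t) β ((1 + Complex.I - S.ζ s β) * t') ∧
        ⁅S.Mt X s α t, S.Mt X s β t'⁆ =
          S.VV X c α ((1 + Complex.I - S.ζ s α) * t) β
            ((1 + Complex.I - S.ζ s β) * t'))) ∧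
    -- (d) the curvature tensor of `M = G/K` at the base point, `𝔪` being identified with the
    -- tangent space by the differential of the orbit map
    (∀ (EG : Type*) [NormedAddCommGroup EG] [NormedSpace ℝ EG] [FiniteDimensional ℝ EG]
      (G : Type*) [TopologicalSpace G] [ChartedSpace EG G] [Group G] [LieGroup 𝓘(ℝ, EG) ∞ G]
      (EM : Type*) [NormedAddCommGroup EM] [NormedSpace ℝ EM] [FiniteDimensional ℝ EM]
      (M : Type*) [TopologicalSpace M] [T2Space M] [ChartedSpace EM M]
      [IsManifold 𝓘(ℝ, EM) ∞ M]
      [RiemannianBundle (fun x : M => TangentSpace 𝓘(ℝ, EM) x)]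
      [IsContMDiffRiemannianBundle 𝓘(ℝ, EM) ∞ EM (fun x : M => TangentSpace 𝓘(ℝ, EM) x)]
      [MulAction G M] [ContMDiffSMul 𝓘(ℝ, EG) 𝓘(ℝ, EM) ∞ G M]
      (ι : 𝔤 ≃ₗ⁅ℝ⁆ GroupLieAlgebra 𝓘(ℝ, EG) G) (Θ : G ≃* G) (o : M),
      IsSymmetricSpace (EM := EM) S ι Θ o →
      Function.Bijective (fun u : S.𝔪 => orbitDeriv EG (G := G) (EM := EM) o (ι u)) ∧
      ∀ cov : CovariantDerivative 𝓘(ℝ, EM) EM (fun x : M => TangentSpace 𝓘(ℝ, EM) x),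
        IsLeviCivita cov →
        ∀ U V W : ∀ x : M, TangentSpace 𝓘(ℝ, EM) x,
          SmoothField U → SmoothField V → SmoothField W →
          ∀ u ∈ S.𝔪, ∀ v ∈ S.𝔪, ∀ w ∈ S.𝔪,
            U ((1 : G) • o) = orbitDeriv EG o (ι u) →
            V ((1 : G) • o) = orbitDeriv EG o (ι v) →
            W ((1 : G) • o) = orbitDeriv EG o (ι w) →
            curvature cov U V W ((1 : G) • o) = -orbitDeriv EG o (ι ⁅⁅u, v⁆, w⁆)) := by
  constructor
  · intro X c s h
    refine ⟨fun α hα => ⟨fun _ => ⟨h.image_𝔨r hα, h.image_𝔪r hα⟩,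
        fun hσ => ⟨h.range_V_of_fixed hα hσ, h.𝔪r_of_fixed hα hσ⟩,
        fun hσ => ⟨h.range_Kt hα hσ, h.range_Mt hα hσ⟩⟩,
      fun α hα => h.pairwise_four hα,
      fun α hα β hβ hab => h.pairwise_six hα hβ hab,
      fun α hα => ⟨fun hg z w => ⟨h.ipC_K hα hg z w, h.ipC_M hα hg z w⟩,
        fun _ z w => h.ipC_V hα z w, fun _ t t' => ⟨h.ipC_Kt hα t t', h.ipC_Mt hα t t'⟩⟩,
      fun α hα β hβ z w => h.lie_V hα hβ z w,
      fun α hα H z => h.lie_incl_V hα H z,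
      fun β hβ _ w => ⟨h.K_σf hβ w, h.M_σf hβ w, h.K_neg β w, h.M_neg β w⟩,
      fun α hα β hβ _ _ hab z w => h.lie_apart hα hβ hab z w,
      fun α hα hg z w => h.lie_diagonal hα hg z w,
      fun α hα β hβ hσ hg z w => ?_,
      fun α hα β hβ hσ hg t z => ?_,
      fun α hα β hβ h1 h2 t z => ⟨h.lie_Kt_V hα hβ h1 h2 t z, h.lie_Mt_V hα hβ h1 h2 t z⟩,
      fun α hα β hβ _ _ t t' => ?_⟩
    · obtain ⟨n1, n2⟩ := hg.ne_of_fixed hσ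
      exact h.lie_fixed hα hβ n1 n2 (h.σC_V_of_fixed hα hσ z) w
    · obtain ⟨n1, n2⟩ := hg.ne_of_neg hσ
      obtain ⟨e1, e2⟩ := h.lie_fixed hα hβ n1 n2 (h.σC_Kt hα hσ t) z
      obtain ⟨e3, e4⟩ := h.lie_antifixed hα hβ n1 n2 (h.σC_Mt hα hσ t) z
      rw [h.Kt_eq, h.Mt_eq]
      exact ⟨e1, e2, e3, e4⟩
    · simp only [h.Kt_eq, h.Mt_eq]
      exact ⟨h.lie_V hα hβ _ _, h.lie_V hα hβ _ _, h.lie_V hα hβ _ _⟩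
  · intro EG _ _ _ G _ _ _ _ EM _ _ _ M _ _ _ _ _ _ _ _ ι Θ o h
    refine ⟨h.bijective, ?_⟩
    intro cov hcov U V W hU hV hW u hu v hv w hw hUo hVo hWo
    exact h.curvature_eq hcov hU hV hW hu hv hw (one_smul G o) hUo hVo hWo
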